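/- Let $\Sigma$ be a finite alphabet and $R$ an arbitrary set (of weights). **Weighted automata.** An $R$-weighted automaton over $\Sigma$ is a tuple $\mathcal A=(Q,\Sigma,\Delta,\mathrm{wgt},I,F)$ with a finite set $Q$ of states, transitions $\Delta\subseteq Q\times\Sigma\times Q$, a weight function $\mathrm{wgt}\colon\Delta\to R$, and sets $I,F\subseteq Q$ of initial and final states. A run from $p$ to $q$ with label $a_1\cdots a_n\in\Sigma^+$ is a sequence of transitions $\delta_1\cdots\delta_n$, $\delta_i=(p_i,a_i,q_i)\in\Delta$, with $p_1=p$, $q_n=q$ and $q_i=p_{i+1}$ for $1\le i<n$; its weight sequence is $\mathrm{wgt}(\delta_1)\cdots\mathrm{wgt}(\delta_n)\in R^+$. It is successful if $p\in I$ and $q\in F$. The abstract semantics of $\mathcal A$ maps each $u\in\Sigma^+$ to the finite multiset $\{\!|\mathcal A|\!\}(u)$ of the weight sequences of all successful runs with label $u$ (one occurrence for each run). The automaton is *aperiodic* if there is an integer $m\ge1$ such that for all $p,q\in Q$ and all $u\in\Sigma^+$ there is a run from $p$ to $q$ with label $u^m$ if and only if there is one with label $u^{m+1}$. It is *polynomially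 ambiguous* if there is a polynomial $P$ such that each $w\in\Sigma^+$ labels at most $P(|w|)$ successful runs, *finitely ambiguous* if $P$ can be taken constant, and *unambiguous* if each $w\in\Sigma^+$ labels at most one successful run. **Weighted first-order logic.** The formulas $\varphi$ of $\mathsf{FO}$, $\Psi$ of $\mathsf{step\text{-}wFO}$ and $\Phi$ of $\mathsf{wFO}$ are given by $$\varphi::=\top\mid P_a(x)\mid x\le y\mid\neg\varphi\mid\varphi\wedge\varphi\mid\forall x\,\varphi,\qquad \Psi::=r\mid\varphi\,?\,\Psi:\Psi,\qquad \Phi::=\mathbf 0\mid\textstyle\prod_x\Psi\mid\varphi\,?\,\Phi:\Phi\mid\Phi+\Phi\mid\sum_x\Phi,$$ with $a\in\Sigma$, $r\in R$ and first-order variables $x,y$. Given $u\in\Sigma^+$ and a valuation $\sigma$ of the variables by positions in $\{1,\dots,|u|\}$, $\mathsf{FO}$ has its usual semantics on words ($P_a(x)$ says that position $x$ of $u$ carries the letter $a$); the value of $r$ is $r$, and $\varphi\,?\,X_1:X_2$ has the value of $X_1$ if $u,\sigma\models\varphi$ and that of $X_2$ otherwise, both for step formulas and for $\mathsf{wFO}$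 formulas; $\mathbf 0$ has as value the empty multiset; $\prod_x\Psi$ has as value the singleton multiset containing the sequence $r_1\cdots r_{|u|}$, where $r_i$ is the value of $\Psi$ at $(u,\sigma[x\mapsto i])$; the value of $\Phi_1+\Phi_2$ is the multiset union of the two values; and the value of $\sum_x\Phi$ is the multiset union of the values of $\Phi$ at $(u,\sigma[x\mapsto i])$ over $1\le i\le|u|$. A $\mathsf{wFO}$ sentence is a $\mathsf{wFO}$ formula $\Phi$ without free variables; its semantics $\{\!|\Phi|\!\}$ maps words $u\in\Sigma^+$ to finite multisets over $R^+$. **Theorem.** The following classes define the same functions from $\Sigma^+$ to finite multisets over $R^+$; that is, for each automaton of the first class there is a sentence of the second class with the same semantics, and conversely: 1. aperiodic polynomially ambiguous $R$-weighted automata over $\Sigma$, and $\mathsf{wFO}$ sentences; 2. aperiodic finitely ambiguous $R$-weighted automata over $\Sigma$, and $\mathsf{wFO}$ sentences in which no first-order sum $\sum_x$ occurs; 3. aperiodic unambiguous $R$-weighted automata over $\Sigma$, and $\mathsf{wFO}$ sentences in which neither a binary sum $+$ nor a first-order sum $\sum_x$ occurs. -/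

import Mathlib

/-! ### Weighted automata over a set `R` of weights -/

/-- An `R`-weighted automaton `(Q, Σ, Δ, wgt, I, F)` over the alphabet `α`, with a finite set of
states. The weight function is defined on the transitions only. -/
structure WAutomaton (α : Type*) (R : Type*) where
  /-- the states -/
  State : Type
  /-- there are finitely many states -/
  finite_state : Finite State
  /-- the transitions -/
  Δ : Set (State × α × State)
  /-- the weight of a transition -/
  wgt : Δ → R
  /-- the initial states -/
  init : Set State
  /-- the final states -/
  final : Set State

attribute [instance] WAutomaton.finite_state

namespace WAutomaton

variable {α R : Type*} (A : WAutomaton α R)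

/-- `A.IsRun p ρ q`: the sequence of transitions `ρ` is a run of `A` from `p` to `q`; the empty
sequence is a run from each state to itself. -/
def IsRun : A.State → List A.Δ → A.State → Prop
  | p, [], q => p = q
  | p, δ :: ρ, q => δ.1.1 = p ∧ IsRun δ.1.2.2 ρ q

/-- The word read by a sequence of transitions. -/
def label (ρ : List A.Δ) : List α := ρ.map fun δ => δ.1.2.1

/-- The weight sequence of a sequence of transitions. -/
def weight (ρ : List A.Δ) : List R := ρ.map A.wgt

/-- The runs from `p` to `q` with label `u`. -/
def runs (p q : A.State) (u : List α) : Set (List A.Δ) :=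
  {ρ | A.IsRun p ρ q ∧ A.label ρ = u}

/-- The runs with label `u` from some initial to some final state. -/
def successfulRuns (u : List α) : Set (List A.Δ) :=
  {ρ | ∃ p ∈ A.init, ∃ q ∈ A.final, ρ ∈ A.runs p q u}

/-- The set of labels of runs from `p` to `q`. -/
def lang (p q : A.State) : Set (List α) := {u | (A.runs p q u).Nonempty}

/-- Aperiodicity of the underlying non-deterministic automaton; `u ^ m` is written as the
concatenation of `m` copies of `u`. -/
def Aperiodic : Prop :=
  ∃ m : ℕ, 1 ≤ m ∧ ∀ (p q : A.State) (u : List α), u ≠ [] →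
    ((List.replicate m u).flatten ∈ A.lang p q ↔ (List.replicate (m + 1) u).flatten ∈ A.lang p q)

/-- The number of successful runs on a nonempty word is bounded by a polynomial in its length. -/
def PolynomiallyAmbiguous : Prop :=
  ∃ P : Polynomial ℕ, ∀ w : List α, w ≠ [] → (A.successfulRuns w).encard ≤ P.eval w.length

/-- The number of successful runs on a nonempty word is bounded by a constant. -/
def FinitelyAmbiguous : Prop :=
  ∃ k : ℕ, ∀ w : List α, w ≠ [] → (A.successfulRuns w).encard ≤ k

/-- Each nonempty word has at most one successful run. -/
def Unambiguous : Prop :=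
  ∀ w : List α, w ≠ [] → (A.successfulRuns w).encard ≤ 1

theorem finite_runs [Finite α] (p q : A.State) (u : List α) : (A.runs p q u).Finite := by
  refine (List.finite_length_eq A.Δ u.length).subset ?_
  rintro ρ ⟨-, h⟩
  simp [← h, label]

/-- The abstract semantics of `A` from `p` to `q`: the multiset of the weight sequences of the
runs from `p` to `q` with label `u`, each run counted once. -/
noncomputable def usemFrom [Finite α] (p q : A.State) (u : List α) : Multiset (List R) :=
  (A.finite_runs p q u).toFinset.val.map A.weight

/-- The abstract semantics of `A` on nonempty words: the multiset union of the semantics from `p`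
to `q` over all initial `p` and final `q`. -/
noncomputable def usem [Finite α] (u : {u : List α // u ≠ []}) : Multiset (List R) :=
  ∑ p ∈ A.init.toFinite.toFinset, ∑ q ∈ A.final.toFinite.toFinset, A.usemFrom p q u.1

end WAutomaton

/-! ### First-order logic on words; the first-order variables are the natural numbers -/

/-- First-order formulas: `⊤`, `P_a(x)`, `x ≤ y`, `¬ φ`, `φ ∧ ψ`, `∀ x φ`. -/
inductive FOFormula (α : Type*) where
  | top : FOFormula α
  | letter (a : α) (x : ℕ) : FOFormula α
  | le (x y : ℕ) : FOFormula α
  | not (φ : FOFormula α) : FOFormula α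
  | and (φ ψ : FOFormula α) : FOFormula α
  | all (x : ℕ) (φ : FOFormula α) : FOFormula α

namespace FOFormula

variable {α : Type*}

/-- The free variables. -/
def freeVars : FOFormula α → Finset ℕ
  | top => ∅
  | letter _ x => {x}
  | le x y => {x, y}
  | not φ => φ.freeVars
  | and φ ψ => φ.freeVars ∪ ψ.freeVars
  | all x φ => φ.freeVars.erase x

/-- `φ.Sat u σ` is `u, σ ⊨ φ`, where `σ` assigns positions of `u` to the variables. -/
def Sat (u : List α) : FOFormula α → (ℕ → Fin u.length) → Prop
  | top, _ => True
  | letter a x, σ => u.get (σ x) = a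
  | le x y, σ => σ x ≤ σ y
  | not φ, σ => ¬ φ.Sat u σ
  | and φ ψ, σ => φ.Sat u σ ∧ ψ.Sat u σ
  | all x φ, σ => ∀ i : Fin u.length, φ.Sat u (Function.update σ x i)

end FOFormula

/-! ### Weighted first-order logic -/

/-- Step formulas: constants `r` and `φ ? Ψ₁ : Ψ₂`. -/
inductive StepWFO (α : Type*) (R : Type*) where
  | const (r : R) : StepWFO α R
  | ite (φ : FOFormula α) (Ψ₁ Ψ₂ : StepWFO α R) : StepWFO α R

namespace StepWFO

variable {α R : Type*}

/-- The free variables. -/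
def freeVars : StepWFO α R → Finset ℕ
  | const _ => ∅
  | ite φ Ψ₁ Ψ₂ => φ.freeVars ∪ Ψ₁.freeVars ∪ Ψ₂.freeVars

open Classical in
/-- The semantics of a step formula, a single weight. -/
noncomputable def sem (u : List α) : StepWFO α R → (ℕ → Fin u.length) → R
  | const r, _ => r
  | ite φ Ψ₁ Ψ₂, σ => if φ.Sat u σ then Ψ₁.sem u σ else Ψ₂.sem u σ

end StepWFO

/-- wFO formulas: `0`, `∏ₓ Ψ`, `φ ? Φ₁ : Φ₂`, `Φ₁ + Φ₂`, `∑ₓ Φ`. -/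
inductive WFO (α : Type*) (R : Type*) where
  | zero : WFO α R
  | prod (x : ℕ) (Ψ : StepWFO α R) : WFO α R
  | ite (φ : FOFormula α) (Φ₁ Φ₂ : WFO α R) : WFO α R
  | add (Φ₁ Φ₂ : WFO α R) : WFO α R
  | sum (x : ℕ) (Φ : WFO α R) : WFO α R

namespace WFO

variable {α R : Type*}

/-- The free variables. -/
def freeVars : WFO α R → Finset ℕ
  | zero => ∅
  | prod x Ψ => Ψ.freeVars.erase x
  | ite φ Φ₁ Φ₂ => φ.freeVars ∪ Φ₁.freeVars ∪ Φ₂.freeVars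
  | add Φ₁ Φ₂ => Φ₁.freeVars ∪ Φ₂.freeVars
  | sum x Φ => Φ.freeVars.erase x

/-- A sentence has no free variables. -/
def IsSentence (Φ : WFO α R) : Prop := Φ.freeVars = ∅

/-- No first-order sum `∑ₓ` occurs in the formula. -/
def NoFirstOrderSum : WFO α R → Prop
  | zero => True
  | prod _ _ => True
  | ite _ Φ₁ Φ₂ => Φ₁.NoFirstOrderSum ∧ Φ₂.NoFirstOrderSum
  | add Φ₁ Φ₂ => Φ₁.NoFirstOrderSum ∧ Φ₂.NoFirstOrderSum
  | sum _ _ => False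

/-- No binary sum `+` occurs in the formula. -/
def NoBinarySum : WFO α R → Prop
  | zero => True
  | prod _ _ => True
  | ite _ Φ₁ Φ₂ => Φ₁.NoBinarySum ∧ Φ₂.NoBinarySum
  | add _ _ => False
  | sum _ Φ => Φ.NoBinarySum

open Classical in
/-- The semantics of a wFO formula on a word `u` with a valuation `σ`. -/
noncomputable def sem (u : List α) : WFO α R → (ℕ → Fin u.length) → Multiset (List R)
  | zero, _ => 0
  | prod x Ψ, σ => {List.ofFn fun i : Fin u.length => Ψ.sem u (Function.update σ x i)}
  | ite φ Φ₁ Φ₂, σ => if φ.Sat u σ then Φ₁.sem u σ else Φ₂.sem u σ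
  | add Φ₁ Φ₂, σ => Φ₁.sem u σ + Φ₂.sem u σ
  | sum x Φ, σ => ∑ i : Fin u.length, Φ.sem u (Function.update σ x i)

/-- The semantics of a sentence on nonempty words. The valuation that sends every variable to the
first position is an arbitrary choice; by `sem_eq_usem` it does not matter for sentences. -/
noncomputable def usem (Φ : WFO α R) (u : {u : List α // u ≠ []}) : Multiset (List R) :=
  Φ.sem u.1 fun _ => ⟨0, List.length_pos_iff.2 u.2⟩

end WFO

theorem FOFormula.sat_congr {α : Type*} (u : List α) (φ : FOFormula α) :
    ∀ σ τ : ℕ → Fin u.length, (∀ x ∈ φ.freeVars, σ x = τ x) → (φ.Sat u σ ↔ φ.Sat u τ) := by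
  induction φ with
  | top => simp [Sat]
  | letter a x => intro σ τ h; simp only [Sat, h x (by simp [freeVars])]
  | le x y =>
    intro σ τ h
    simp only [Sat, h x (by simp [freeVars]), h y (by simp [freeVars])]
  | not φ ih => intro σ τ h; simp only [Sat, ih σ τ h]
  | and φ ψ ih₁ ih₂ =>
    intro σ τ h
    simp only [freeVars, Finset.mem_union] at h
    simp only [Sat, ih₁ σ τ (fun x hx => h x (.inl hx)), ih₂ σ τ (fun x hx => h x (.inr hx))]
  | all x φ ih =>
    intro σ τ h
    refine forall_congr' fun i => ih _ _ fun y hy => ?_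
    by_cases hyx : y = x
    · subst hyx; simp
    · simpa [hyx] using h y (Finset.mem_erase.2 ⟨hyx, hy⟩)

theorem StepWFO.sem_congr {α R : Type*} (u : List α) (Ψ : StepWFO α R) :
    ∀ σ τ : ℕ → Fin u.length, (∀ x ∈ Ψ.freeVars, σ x = τ x) → Ψ.sem u σ = Ψ.sem u τ := by
  induction Ψ with
  | const r => simp [sem]
  | ite φ Ψ₁ Ψ₂ ih₁ ih₂ =>
    intro σ τ h
    simp only [freeVars, Finset.mem_union] at h
    have hφ := φ.sat_congr u σ τ fun x hx => h x (.inl (.inl hx))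
    simp only [sem, ih₁ σ τ (fun x hx => h x (.inl (.inr hx))),
      ih₂ σ τ (fun x hx => h x (.inr hx))]
    by_cases hs : φ.Sat u τ
    · rw [if_pos hs, if_pos (hφ.2 hs)]
    · rw [if_neg hs, if_neg (mt hφ.1 hs)]

theorem WFO.sem_congr {α R : Type*} (u : List α) (Φ : WFO α R) :
    ∀ σ τ : ℕ → Fin u.length, (∀ x ∈ Φ.freeVars, σ x = τ x) → Φ.sem u σ = Φ.sem u τ := by
  have upd : ∀ (s : Finset ℕ) (x : ℕ) (σ τ : ℕ → Fin u.length) (i : Fin u.length),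
      (∀ y ∈ s.erase x, σ y = τ y) →
        ∀ y ∈ s, Function.update σ x i y = Function.update τ x i y := by
    intro s x σ τ i h y hy
    by_cases hyx : y = x
    · subst hyx; simp
    · simpa [hyx] using h y (Finset.mem_erase.2 ⟨hyx, hy⟩)
  induction Φ with
  | zero => simp [sem]
  | prod x Ψ =>
    intro σ τ h
    simp only [sem]
    congr 2
    funext i
    exact Ψ.sem_congr u _ _ (upd _ x σ τ i h)
  | ite φ Φ₁ Φ₂ ih₁ ih₂ =>
    intro σ τ h
    simp only [freeVars, Finset.mem_union] at h
    have hφ := φ.sat_congr u σ τ fun x hx => h x (.inl (.inl hx))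
    simp only [sem, ih₁ σ τ (fun x hx => h x (.inl (.inr hx))),
      ih₂ σ τ (fun x hx => h x (.inr hx))]
    by_cases hs : φ.Sat u τ
    · rw [if_pos hs, if_pos (hφ.2 hs)]
    · rw [if_neg hs, if_neg (mt hφ.1 hs)]
  | add Φ₁ Φ₂ ih₁ ih₂ =>
    intro σ τ h
    simp only [freeVars, Finset.mem_union] at h
    simp only [sem, ih₁ σ τ (fun x hx => h x (.inl hx)), ih₂ σ τ (fun x hx => h x (.inr hx))]
  | sum x Φ ih =>
    intro σ τ h
    simp only [sem]
    exact Finset.sum_congr rfl fun i _ => ih _ _ (upd _ x σ τ i h)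

/-- For a sentence the valuation is irrelevant. -/
theorem WFO.sem_eq_usem {α R : Type*} (Φ : WFO α R) (hΦ : Φ.IsSentence)
    (u : {u : List α // u ≠ []}) (σ : ℕ → Fin u.1.length) : Φ.sem u.1 σ = Φ.usem u :=
  Φ.sem_congr u.1 _ _ fun x hx => by
    rw [hΦ] at hx
    simp at hx

/-!
Formulas and automata meet in the *recognizable series*: sums of finitely many functions, each of
which adds up, over all valuations of some further variables, a single weight sequence, subject to
a condition on the word with the valuation written into its letters as marks. Conditions and weights
are recognizable, that is, they depend on the word through a finite aperiodic monoid only.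

*Formulas define recognizable series.* By induction; a quantifier projects a mark away, and since
the mark occurs at most once, the projection preserves aperiodicity.

*Recognizable series are definable.* By the Schützenberger and McNaughton–Papert theorem, proved
with local divisors as by Diekert and Gastin: a product in an aperiodic monoid `M` is cut at the
occurrences of an element `c ≠ 1`, and the product of the blocks in between is computed in
`c M ∩ M c`, which is smaller than `M`.

*Recognizable series are accepted by automata.* The automaton guesses the marks; its state consists
of the product of the prefix already read and of the product of the suffix still to be read. Both
are determined by the marked word, so there is exactly one successful run for each valuation.

*Automata define recognizable series.* If a state of a polynomially ambiguous aperiodic automaton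
had two different loops with the same label, then the powers of this label would have exponentially
many runs. Hence a run is determined by its label and by its crossing transitions, those which leave
a strongly connected component. There are boundedly many of them in a run, and their positions are
the variables of the series.

*Bounded series need no sums.* Where a condition on one position holds at most `K` times, the first
position at which it holds is definable, so its summand can be split off as a series without that
variable; after `K` steps nothing is left.
-/

universe u v w

/-! ### Congruences with aperiodic quotient -/

/-- The power `x ^ n` of the word `x` in the free monoid. -/
def wordPow {B : Type*} (x : List B) (n : ℕ) : List B := (List.replicate n x).flatten

section WordPow

variable {B C : Type*}

@[simp] theorem wordPow_zero (x : List B) : wordPow x 0 = [] := rfl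

theorem wordPow_succ (x : List B) (n : ℕ) : wordPow x (n + 1) = x ++ wordPow x n := by
  simp [wordPow, List.replicate_succ]

theorem wordPow_add (x : List B) (m n : ℕ) :
    wordPow x (m + n) = wordPow x m ++ wordPow x n := by
  rw [wordPow, List.replicate_add, List.flatten_append]; rfl

theorem wordPow_nil (n : ℕ) : wordPow ([] : List B) n = [] := by simp [wordPow]

theorem map_wordPow (g : B → C) (x : List B) (n : ℕ) :
    (wordPow x n).map g = wordPow (x.map g) n := by
  simp [wordPow, List.map_flatten]

theorem length_wordPow (x : List B) (n : ℕ) : (wordPow x n).length = n * x.length := by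
  simp [wordPow]

theorem map_eq_wordPow_iff {π : C → B} {x : List B} {n : ℕ} {y : List C} :
    y.map π = wordPow x n ↔
      ∃ l : List (List C), l.length = n ∧ l.flatten = y ∧ ∀ z ∈ l, z.map π = x := by
  constructor
  · induction n generalizing y with
    | zero => exact fun hy => ⟨[], by simpa [eq_comm] using hy⟩
    | succ n ih =>
      intro hy
      obtain ⟨z, y, rfl, hz, hy⟩ := List.map_eq_append_iff.1 (hy.trans (wordPow_succ x n))
      obtain ⟨l, rfl, rfl, hl⟩ := ih hy
      exact ⟨z :: l, rfl, rfl, List.forall_mem_cons.2 ⟨hz, hl⟩⟩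
  · rintro ⟨l, rfl, rfl, hl⟩
    rw [List.map_flatten, List.map_congr_left hl, List.map_const', wordPow]

end WordPow

theorem apply_wordPow_eq_of_le {B T : Type*} {f : List B → T}
    (hf : ∀ {x x' y : List B}, f x = f x' → f (x ++ y) = f (x' ++ y)) {x : List B} {N : ℕ}
    (hN : f (wordPow x N) = f (wordPow x (N + 1))) {n : ℕ} (hn : N ≤ n) :
    f (wordPow x n) = f (wordPow x (n + 1)) := by
  obtain ⟨k, rfl⟩ := Nat.exists_eq_add_of_le hn
  rw [Nat.add_right_comm, wordPow_add, wordPow_add]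
  exact hf hN

/-- The kernel of `f` is a congruence of the free monoid on `B` and its quotient is aperiodic. When
`T` is finite, this says that `f` is computed by a morphism to a finite aperiodic monoid; working
with `f` instead of the morphism lets `T` be whatever set of values is at hand. -/
structure HasAperiodicKer {B : Type*} {T : Type*} (f : List B → T) : Prop where
  append : ∀ {x x' y y' : List B}, f x = f x' → f y = f y' → f (x ++ y) = f (x' ++ y')
  exists_wordPow : ∃ N : ℕ, ∀ x : List B, f (wordPow x N) = f (wordPow x (N + 1))

namespace HasAperiodicKer

variable {B C T T' : Type*} {f : List B → T}

theorem wordPow_eq_of_le (hf : HasAperiodicKer f) {N : ℕ}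
    (hN : ∀ x : List B, f (wordPow x N) = f (wordPow x (N + 1))) {n : ℕ} (hn : N ≤ n)
    (x : List B) : f (wordPow x n) = f (wordPow x (n + 1)) :=
  apply_wordPow_eq_of_le (fun h => hf.append h rfl) (hN x) hn

theorem append_append (hf : HasAperiodicKer f) {x x' : List B} (h : f x = f x')
    (y z : List B) : f (y ++ x ++ z) = f (y ++ x' ++ z) :=
  hf.append (hf.append rfl h) rfl

theorem comp_map (hf : HasAperiodicKer f) (g : C → B) :
    HasAperiodicKer fun x : List C => f (x.map g) where
  append h h' := by simpa using hf.append h h'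
  exists_wordPow := by
    obtain ⟨N, hN⟩ := hf.exists_wordPow
    exact ⟨N, fun x => by simpa only [map_wordPow] using hN (x.map g)⟩

theorem comp_injective (hf : HasAperiodicKer f) {g : T → T'} (hg : g.Injective) :
    HasAperiodicKer fun x => g (f x) where
  append h h' := congrArg g (hf.append (hg h) (hg h'))
  exists_wordPow := by
    obtain ⟨N, hN⟩ := hf.exists_wordPow
    exact ⟨N, fun x => congrArg g (hN x)⟩

theorem of_comp_injective {g : T → T'} (hf : HasAperiodicKer fun x => g (f x))
    (hg : g.Injective) : HasAperiodicKer f where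
  append h h' := hg (hf.append (congrArg g h) (congrArg g h'))
  exists_wordPow := by
    obtain ⟨N, hN⟩ := hf.exists_wordPow
    exact ⟨N, fun x => hg (hN x)⟩

theorem prodMk (hf : HasAperiodicKer f) {f' : List B → T'} (hf' : HasAperiodicKer f') :
    HasAperiodicKer fun x => (f x, f' x) where
  append h h' := by
    rw [Prod.mk.injEq] at h h' ⊢
    exact ⟨hf.append h.1 h'.1, hf'.append h.2 h'.2⟩
  exists_wordPow := by
    obtain ⟨N, hN⟩ := hf.exists_wordPow
    obtain ⟨N', hN'⟩ := hf'.exists_wordPow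
    exact ⟨max N N', fun x => Prod.ext (hf.wordPow_eq_of_le hN (le_max_left _ _) x)
      (hf'.wordPow_eq_of_le hN' (le_max_right _ _) x)⟩

theorem pi {ι : Type*} [Finite ι] {T : ι → Type*} {f : ∀ i, List B → T i}
    (hf : ∀ i, HasAperiodicKer (f i)) : HasAperiodicKer fun x i => f i x where
  append h h' := funext fun i => (hf i).append (congrFun h i) (congrFun h' i)
  exists_wordPow := by
    choose N hN using fun i => (hf i).exists_wordPow
    obtain ⟨M, hM⟩ := (Set.finite_range N).bddAbove
    exact ⟨M, fun x => funext fun i => (hf i).wordPow_eq_of_le (hN i) (hM ⟨i, rfl⟩) x⟩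

end HasAperiodicKer

/-! ### Projections with boundedly many marks -/

theorem exists_replicate_of_countP_le {B : Type*} [DecidableEq B] {b : B} {N k : ℕ} {l : List B}
    (hcount : l.countP (· ≠ b) ≤ k) (hl : (k + 1) * N ≤ l.length) :
    ∃ l₁ l₂, l = l₁ ++ List.replicate N b ++ l₂ := by
  rw [add_one_mul] at hl
  by_cases h0 : (l.take N).countP (· ≠ b) = 0
  · have htake : l.take N = List.replicate N b :=
      List.eq_replicate_iff.2 ⟨List.length_take_of_le (by lia), by simpa using h0⟩
    exact ⟨[], l.drop N, by rw [List.nil_append, ← htake, List.take_append_drop]⟩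
  · have hsplit : l.countP (· ≠ b) =
        (l.take N).countP (· ≠ b) + (l.drop N).countP (· ≠ b) := by
      rw [← List.countP_append, List.take_append_drop]
    obtain ⟨k, rfl⟩ : ∃ k', k = k' + 1 := Nat.exists_eq_add_one.2 (by lia)
    obtain ⟨l₁, l₂, h⟩ := exists_replicate_of_countP_le (k := k) (N := N) (l := l.drop N) (b := b)
      (by lia) (by rw [List.length_drop]; lia)
    refine ⟨l.take N ++ l₁, l₂, ?_⟩
    rw [List.append_assoc, List.append_assoc, ← List.append_assoc l₁, ← h, List.take_append_drop]
termination_by k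

section Projection

variable {B B' T : Type*} (f : List B' → T) (π : B' → B) (emb : B → B') (k : ℕ)

open Classical in
/-- The number of marked letters of a word over `B'`, where the letters `emb b` are those without a
mark and `π` erases the marks. -/
noncomputable def markCount (y : List B') : ℕ := y.countP fun b => emb (π b) ≠ b

/-- The values of `f` at the words which become `x` when their marks are erased, sorted by the
number of marks, up to the bound `k`. -/
def projectionValues (x : List B) : Fin (k + 1) → Set T := fun j =>
  {t | ∃ y : List B', y.map π = x ∧ markCount π emb y = j ∧ f y = t}

variable {f π emb k}

theorem markCount_append (y z : List B') :
    markCount π emb (y ++ z) = markCount π emb y + markCount π emb z :=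
  List.countP_append

theorem markCount_map_emb (hπ : Function.LeftInverse π emb) (x : List B) :
    markCount π emb (x.map emb) = 0 := by
  simp [markCount, hπ _]

theorem eq_map_emb_of_markCount_eq_zero {y : List B'} (h : markCount π emb y = 0) :
    y = (y.map π).map emb := by
  simp only [markCount, List.countP_eq_zero, decide_eq_true_eq, not_not] at h
  exact (List.map_map.trans (List.map_congr_left h) |>.trans (List.map_id' y)).symm

open Classical in
theorem countP_ne_le_markCount_flatten {x : List B} {l : List (List B')}
    (hl : ∀ z ∈ l, z.map π = x) :
    l.countP (· ≠ x.map emb) ≤ markCount π emb l.flatten := by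
  induction l with
  | nil => simp
  | cons z l ih =>
    obtain ⟨hz, hl⟩ := List.forall_mem_cons.1 hl
    have hmark : z ≠ x.map emb → 1 ≤ markCount π emb z := fun hne =>
      Nat.one_le_iff_ne_zero.2 fun h0 => hne (hz ▸ eq_map_emb_of_markCount_eq_zero h0)
    rw [List.flatten_cons, markCount_append, List.countP_cons, add_comm]
    refine Nat.add_le_add ?_ (ih hl)
    split_ifs with hne
    · exact hmark (of_decide_eq_true hne)
    · exact Nat.zero_le _

/-- Pigeonhole: of the `n` blocks of `y` over `x`, at most `k` are marked, hence `N` consecutive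
ones are not. -/
theorem exists_wordPow_factor {x : List B} {y : List B'} {N n : ℕ} (hn : (k + 1) * N ≤ n)
    (hy : y.map π = wordPow x n) (hk : markCount π emb y ≤ k) :
    ∃ (a b : ℕ) (y₁ y₂ : List B'), n = a + N + b ∧ y = y₁ ++ wordPow (x.map emb) N ++ y₂ ∧
      y₁.map π = wordPow x a ∧ y₂.map π = wordPow x b := by
  classical
  obtain ⟨l, rfl, rfl, hl⟩ := map_eq_wordPow_iff.1 hy
  obtain ⟨l₁, l₂, rfl⟩ :=
    exists_replicate_of_countP_le ((countP_ne_le_markCount_flatten hl).trans hk) hn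
  exact ⟨l₁.length, l₂.length, l₁.flatten, l₂.flatten, by simp; lia, by simp [wordPow],
    map_eq_wordPow_iff.2 ⟨l₁, rfl, rfl, fun z hz => hl z (by simp [hz])⟩,
    map_eq_wordPow_iff.2 ⟨l₂, rfl, rfl, fun z hz => hl z (by simp [hz])⟩⟩

theorem projectionValues_wordPow_subset (hf : HasAperiodicKer f)
    (hπ : Function.LeftInverse π emb) {x : List B} {N N' n n' : ℕ}
    (hN : f (wordPow (x.map emb) N) = f (wordPow (x.map emb) N')) (hn : (k + 1) * N ≤ n)
    (hn' : n + N' = n' + N) (j : Fin (k + 1)) :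
    projectionValues f π emb k (wordPow x n) j ⊆ projectionValues f π emb k (wordPow x n') j := by
  rintro t ⟨y, hy, hj, rfl⟩
  obtain ⟨a, b, y₁, y₂, rfl, rfl, h₁, h₂⟩ := exists_wordPow_factor hn hy (hj ▸ j.is_le)
  refine ⟨y₁ ++ wordPow (x.map emb) N' ++ y₂, ?_, ?_, hf.append_append hN.symm _ _⟩
  · obtain rfl : n' = a + N' + b := by lia
    simp [h₁, h₂, map_wordPow, wordPow_add, hπ.comp_eq_id]
  · simpa only [markCount_append, ← map_wordPow, markCount_map_emb hπ] using hj

theorem projectionValues_append_subset (hf : HasAperiodicKer f) {x x' y y' : List B}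
    (hx : projectionValues f π emb k x = projectionValues f π emb k x')
    (hy : projectionValues f π emb k y = projectionValues f π emb k y') (j : Fin (k + 1)) :
    projectionValues f π emb k (x ++ y) j ⊆ projectionValues f π emb k (x' ++ y') j := by
  rintro t ⟨z, hz, hj, rfl⟩
  obtain ⟨z₁, z₂, rfl, rfl, rfl⟩ := List.map_eq_append_iff.1 hz
  rw [markCount_append] at hj
  have h₁ : f z₁ ∈ projectionValues f π emb k (z₁.map π) ⟨markCount π emb z₁, by lia⟩ :=
    ⟨z₁, rfl, rfl, rfl⟩
  have h₂ : f z₂ ∈ projectionValues f π emb k (z₂.map π) ⟨markCount π emb z₂, by lia⟩ :=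
    ⟨z₂, rfl, rfl, rfl⟩
  rw [hx] at h₁
  rw [hy] at h₂
  obtain ⟨w₁, hw₁, hc₁, he₁⟩ := h₁
  obtain ⟨w₂, hw₂, hc₂, he₂⟩ := h₂
  refine ⟨w₁ ++ w₂, by rw [List.map_append, hw₁, hw₂], ?_, hf.append he₁ he₂⟩
  rw [markCount_append, hc₁, hc₂, ← hj]

theorem HasAperiodicKer.projectionValues (hf : HasAperiodicKer f)
    (hπ : Function.LeftInverse π emb) (k : ℕ) :
    HasAperiodicKer (projectionValues f π emb k) where
  append hx hy := funext fun j => (projectionValues_append_subset hf hx hy j).antisymm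
    (projectionValues_append_subset hf hx.symm hy.symm j)
  exists_wordPow := by
    obtain ⟨N, hN⟩ := hf.exists_wordPow
    refine ⟨(k + 1) * (N + 1), fun x => funext fun j => ?_⟩
    exact (projectionValues_wordPow_subset hf hπ (hN _) (by gcongr; lia) (by lia) j).antisymm
      (projectionValues_wordPow_subset hf hπ (hN _).symm (by lia) (by lia) j)

end Projection

/-! ### Words with a valuation -/

/-- A nonempty word together with a valuation of the variables `V` by its positions. -/
structure PointedWord (α : Type u) (V : Type) where
  word : List α
  ne : word ≠ []
  val : V → Fin word.length

/-- The variables in the marks of a word over the alphabet `α × Set V`. -/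
def allMarks {α : Type u} {V : Type} (y : List (α × Set V)) : Set V := ⋃ b ∈ y, b.2

/-- Each variable occurs in at most one of the marks. -/
def MarksDisjoint {α : Type u} {V : Type} (y : List (α × Set V)) : Prop :=
  y.Pairwise fun b c => Disjoint b.2 c.2

theorem pairwise_disjoint_append_iff {B S : Type*} {g h : B → Set S} {y z : List B} :
    (y ++ z).Pairwise (fun b c => Disjoint (g b) (h c)) ↔
      y.Pairwise (fun b c => Disjoint (g b) (h c)) ∧
      z.Pairwise (fun b c => Disjoint (g b) (h c)) ∧ Disjoint (⋃ b ∈ y, g b) (⋃ c ∈ z, h c) := by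
  rw [List.pairwise_append]
  simp only [Set.disjoint_iUnion_left]
  simp only [Set.disjoint_iUnion_right]

theorem hasAperiodicKer_pairwise_disjoint {B S : Type*} (g h : B → Set S) :
    HasAperiodicKer fun y : List B =>
      (⋃ b ∈ y, g b, ⋃ b ∈ y, h b, y.Pairwise fun b c => Disjoint (g b) (h c)) where
  append hx hy := by
    simp only [Prod.mk.injEq, eq_iff_iff] at hx hy ⊢
    simp only [pairwise_disjoint_append_iff, List.mem_append, Set.iUnion_or,
      Set.iUnion_union_distrib, hx, hy, and_self]
  exists_wordPow := by
    refine ⟨2, fun x => ?_⟩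
    simp only [wordPow_succ, wordPow_zero, List.append_nil, pairwise_disjoint_append_iff,
      List.mem_append, or_self, Prod.mk.injEq, eq_iff_iff, true_and]
    tauto

theorem hasAperiodicKer_exists_mem {B : Type*} (P : B → Prop) :
    HasAperiodicKer fun y : List B => ∃ b ∈ y, P b where
  append hx hy := by simp only [List.mem_append, or_and_right, exists_or, hx, hy]
  exists_wordPow := ⟨1, fun x => by simp [wordPow_succ]⟩

section Marks

variable {α : Type u} {V : Type}

theorem hasAperiodicKer_marks :
    HasAperiodicKer fun y : List (α × Set V) => (allMarks y, MarksDisjoint y) :=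
  (hasAperiodicKer_pairwise_disjoint Prod.snd Prod.snd).of_comp_injective
    (g := fun t : Set V × Prop => (t.1, t.1, t.2)) fun _ _ h => by simpa [Prod.ext_iff] using h

theorem allMarks_append (y z : List (α × Set V)) :
    allMarks (y ++ z) = allMarks y ∪ allMarks z := by
  simp only [allMarks, List.mem_append, Set.iUnion_or, Set.iUnion_union_distrib]

theorem marksDisjoint_append {y z : List (α × Set V)} : MarksDisjoint (y ++ z) ↔
    MarksDisjoint y ∧ MarksDisjoint z ∧ Disjoint (allMarks y) (allMarks z) :=
  pairwise_disjoint_append_iff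

theorem allMarks_cons (b : α × Set V) (y : List (α × Set V)) :
    allMarks (b :: y) = b.2 ∪ allMarks y := by
  simp [allMarks]

theorem marksDisjoint_cons {b : α × Set V} {y : List (α × Set V)} : MarksDisjoint (b :: y) ↔
    MarksDisjoint y ∧ Disjoint b.2 (allMarks y) := by
  simpa [MarksDisjoint, allMarks] using marksDisjoint_append (y := [b]) (z := y)

theorem markCount_le_of_marksDisjoint [Finite V] {y : List (α × Set V)} (h : MarksDisjoint y) :
    markCount Prod.fst (fun a => (a, (∅ : Set V))) y ≤ (allMarks y).ncard := by
  induction y with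
  | nil => simp [markCount]
  | cons b y ih =>
    rw [marksDisjoint_cons] at h
    rw [← List.singleton_append, markCount_append, List.singleton_append, allMarks_cons,
      Set.ncard_union_eq h.2]
    refine add_le_add ?_ (ih h.1)
    by_cases hb : b.2 = ∅
    · simp [markCount, ← hb]
    · exact List.countP_le_length.trans
        ((Set.ncard_pos (Set.toFinite _)).2 (Set.nonempty_iff_ne_empty.2 hb))

end Marks

namespace PointedWord

variable {α : Type u} {V V' W : Type}

/-- Substitution of variables. -/
def subst (p : PointedWord α V') (s : V → V') : PointedWord α V :=
  ⟨p.word, p.ne, fun x => p.val (s x)⟩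

/-- The extension of the valuation to one more variable `none`. -/
def extend (p : PointedWord α V) (i : Fin p.word.length) : PointedWord α (Option V) :=
  ⟨p.word, p.ne, fun o => o.elim i p.val⟩

/-- The extension of the valuation to the variables in `W`. -/
def append (p : PointedWord α V) (τ : W → Fin p.word.length) : PointedWord α (V ⊕ W) :=
  ⟨p.word, p.ne, Sum.elim p.val τ⟩

/-- The word over the extended alphabet `α × Set V` which encodes the valuation. -/
def mark (p : PointedWord α V) : List (α × Set V) :=
  List.ofFn fun i => (p.word.get i, {x | p.val x = i})

/-- The first position. -/
def first (p : PointedWord α V) : Fin p.word.length := ⟨0, List.length_pos_iff.2 p.ne⟩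

theorem ext_val {u : List α} (h h' : u ≠ []) {σ τ : V → Fin u.length} (hst : ∀ x, σ x = τ x) :
    (⟨u, h, σ⟩ : PointedWord α V) = ⟨u, h', τ⟩ := by
  obtain rfl : σ = τ := funext hst
  rfl

theorem length_mark (p : PointedWord α V) : p.mark.length = p.word.length := by simp [mark]

theorem getElem_mark (p : PointedWord α V) (i : ℕ) (hi : i < p.mark.length) :
    p.mark[i] = (p.word[i]'(p.length_mark ▸ hi),
      {x | p.val x = ⟨i, p.length_mark ▸ hi⟩}) := by
  simp [mark]

theorem mark_map_fst (p : PointedWord α V) : p.mark.map Prod.fst = p.word := by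
  simp [mark, List.map_ofFn, Function.comp_def]

theorem mark_subst (p : PointedWord α V') (s : V → V') :
    (p.subst s).mark = p.mark.map fun b => (b.1, s ⁻¹' b.2) := by
  simp [mark, List.map_ofFn, Function.comp_def, subst]

theorem mark_injective : Function.Injective (mark : PointedWord α V → List (α × Set V)) := by
  rintro ⟨u, hu, σ⟩ ⟨u', hu', τ⟩ h
  obtain rfl : u = u' := by simpa only [mark_map_fst] using congrArg (List.map Prod.fst) h
  refine ext_val hu hu' fun x => ?_
  have hx := congrArg Prod.snd (congrFun (List.ofFn_injective h) (σ x))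
  exact ((Set.ext_iff.1 hx x).1 rfl).symm

theorem marksDisjoint_mark (p : PointedWord α V) : MarksDisjoint p.mark :=
  List.pairwise_ofFn.2 fun _ _ hij =>
    Set.disjoint_left.2 fun _ hx hy => hij.ne (Eq.trans (Eq.symm hx) hy)

theorem allMarks_mark (p : PointedWord α V) : allMarks p.mark = Set.univ :=
  Set.eq_univ_of_forall fun x => Set.mem_biUnion (List.mem_ofFn.2 ⟨p.val x, rfl⟩) rfl

theorem exists_mark_eq {y : List (α × Set V)} (hne : y ≠ []) (hd : MarksDisjoint y)
    (hu : allMarks y = Set.univ) : ∃ p : PointedWord α V, p.mark = y := by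
  have hpos (x : V) : ∃ i : Fin y.length, x ∈ y[i].2 := by
    obtain ⟨b, hb, hx⟩ := Set.mem_iUnion₂.1 (hu ▸ Set.mem_univ x : x ∈ allMarks y)
    obtain ⟨i, hi, rfl⟩ := List.getElem_of_mem hb
    exact ⟨⟨i, hi⟩, hx⟩
  choose τ hτ using hpos
  have huniq {i : Fin y.length} {x : V} (hx : x ∈ y[i].2) : τ x = i := by
    by_contra hxi
    have hpw := List.pairwise_iff_getElem.1 hd
    rcases lt_or_gt_of_ne hxi with hlt | hlt
    · exact Set.disjoint_left.1 (hpw _ _ (τ x).2 i.2 hlt) (hτ x) hx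
    · exact Set.disjoint_left.1 (hpw _ _ i.2 (τ x).2 hlt) hx (hτ x)
  refine ⟨⟨y.map Prod.fst, by simpa using hne, fun x => (τ x).cast (by simp)⟩,
    List.ext_getElem (by simp [mark]) fun i _ hi => ?_⟩
  rw [getElem_mark]
  refine Prod.ext (by simp) (Set.ext fun x => ⟨fun hx => ?_, fun hx => ?_⟩)
  · obtain rfl : i = τ x := (congrArg Fin.val hx).symm
    exact hτ x
  · have hτi : τ x = ⟨i, hi⟩ := huniq hx
    exact Fin.ext (by simp [hτi])

theorem extend_subst_some (p : PointedWord α (Option V)) :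
    (p.subst some).extend (p.val none) = p :=
  ext_val _ _ fun o => by cases o <;> rfl

end PointedWord

/-! ### Recognizable functions of pointed words -/

open PointedWord

/-- `F` is recognized by a finite aperiodic monoid: it factors through a function with aperiodic
kernel and finitely many values on the encodings of the valuations. -/
def Recognizable {α : Type u} {V : Type} {X : Type*} (F : PointedWord α V → X) : Prop :=
  ∃ (n : ℕ) (f : List (α × Set V) → Fin n), HasAperiodicKer f ∧
    ∀ p q : PointedWord α V, f p.mark = f q.mark → F p = F q

namespace Recognizable

variable {α : Type u} {V V' : Type} {X Y : Type*}

theorem of_hasAperiodicKer {T : Type*} [Finite T] {f : List (α × Set V) → T}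
    (hf : HasAperiodicKer f) {F : PointedWord α V → X}
    (h : ∀ p q : PointedWord α V, f p.mark = f q.mark → F p = F q) : Recognizable F := by
  obtain ⟨n, ⟨e⟩⟩ := Finite.exists_equiv_fin T
  exact ⟨n, fun x => e (f x), hf.comp_injective e.injective,
    fun p q hpq => h p q (e.injective hpq)⟩

theorem comp {F : PointedWord α V → X} (hF : Recognizable F) (g : X → Y) :
    Recognizable fun p => g (F p) := by
  obtain ⟨n, f, hf, h⟩ := hF
  exact ⟨n, f, hf, fun p q hpq => congrArg g (h p q hpq)⟩

theorem prodMk {F : PointedWord α V → X} (hF : Recognizable F) {G : PointedWord α V → Y}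
    (hG : Recognizable G) : Recognizable fun p => (F p, G p) := by
  obtain ⟨n, f, hf, h⟩ := hF
  obtain ⟨m, g, hg, h'⟩ := hG
  refine of_hasAperiodicKer (hf.prodMk hg) fun p q hpq => ?_
  rw [Prod.mk.injEq] at hpq
  rw [h p q hpq.1, h' p q hpq.2]

theorem pi {ι : Type*} [Finite ι] {X : ι → Type*} {F : ∀ i, PointedWord α V → X i}
    (hF : ∀ i, Recognizable (F i)) : Recognizable fun p i => F i p := by
  choose n f hf h using hF
  exact of_hasAperiodicKer (HasAperiodicKer.pi hf)
    fun p q hpq => funext fun i => h i p q (congrFun hpq i)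

theorem const (x : X) : Recognizable fun _ : PointedWord α V => x :=
  of_hasAperiodicKer (T := Unit) (f := fun _ => ()) ⟨fun _ _ => rfl, 0, fun _ => rfl⟩
    fun _ _ _ => rfl

theorem subst {F : PointedWord α V → X} (hF : Recognizable F) (s : V → V') :
    Recognizable fun p : PointedWord α V' => F (p.subst s) := by
  obtain ⟨n, f, hf, h⟩ := hF
  refine of_hasAperiodicKer (hf.comp_map fun b : α × Set V' => (b.1, s ⁻¹' b.2)) fun p q hpq => ?_
  exact h _ _ (by simpa only [mark_subst] using hpq)

theorem ite {P : PointedWord α V → Prop} (hP : Recognizable P) [DecidablePred P]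
    {F G : PointedWord α V → X} (hF : Recognizable F) (hG : Recognizable G) :
    Recognizable fun p => if P p then F p else G p := by
  classical
  have := ((hP.prodMk hF).prodMk hG).comp fun x => if x.1.1 then x.1.2 else x.2
  convert this using 3

theorem not {P : PointedWord α V → Prop} (hP : Recognizable P) : Recognizable fun p => ¬ P p :=
  hP.comp Not

theorem and {P Q : PointedWord α V → Prop} (hP : Recognizable P) (hQ : Recognizable Q) :
    Recognizable fun p => P p ∧ Q p :=
  (hP.prodMk hQ).comp fun x => x.1 ∧ x.2

theorem letter (a : α) (x : V) :
    Recognizable fun p : PointedWord α V => p.word.get (p.val x) = a := by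
  have hmark (p : PointedWord α V) :
      (∃ b ∈ p.mark, b.1 = a ∧ x ∈ b.2) ↔ p.word.get (p.val x) = a := by
    simp [mark, List.mem_ofFn]
  refine of_hasAperiodicKer
    (hasAperiodicKer_exists_mem fun b : α × Set V => b.1 = a ∧ x ∈ b.2) fun p q hpq => ?_
  simpa only [hmark] using hpq

theorem lt (x y : V) : Recognizable fun p : PointedWord α V => p.val x < p.val y := by
  have hmark (p : PointedWord α V) :
      (p.mark.Pairwise fun b c => Disjoint {_u : Unit | x ∈ b.2} {_u : Unit | y ∈ c.2}) ↔
        ¬ p.val x < p.val y := by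
    rw [mark, List.pairwise_ofFn]
    simp only [Set.disjoint_left, Set.mem_ofPred_eq, forall_const]
    exact ⟨fun h hlt => h hlt rfl rfl, fun h i j hij hx hy => h (hx ▸ hy ▸ hij)⟩
  refine of_hasAperiodicKer (hasAperiodicKer_pairwise_disjoint
    (fun b : α × Set V => {_u : Unit | x ∈ b.2}) fun b => {_u | y ∈ b.2}) fun p q hpq => ?_
  simp only [Prod.mk.injEq, hmark, eq_iff_iff, not_iff_not] at hpq
  exact propext hpq.2.2

theorem le (x y : V) : Recognizable fun p : PointedWord α V => p.val x ≤ p.val y := by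
  simpa only [not_lt] using (lt y x).not

/-- Erases the mark `none`. -/
def eraseNone (b : α × Set (Option V)) : α × Set V := (b.1, some ⁻¹' b.2)

/-- Regards a letter as one without the mark `none`. -/
def embSome (b : α × Set V) : α × Set (Option V) := (b.1, some '' b.2)

theorem eraseNone_embSome :
    Function.LeftInverse eraseNone (embSome (α := α) (V := V)) := fun b => by
  simp [eraseNone, embSome, Set.preimage_image_eq _ (Option.some_injective V)]

theorem embSome_eraseNone_ne_iff {b : α × Set (Option V)} :
    embSome (eraseNone b) ≠ b ↔ none ∈ b.2 := by
  have hrange : b.2 ⊆ Set.range some ↔ none ∉ b.2 := by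
    rw [← Set.compl_subset_compl, Set.compl_range_some, Set.singleton_subset_iff,
      Set.mem_compl_iff]
  rw [ne_eq, Prod.ext_iff, embSome, eraseNone, Set.image_preimage_eq_iff, hrange]
  simp

theorem markCount_mark_extend (p : PointedWord α V) (i : Fin p.word.length) :
    markCount eraseNone embSome (p.extend i).mark = 1 := by
  classical
  have hmark : (p.extend i).mark =
      (List.finRange _).map fun j => (p.word.get j, {x | (p.extend i).val x = j}) :=
    List.ofFn_eq_map
  have hnone : (fun b : α × Set (Option V) => decide (none ∈ b.2)) ∘
      (fun j => (p.word.get j, {x | (p.extend i).val x = j})) = (· == i) := by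
    funext j
    simp [extend, eq_comm, Bool.beq_eq_decide_eq]
  simp only [markCount, embSome_eraseNone_ne_iff]
  rw [hmark, List.countP_map, hnone]
  exact List.count_eq_one_of_mem (List.nodup_finRange _) (List.mem_finRange i)

theorem exists_mark_extend_eq {p : PointedWord α V} {y : List (α × Set (Option V))}
    (hy : y.map eraseNone = p.mark) (hcount : markCount eraseNone embSome y = 1) :
    ∃ i, (p.extend i).mark = y := by
  classical
  simp only [markCount, embSome_eraseNone_ne_iff, List.countP_eq_length_filter] at hcount
  obtain ⟨b, hb⟩ := List.length_eq_one_iff.1 hcount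
  have hnone : b ∈ y ∧ none ∈ b.2 :=
    (List.mem_filter.1 (hb ▸ List.mem_singleton_self b)).imp_right of_decide_eq_true
  have hsome : (y.map eraseNone).Pairwise fun b c => Disjoint b.2 c.2 :=
    hy ▸ p.marksDisjoint_mark
  have honce : y.Pairwise fun b c => none ∈ b.2 → none ∈ c.2 → False :=
    (List.pairwise_filter.1 (hb ▸ List.pairwise_singleton (fun _ _ => False) b)).imp
      fun h hb hc => h (decide_eq_true hb) (decide_eq_true hc)
  have hdisjoint : MarksDisjoint y := by
    refine ((List.pairwise_map.1 hsome).and honce).imp fun {b c} h => ?_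
    refine Set.disjoint_left.2 fun o hob hoc => ?_
    cases o with
    | none => exact h.2 hob hoc
    | some x => exact Set.disjoint_left.1 h.1 hob hoc
  have hall : allMarks y = Set.univ := Set.eq_univ_of_forall fun o => by
    cases o with
    | none => exact Set.mem_biUnion hnone.1 hnone.2
    | some x =>
      have hx : x ∈ allMarks (y.map eraseNone) := hy ▸ p.allMarks_mark ▸ Set.mem_univ x
      simpa [allMarks, eraseNone] using hx
  obtain ⟨q, rfl⟩ := exists_mark_eq (List.ne_nil_of_mem hnone.1) hdisjoint hall
  obtain rfl : q.subst some = p := mark_injective ((mark_subst q some).trans hy)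
  exact ⟨q.val none, congrArg mark (extend_subst_some q)⟩

theorem range_extend {F : PointedWord α (Option V) → X} (hF : Recognizable F) :
    Recognizable fun p : PointedWord α V => Set.range fun i => F (p.extend i) := by
  obtain ⟨n, f, hf, h⟩ := hF
  have hsubset {p q : PointedWord α V} (hpq : projectionValues f eraseNone embSome 1 p.mark =
      projectionValues f eraseNone embSome 1 q.mark) :
      (Set.range fun i => F (p.extend i)) ⊆ Set.range fun i => F (q.extend i) := by
    rintro _ ⟨i, rfl⟩
    have hmem : f (p.extend i).mark ∈ projectionValues f eraseNone embSome 1 p.mark 1 :=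
      ⟨_, (mark_subst (p.extend i) some).symm, markCount_mark_extend p i, rfl⟩
    obtain ⟨y, hy, hcount, hfy⟩ := hpq ▸ hmem
    obtain ⟨j, rfl⟩ := exists_mark_extend_eq hy hcount
    exact ⟨j, h _ _ hfy⟩
  exact of_hasAperiodicKer (hf.projectionValues eraseNone_embSome 1) fun p q hpq =>
    (hsubset hpq).antisymm (hsubset hpq.symm)

theorem ex {P : PointedWord α (Option V) → Prop} (hP : Recognizable P) :
    Recognizable fun p : PointedWord α V => ∃ i, P (p.extend i) := by
  have := hP.range_extend.comp fun s => True ∈ s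
  simpa using this

theorem all {P : PointedWord α (Option V) → Prop} (hP : Recognizable P) :
    Recognizable fun p : PointedWord α V => ∀ i, P (p.extend i) := by
  have := hP.not.ex.not
  simpa using this

theorem extend_first {F : PointedWord α (Option V) → X} (hF : Recognizable F) :
    Recognizable fun p : PointedWord α V => F (p.extend p.first) := by
  have hmin : Recognizable fun p : PointedWord α (Option V) => ∀ i, p.val none ≤ i :=
    (le (some none) (none : Option (Option V))).all
  have hfirst (p : PointedWord α V) (i : Fin p.word.length) : (∀ j, i ≤ j) ↔ i = p.first :=
    ⟨fun h => le_antisymm (h _) (Nat.zero_le _), fun h j => h ▸ Nat.zero_le _⟩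
  obtain ⟨n, f, hf, h⟩ := (hmin.prodMk hF).range_extend
  refine ⟨n, f, hf, fun p q hpq => ?_⟩
  have hp : (True, F (p.extend p.first)) ∈
      Set.range fun i => (∀ j, (p.extend i).val none ≤ j, F (p.extend i)) :=
    ⟨p.first, Prod.ext (eq_true ((hfirst p _).2 rfl)) rfl⟩
  obtain ⟨j, hj⟩ := (h p q hpq).subset hp
  rw [Prod.mk.injEq, eq_iff_iff, iff_true] at hj
  obtain rfl := (hfirst q j).1 hj.1
  exact hj.2.symm

end Recognizable

/-! ### First-order definability -/

theorem mem_range_of_mem_erase {V : Type} {e : V → ℕ} {z : ℕ} {s : Finset ℕ}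
    (hs : ∀ x ∈ s, x ∈ Set.range fun o : Option V => o.elim z e) :
    ∀ x ∈ s.erase z, x ∈ Set.range e := by
  intro x hx
  obtain ⟨hxz, hx⟩ := Finset.mem_erase.1 hx
  obtain ⟨_ | y, rfl⟩ := hs x hx
  · exact absurd rfl hxz
  · exact ⟨y, rfl⟩

theorem PointedWord.update_elim {α : Type u} {V : Type} {e : V → ℕ} {z : ℕ}
    (hz : z ∉ Set.range e) {u : List α} (hu : u ≠ []) (σ : ℕ → Fin u.length)
    (i : Fin u.length) :
    (⟨u, hu, fun o : Option V => Function.update σ z i (o.elim z e)⟩ : PointedWord α (Option V)) =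
      (⟨u, hu, fun x => σ (e x)⟩ : PointedWord α V).extend i :=
  ext_val hu hu fun o => by
    cases o with
    | none => exact Function.update_self ..
    | some y => exact Function.update_of_ne (fun hy => hz ⟨y, hy⟩) ..

/-- `P` is first-order definable, whatever the names `e` of its variables. -/
def FODefinable {α : Type u} {V : Type} (P : PointedWord α V → Prop) : Prop :=
  ∀ e : V → ℕ, ∃ φ : FOFormula α, (∀ x ∈ φ.freeVars, x ∈ Set.range e) ∧
    ∀ (u : List α) (hu : u ≠ []) (σ : ℕ → Fin u.length),
      φ.Sat u σ ↔ P ⟨u, hu, fun x => σ (e x)⟩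

namespace FODefinable

variable {α : Type u} {V V' : Type} {P Q : PointedWord α V → Prop}

theorem congr (hP : FODefinable P) (h : ∀ p, P p ↔ Q p) : FODefinable Q := by
  obtain rfl : P = Q := funext fun p => propext (h p)
  exact hP

theorem not (hP : FODefinable P) : FODefinable fun p => ¬ P p := by
  intro e
  obtain ⟨φ, hφ, hPφ⟩ := hP e
  exact ⟨φ.not, hφ, fun u hu σ => not_congr (hPφ u hu σ)⟩

theorem const (c : Prop) : FODefinable fun _ : PointedWord α V => c := by
  have htrue : FODefinable fun _ : PointedWord α V => True :=
    fun _ => ⟨.top, by simp [FOFormula.freeVars], by simp [FOFormula.Sat]⟩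
  by_cases hc : c
  · exact htrue.congr (by simp [hc])
  · exact htrue.not.congr (by simp [hc])

theorem and (hP : FODefinable P) (hQ : FODefinable Q) : FODefinable fun p => P p ∧ Q p := by
  intro e
  obtain ⟨φ, hφ, hPφ⟩ := hP e
  obtain ⟨ψ, hψ, hQψ⟩ := hQ e
  refine ⟨φ.and ψ, ?_, fun u hu σ => and_congr (hPφ u hu σ) (hQψ u hu σ)⟩
  simp only [FOFormula.freeVars, Finset.mem_union]
  exact fun x hx => hx.elim (hφ x) (hψ x)

theorem or (hP : FODefinable P) (hQ : FODefinable Q) : FODefinable fun p => P p ∨ Q p :=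
  (hP.not.and hQ.not).not.congr fun p => by tauto

theorem imp (hP : FODefinable P) (hQ : FODefinable Q) : FODefinable fun p => P p → Q p :=
  (hP.not.or hQ).congr fun p => by tauto

theorem letter (a : α) (x : V) :
    FODefinable fun p : PointedWord α V => p.word.get (p.val x) = a :=
  fun e => ⟨.letter a (e x), by simp [FOFormula.freeVars], by simp [FOFormula.Sat]⟩

theorem le (x y : V) : FODefinable fun p : PointedWord α V => p.val x ≤ p.val y :=
  fun e => ⟨.le (e x) (e y), by simp [FOFormula.freeVars], by simp [FOFormula.Sat]⟩

theorem lt (x y : V) : FODefinable fun p : PointedWord α V => p.val x < p.val y :=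
  (le y x).not.congr fun _ => not_le

theorem eq (x y : V) : FODefinable fun p : PointedWord α V => p.val x = p.val y :=
  ((le x y).and (le y x)).congr fun _ => le_antisymm_iff.symm

theorem subst (hP : FODefinable P) (s : V → V') :
    FODefinable fun p : PointedWord α V' => P (p.subst s) := by
  intro e
  obtain ⟨φ, hφ, hPφ⟩ := hP fun x => e (s x)
  exact ⟨φ, fun x hx => Set.range_comp_subset_range s e (hφ x hx), hPφ⟩

theorem all [Finite V] {P : PointedWord α (Option V) → Prop} (hP : FODefinable P) :
    FODefinable fun p : PointedWord α V => ∀ i, P (p.extend i) := by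
  intro e
  obtain ⟨z, hz⟩ := (Set.finite_range e).exists_notMem
  obtain ⟨φ, hφ, hPφ⟩ := hP fun o => o.elim z e
  exact ⟨.all z φ, mem_range_of_mem_erase hφ, fun u hu σ => forall_congr' fun i =>
    (hPφ u hu _).trans (iff_of_eq (congrArg P (update_elim hz hu σ i)))⟩

theorem ex [Finite V] {P : PointedWord α (Option V) → Prop} (hP : FODefinable P) :
    FODefinable fun p : PointedWord α V => ∃ i, P (p.extend i) :=
  hP.not.all.not.congr fun p => by simp

theorem exists_of_finite {ι : Type*} [Finite ι] {P : ι → PointedWord α V → Prop}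
    (hP : ∀ i, FODefinable (P i)) : FODefinable fun p => ∃ i, P i p := by
  classical
  have := Fintype.ofFinite ι
  have hfinset (s : Finset ι) : FODefinable fun p => ∃ i ∈ s, P i p := by
    induction s using Finset.induction_on with
    | empty => exact (const False).congr (by simp)
    | insert i s _ ih => exact ((hP i).or ih).congr (by simp)
  exact (hfinset Finset.univ).congr (by simp)

theorem forall_of_finite {ι : Type*} [Finite ι] {P : ι → PointedWord α V → Prop}
    (hP : ∀ i, FODefinable (P i)) : FODefinable fun p => ∀ i, P i p :=
  (exists_of_finite fun i => (hP i).not).not.congr fun p => by simp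

end FODefinable

/-- All fibres of `F` are first-order definable. -/
def FODefinableFun {α : Type u} {V : Type} {X : Type*} (F : PointedWord α V → X) : Prop :=
  ∀ x, FODefinable fun p => F p = x

namespace FODefinableFun

variable {α : Type u} {V V' : Type} {X Y Z : Type*}

theorem comp [Finite X] {F : PointedWord α V → X} (hF : FODefinableFun F) (g : X → Y) :
    FODefinableFun fun p => g (F p) := fun y =>
  (FODefinable.exists_of_finite fun x => (hF x).and (.const (g x = y))).congr fun p => by simp

theorem map₂ [Finite X] [Finite Y] {F : PointedWord α V → X} (hF : FODefinableFun F)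
    {G : PointedWord α V → Y} (hG : FODefinableFun G) (g : X → Y → Z) :
    FODefinableFun fun p => g (F p) (G p) := fun z =>
  (FODefinable.exists_of_finite fun x : X × Y =>
    ((hF x.1).and (hG x.2)).and (.const (g x.1 x.2 = z))).congr fun p => by simp

theorem ite {P : PointedWord α V → Prop} (hP : FODefinable P) [DecidablePred P]
    {F G : PointedWord α V → X} (hF : FODefinableFun F) (hG : FODefinableFun G) :
    FODefinableFun fun p => if P p then F p else G p := fun x =>
  ((hP.and (hF x)).or (hP.not.and (hG x))).congr fun p => by
    by_cases h : P p <;> simp [h]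

theorem const (x : X) : FODefinableFun fun _ : PointedWord α V => x := fun _ => .const _

theorem subst {F : PointedWord α V → X} (hF : FODefinableFun F) (s : V → V') :
    FODefinableFun fun p : PointedWord α V' => F (p.subst s) := fun x => (hF x).subst s

theorem subst_extend {F : PointedWord α (Option V) → X} (hF : FODefinableFun F) (s : V → V')
    (x : V') : FODefinableFun fun p : PointedWord α V' => F ((p.subst s).extend (p.val x)) := by
  have helim (p : PointedWord α V') :
      p.subst (fun o : Option V => o.elim x s) = (p.subst s).extend (p.val x) :=
    ext_val _ _ fun o => by cases o <;> rfl
  simpa only [helim] using hF.subst fun o : Option V => o.elim x s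

end FODefinableFun

/-! ### Local divisors -/

/-- The local divisor `cM ∩ Mc` of a monoid `M` at `c`, a monoid under `xc ∘ cy = xcy` with
neutral element `c`. -/
def LocalDivisor {M : Type*} [Monoid M] (c : M) : Type _ :=
  {m : M // (∃ x, m = x * c) ∧ ∃ y, m = c * y}

namespace LocalDivisor

variable {M : Type*} [Monoid M] {c : M}

noncomputable instance : Mul (LocalDivisor c) :=
  ⟨fun m n => ⟨m.2.1.choose * n.1, by
    obtain ⟨x, hx⟩ := n.2.1
    obtain ⟨y, hy⟩ := n.2.2
    obtain ⟨z, hz⟩ := m.2.2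
    refine ⟨⟨m.2.1.choose * x, by rw [hx, mul_assoc]⟩, ⟨z * y, ?_⟩⟩
    rw [hy, ← mul_assoc, ← m.2.1.choose_spec, hz, mul_assoc]⟩⟩

instance : One (LocalDivisor c) := ⟨⟨c, ⟨1, by simp⟩, ⟨1, by simp⟩⟩⟩

/-- The block `y` between two occurrences of `c` as an element of the local divisor. -/
def conj (c y : M) : LocalDivisor c := ⟨c * y * c, ⟨_, rfl⟩, ⟨_, mul_assoc _ _ _⟩⟩

theorem coe_one : (1 : LocalDivisor c).1 = c := rfl

theorem coe_mul_right (m n : LocalDivisor c) {y : M} (h : n.1 = c * y) :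
    (m * n).1 = m.1 * y := by
  change m.2.1.choose * n.1 = _
  rw [h, ← mul_assoc, ← m.2.1.choose_spec]

theorem coe_mul_left (m n : LocalDivisor c) {x : M} (h : m.1 = x * c) :
    (m * n).1 = x * n.1 := by
  obtain ⟨y, hy⟩ := n.2.2
  rw [coe_mul_right m n hy, h, hy, mul_assoc]

theorem coe_mul_conj (m : LocalDivisor c) (y : M) : (m * conj c y).1 = m.1 * (y * c) :=
  coe_mul_right m _ (mul_assoc c y c)

noncomputable instance : Monoid (LocalDivisor c) where
  mul_assoc m n k := by
    obtain ⟨x, hx⟩ := m.2.1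
    obtain ⟨y, hy⟩ := n.2.1
    apply Subtype.ext
    rw [coe_mul_left (m * n) k (x := x * y) (by rw [coe_mul_left m n hx, hy, mul_assoc]),
      coe_mul_left m (n * k) hx, coe_mul_left n k hy, mul_assoc]
  one_mul m := Subtype.ext (by rw [coe_mul_left 1 m (x := 1) (by simp [coe_one]), one_mul])
  mul_one m := Subtype.ext (by rw [coe_mul_right m 1 (y := 1) (by simp [coe_one]), mul_one])

theorem coe_pow (m : LocalDivisor c) {x : M} (h : m.1 = x * c) (n : ℕ) :
    (m ^ n).1 = x ^ n * c := by
  induction n with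
  | zero => simp [coe_one]
  | succ n ih => rw [pow_succ', coe_mul_left m _ h, ih, pow_succ', mul_assoc]

theorem pow_eq_pow_succ {N : ℕ} (hN : ∀ x : M, x ^ N = x ^ (N + 1)) (m : LocalDivisor c) :
    m ^ N = m ^ (N + 1) := by
  obtain ⟨x, hx⟩ := m.2.1
  exact Subtype.ext (by rw [m.coe_pow hx, m.coe_pow hx, hN])

theorem card_lt [Finite M] {N : ℕ} (hN : ∀ x : M, x ^ N = x ^ (N + 1)) (hc : c ≠ 1) :
    Nat.card (LocalDivisor c) < Nat.card M := by
  refine Finite.card_subtype_lt (x := 1) ?_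
  rintro ⟨-, y, hy⟩
  have h (n : ℕ) : c ^ n * y ^ n = 1 := by
    induction n with
    | zero => simp
    | succ n ih => rw [pow_succ c, pow_succ' y, mul_assoc, ← mul_assoc c, ← hy, one_mul, ih]
  refine hc ?_
  calc c = c * (c ^ N * y ^ N) := by rw [h, mul_one]
    _ = c ^ (N + 1) * y ^ N := by rw [← mul_assoc, ← pow_succ']
    _ = 1 := by rw [← hN, h]

instance [Finite M] : Finite (LocalDivisor c) := Subtype.finite

end LocalDivisor

section LocalFactorization

variable {M : Type*} [Monoid M] {n : ℕ}

theorem prod_ofFn_succ (g : Fin (n + 1) → M) :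
    (List.ofFn g).prod = (List.ofFn fun i => g i.castSucc).prod * g (Fin.last n) := by
  rw [List.ofFn_succ', List.concat_eq_append, List.prod_append, List.prod_singleton]

theorem prod_ofFn_eq_one {g : Fin n → M} (h : ∀ i, g i = 1) : (List.ofFn g).prod = 1 :=
  List.prod_eq_one (List.forall_mem_ofFn_iff.2 h)

open Classical in
/-- The elements of the sequence before the first occurrence of `c`, padded by `1`. -/
noncomputable def beforeFirst (c : M) (g : Fin n → M) (i : Fin n) : M :=
  if ∀ j ≤ i, g j ≠ c then g i else 1

open Classical in
/-- The elements of the sequence after the last occurrence of `c`, padded by `1`. -/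
noncomputable def afterLast (c : M) (g : Fin n → M) (i : Fin n) : M :=
  if ∀ j ≥ i, g j ≠ c then g i else 1

open Classical in
/-- The elements of the sequence between the last occurrence of `c` before `k` and `k`, padded
by `1`. -/
noncomputable def sinceLast (c : M) (g : Fin n → M) (k i : Fin n) : M :=
  if i < k ∧ ∀ j ≥ i, j < k → g j ≠ c then g i else 1

open Classical in
/-- At each occurrence of `c` except for the first one the block that leads from the previous
occurrence to it, as an element of the local divisor. -/
noncomputable def blockAt (c : M) (g : Fin n → M) (k : Fin n) : LocalDivisor c :=
  if g k = c ∧ ∃ j < k, g j = c then .conj c (List.ofFn (sinceLast c g k)).prod else 1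

open Classical in
theorem beforeFirst_castSucc (c : M) (g : Fin (n + 1) → M) (i : Fin n) :
    beforeFirst c g i.castSucc = beforeFirst c (fun i => g i.castSucc) i := by
  simp [beforeFirst, Fin.forall_fin_succ']

open Classical in
theorem beforeFirst_last (c : M) (g : Fin (n + 1) → M) : beforeFirst c g (Fin.last n) =
    if g (Fin.last n) = c ∨ ∃ k : Fin n, g k.castSucc = c then 1 else g (Fin.last n) := by
  rw [beforeFirst, ← ite_not]
  refine if_congr ?_ rfl rfl
  simp [Fin.forall_fin_succ', Fin.le_last, imp_iff_not_or, or_comm]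

open Classical in
theorem sinceLast_castSucc_castSucc (c : M) (g : Fin (n + 1) → M) (k i : Fin n) :
    sinceLast c g k.castSucc i.castSucc = sinceLast c (fun i => g i.castSucc) k i := by
  simp [sinceLast, Fin.forall_fin_succ', (Fin.castSucc_lt_last k).not_gt]

open Classical in
theorem sinceLast_last_castSucc (c : M) (g : Fin (n + 1) → M) (i : Fin n) :
    sinceLast c g (Fin.last n) i.castSucc = afterLast c (fun i => g i.castSucc) i := by
  simp [sinceLast, afterLast, Fin.forall_fin_succ', Fin.castSucc_lt_last]

theorem sinceLast_last (c : M) (g : Fin (n + 1) → M) (k : Fin (n + 1)) :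
    sinceLast c g k (Fin.last n) = 1 :=
  if_neg fun h => h.1.not_ge (Fin.le_last k)

open Classical in
theorem blockAt_castSucc (c : M) (g : Fin (n + 1) → M) (k : Fin n) :
    blockAt c g k.castSucc = blockAt c (fun i => g i.castSucc) k := by
  rw [blockAt, prod_ofFn_succ, sinceLast_last, mul_one]
  simp only [sinceLast_castSucc_castSucc]
  refine if_congr (and_congr_right fun _ => ?_) rfl rfl
  simp [Fin.exists_fin_succ', (Fin.castSucc_lt_last k).not_gt]

open Classical in
theorem blockAt_last (c : M) (g : Fin (n + 1) → M) :
    blockAt c g (Fin.last n) = if g (Fin.last n) = c ∧ ∃ j : Fin n, g j.castSucc = c then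
      .conj c (List.ofFn (afterLast c fun i => g i.castSucc)).prod else 1 := by
  rw [blockAt, prod_ofFn_succ, sinceLast_last, mul_one]
  simp only [sinceLast_last_castSucc]
  refine if_congr (and_congr_right fun _ => ?_) rfl rfl
  simp [Fin.exists_fin_succ', Fin.castSucc_lt_last]

open Classical in
theorem prod_afterLast_succ (c : M) (g : Fin (n + 1) → M) :
    (List.ofFn (afterLast c g)).prod = if g (Fin.last n) = c then 1 else
      (List.ofFn (afterLast c fun i => g i.castSucc)).prod * g (Fin.last n) := by
  split_ifs with h
  · exact prod_ofFn_eq_one fun i => if_neg fun hi => hi _ (Fin.le_last i) h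
  · have hcastSucc (i : Fin n) : afterLast c g i.castSucc = afterLast c (fun i => g i.castSucc) i :=
      by simp [afterLast, Fin.forall_fin_succ', h]
    have hlast : afterLast c g (Fin.last n) = g (Fin.last n) :=
      if_pos fun j hj => Fin.last_le_iff.1 hj ▸ h
    rw [prod_ofFn_succ, hlast]
    simp only [hcastSucc]

theorem blockAt_eq_one {c : M} {g : Fin n → M} (h : ∀ k, g k ≠ c) (k : Fin n) :
    blockAt c g k = 1 :=
  if_neg fun hk => h k hk.1

open Classical in
theorem prod_ofFn_eq_local (c : M) (g : Fin n → M) :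
    (List.ofFn g).prod = if ∃ k, g k = c then
      (List.ofFn (beforeFirst c g)).prod * (List.ofFn (blockAt c g)).prod.1 *
        (List.ofFn (afterLast c g)).prod
      else (List.ofFn (beforeFirst c g)).prod := by
  induction n with
  | zero => simp
  | succ n ih =>
    rw [prod_ofFn_succ g, prod_ofFn_succ (beforeFirst c g), prod_ofFn_succ (blockAt c g),
      prod_afterLast_succ, beforeFirst_last, blockAt_last, ih]
    simp only [beforeFirst_castSucc, blockAt_castSucc, Fin.exists_fin_succ']
    by_cases hk : ∃ k : Fin n, g k.castSucc = c <;> by_cases hn : g (Fin.last n) = c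
    · simp [hk, hn, LocalDivisor.coe_mul_conj, mul_assoc]
    · simp [hk, hn, mul_assoc]
    · have hone := prod_ofFn_eq_one (blockAt_eq_one (not_exists.1 hk))
      simp [hk, hn, hone, LocalDivisor.coe_one]
    · simp [hk, hn]

end LocalFactorization

/-! ### First-order definability of products -/

section PosProd

variable {α : Type u} {V : Type} {M : Type w} [Monoid M]

/-- The product of the values of `col` at the positions of a word. -/
noncomputable def posProd (col : PointedWord α (Option V) → M) (p : PointedWord α V) : M :=
  (List.ofFn fun i => col (p.extend i)).prod

variable (α) in
/-- Products along words of definable sequences with values in `A ∪ {1}` are definable. -/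
def DefinableProducts (A : Set M) : Prop :=
  ∀ (V : Type) [Finite V] (col : PointedWord α (Option V) → M), (∀ q, col q ∈ insert 1 A) →
    FODefinableFun col → FODefinableFun (posProd col)

theorem DefinableProducts.posProd_ite [Finite V] {A : Set M} (hA : DefinableProducts α A) {c : M}
    {col : PointedWord α (Option V) → M} (hcol : ∀ q, col q ∈ insert 1 (insert c A))
    (hdef : FODefinableFun col) {P : PointedWord α (Option V) → Prop} [DecidablePred P]
    (hP : FODefinable P) (hPc : ∀ q, P q → col q ≠ c) :
    FODefinableFun (posProd fun q => if P q then col q else 1) := by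
  refine hA V _ (fun q => ?_) (.ite hP hdef (.const 1))
  split_ifs with hq
  · exact (hcol q).imp_right fun h => h.resolve_left (hPc q hq)
  · exact Set.mem_insert 1 A

open Classical in
theorem DefinableProducts.insert [Finite M] {A : Set M} (hA : DefinableProducts α A) {c : M}
    (hc : DefinableProducts α (Set.univ : Set (LocalDivisor c))) :
    DefinableProducts α (insert c A) := by
  intro V _ col hcol hdef
  have hself := hdef.subst_extend some none
  have hne : FODefinable fun q : PointedWord α (Option (Option V)) =>
      col ((q.subst fun x => some (some x)).extend (q.val none)) ≠ c :=
    (hdef.subst_extend _ _ c).not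
  have hbefore : FODefinableFun fun p : PointedWord α V =>
      (List.ofFn (beforeFirst c fun i => col (p.extend i))).prod :=
    hA.posProd_ite (fun q => hcol _) hself
      (P := fun q => ∀ j ≤ q.val none, col ((q.subst some).extend j) ≠ c)
      ((FODefinable.le none (some none)).imp hne).all fun q hq => hq _ le_rfl
  have hafter : FODefinableFun fun p : PointedWord α V =>
      (List.ofFn (afterLast c fun i => col (p.extend i))).prod :=
    hA.posProd_ite (fun q => hcol _) hself
      (P := fun q => ∀ j ≥ q.val none, col ((q.subst some).extend j) ≠ c)
      ((FODefinable.le (some none) none).imp hne).all fun q hq => hq _ le_rfl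
  have hsince : FODefinableFun fun q : PointedWord α (Option V) =>
      (List.ofFn (sinceLast c (fun i => col ((q.subst some).extend i)) (q.val none))).prod :=
    hA.posProd_ite (fun q => hcol _) (hdef.subst_extend (fun x => some (some x)) none)
      (P := fun q => q.val none < q.val (some none) ∧ ∀ j ≥ q.val none, j < q.val (some none) →
        col ((q.subst fun x => some (some x)).extend j) ≠ c)
      ((FODefinable.lt none (some none)).and (((FODefinable.le (some none) none).imp
        ((FODefinable.lt none (some (some none))).imp
          (hdef.subst_extend (fun x => some (some (some x))) none c).not)).all))
      fun q hq => hq.2 _ le_rfl hq.1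
  have hblock : FODefinableFun fun p : PointedWord α V =>
      (List.ofFn (blockAt c fun i => col (p.extend i))).prod :=
    hc V (fun q => blockAt c (fun i => col ((q.subst some).extend i)) (q.val none))
      (fun q => .inr trivial)
      (.ite ((hself c).and
        ((FODefinable.lt none (some none)).and
          (hdef.subst_extend (fun x => some (some x)) none c)).ex)
        (hsince.comp (LocalDivisor.conj c)) (.const 1))
  rw [show posProd col = _ from funext fun p => prod_ofFn_eq_local c fun i => col (p.extend i)]
  exact .ite (hdef c).ex ((hbefore.map₂ (hblock.comp Subtype.val) (· * ·)).map₂ hafter (· * ·))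
    hbefore

theorem definableProducts_univ [Finite M] {N : ℕ} (hN : ∀ x : M, x ^ N = x ^ (N + 1)) :
    DefinableProducts α (Set.univ : Set M) := by
  induction hn : Nat.card M using Nat.strong_induction_on generalizing M with | _ n ih =>
  subst hn
  induction Set.univ, Set.finite_univ (α := M) using Set.Finite.induction_on with
  | empty =>
    intro V _ col hcol _
    have hone : posProd col = fun _ => 1 :=
      funext fun p => prod_ofFn_eq_one fun i => (hcol (p.extend i)).resolve_right id
    exact hone ▸ .const 1
  | @insert c A _ _ hA =>
    by_cases hc : c = 1
    · exact fun V _ col hcol => hA V col fun q => by simpa [hc] using hcol q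
    · exact hA.insert (ih _ (LocalDivisor.card_lt hN hc) (LocalDivisor.pow_eq_pow_succ hN) rfl)

end PosProd

/-! ### Recognizable predicates are first-order definable -/

theorem foDefinableFun_letter {α : Type u} {V : Type} [Finite V] :
    FODefinableFun fun q : PointedWord α (Option V) =>
      (q.word.get (q.val none), {x | q.val (some x) = q.val none}) := fun b =>
  ((FODefinable.letter b.1 none).and (FODefinable.forall_of_finite fun x =>
    ((FODefinable.eq (some x) none).imp (.const (x ∈ b.2))).and
      ((FODefinable.const (x ∈ b.2)).imp (.eq (some x) none)))).congr fun q => by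
    simp only [Prod.ext_iff, Set.ext_iff, Set.mem_ofPred_eq, iff_def]

theorem foDefinableFun_prod_map_mark {α : Type u} [Finite α] {V : Type} [Finite V] {M : Type w}
    [Monoid M] [Finite M] {N : ℕ} (hN : ∀ x : M, x ^ N = x ^ (N + 1)) (φ : α × Set V → M) :
    FODefinableFun fun p : PointedWord α V => (p.mark.map φ).prod := by
  simp only [mark, List.map_ofFn]
  exact definableProducts_univ hN V _ (fun q => .inr trivial) (foDefinableFun_letter.comp φ)

/-- The kernel of `f` as a congruence of the free monoid. -/
def HasAperiodicKer.con {B T : Type*} {f : List B → T} (hf : HasAperiodicKer f) :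
    Con (FreeMonoid B) where
  r x y := f x.toList = f y.toList
  iseqv := ⟨fun _ => rfl, Eq.symm, Eq.trans⟩
  mul' h h' := hf.append h h'

theorem HasAperiodicKer.exists_con_pow_eq {B T : Type*} {f : List B → T}
    (hf : HasAperiodicKer f) : ∃ N : ℕ, ∀ x : hf.con.Quotient, x ^ N = x ^ (N + 1) := by
  have hpow (x : FreeMonoid B) (n : ℕ) : (x ^ n).toList = wordPow x.toList n := by
    induction n with
    | zero => rfl
    | succ n ih => rw [pow_succ', FreeMonoid.toList_mul, ih, wordPow_succ]
  obtain ⟨N, hN⟩ := hf.exists_wordPow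
  refine ⟨N, fun x => ?_⟩
  induction x using Con.induction_on with | _ x =>
  refine (Con.eq _ (a := x ^ N) (b := x ^ (N + 1))).2 ?_
  change f _ = f _
  rw [hpow, hpow, hN]

theorem HasAperiodicKer.exists_prod_map {B T : Type*} [Finite T] {f : List B → T}
    (hf : HasAperiodicKer f) : ∃ (M : Type) (_ : Monoid M) (_ : Finite M) (φ : B → M),
      Function.Surjective (fun y : List B => (y.map φ).prod) ∧
      (∃ N : ℕ, ∀ x : M, x ^ N = x ^ (N + 1)) ∧
      ∀ y z : List B, (y.map φ).prod = (z.map φ).prod ↔ f y = f z := by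
  have hval : Function.Injective
      (Quotient.lift (fun x => f x.toList) fun _ _ h => h : hf.con.Quotient → T) :=
    Quotient.ind₂ fun _ _ h => Quotient.sound h
  have : Finite hf.con.Quotient := .of_injective _ hval
  let e := (Shrink.mulEquiv.{0} (α := hf.con.Quotient)).symm
  let ψ := e.toMonoidHom.comp hf.con.mk'
  have hprod (y : List B) : (y.map fun b => ψ (.of b)).prod = ψ (FreeMonoid.ofList y) := by
    rw [← FreeMonoid.lift_restrict ψ, FreeMonoid.lift_ofList]
    rfl
  obtain ⟨N, hN⟩ := hf.exists_con_pow_eq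
  refine ⟨Shrink.{0} hf.con.Quotient, inferInstance, .of_equiv _ e.toEquiv,
    fun b => ψ (.of b), ?_, ⟨N, fun x => e.symm.injective ?_⟩, fun y z => ?_⟩
  · simp only [hprod]
    exact (e.surjective.comp hf.con.mk'_surjective).comp FreeMonoid.ofList.surjective
  · rw [map_pow, map_pow, hN]
  · rw [hprod, hprod]
    exact e.injective.eq_iff.trans (Con.eq _)

theorem HasAperiodicKer.foDefinableFun_mark {α : Type u} [Finite α] {V : Type} [Finite V]
    {T : Type*} [Finite T] {f : List (α × Set V) → T} (hf : HasAperiodicKer f) :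
    FODefinableFun fun p : PointedWord α V => f p.mark := by
  obtain ⟨M, _, _, φ, hφ, ⟨N, hN⟩, hker⟩ := hf.exists_prod_map
  have hfactor (y : List (α × Set V)) : f (Function.surjInv hφ (y.map φ).prod) = f y :=
    (hker _ _).1 (Function.surjInv_eq hφ _)
  simpa only [hfactor] using (foDefinableFun_prod_map_mark hN φ).comp
    fun m => f (Function.surjInv hφ m)

theorem Recognizable.foDefinableFun {α : Type u} [Finite α] {V : Type} [Finite V] {X : Type*}
    {F : PointedWord α V → X} (hF : Recognizable F) : FODefinableFun F := by
  obtain ⟨n, f, hf, h⟩ := hF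
  refine fun x => (FODefinable.exists_of_finite
    fun t : {t : Fin n // ∃ q, f q.mark = t ∧ F q = x} => hf.foDefinableFun_mark t.1).congr
      fun p => ⟨?_, fun hp => ⟨⟨_, p, rfl, hp⟩, rfl⟩⟩
  rintro ⟨⟨t, q, rfl, hq⟩, hp⟩
  exact (h p q hp).trans hq

/-! ### Recognizable series -/

section Series

variable {α : Type u} {R : Type v} {V V' : Type}

open Classical in
/-- The single sequence of the weights `w` if the condition `P` holds. -/
noncomputable def condProd (P : PointedWord α V → Prop) (w : PointedWord α (Option V) → R)
    (p : PointedWord α V) : Multiset (List R) :=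
  if P p then {List.ofFn fun i => w (p.extend i)} else 0

/-- The sum of `condProd P w` over all valuations of `k` further variables. -/
noncomputable def sumProd (k : ℕ) (P : PointedWord α (V ⊕ Fin k) → Prop)
    (w : PointedWord α (Option (V ⊕ Fin k)) → R) (p : PointedWord α V) : Multiset (List R) :=
  ∑ τ : Fin k → Fin p.word.length, condProd P w (p.append τ)

variable (α R V) in
/-- Finite sums of functions `sumProd k P w` with recognizable `P` and `w`. -/
def recSeries : AddSubmonoid (PointedWord α V → Multiset (List R)) :=
  AddSubmonoid.closure {G | ∃ k P w, Recognizable P ∧ Recognizable w ∧ G = sumProd k P w}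

variable (α R V) in
/-- Finite sums of functions `condProd P w` with recognizable `P` and `w`. -/
def recStepSeries : AddSubmonoid (PointedWord α V → Multiset (List R)) :=
  AddSubmonoid.closure {G | ∃ P w, Recognizable P ∧ Recognizable w ∧ G = condProd P w}

theorem condProd_eq_zero_iff {P : PointedWord α V → Prop} {w : PointedWord α (Option V) → R}
    {p : PointedWord α V} : condProd P w p = 0 ↔ ¬ P p := by
  simp [condProd]

theorem condProd_congr {P : PointedWord α V → Prop} {w : PointedWord α (Option V) → R}
    {P' : PointedWord α V' → Prop} {w' : PointedWord α (Option V') → R}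
    {u : List α} (hu hu' : u ≠ []) {σ : V → Fin u.length} {τ : V' → Fin u.length}
    (hP : P ⟨u, hu, σ⟩ ↔ P' ⟨u, hu', τ⟩)
    (hw : ∀ i, w ⟨u, hu, fun o => o.elim i σ⟩ = w' ⟨u, hu', fun o => o.elim i τ⟩) :
    condProd P w ⟨u, hu, σ⟩ = condProd P' w' ⟨u, hu', τ⟩ := by
  classical
  unfold condProd
  exact if_congr hP (congrArg _ (congrArg List.ofFn (funext hw))) rfl

/-- Replaces the first of the summation variables by `none`. -/
def shiftVar {k : ℕ} : V ⊕ Fin (k + 1) → Option V ⊕ Fin k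
  | .inl x => .inl (some x)
  | .inr j => Fin.cases (.inl none) .inr j

/-- Replaces `none` by the first of the summation variables. -/
def unshiftVar {k : ℕ} : Option V ⊕ Fin k → V ⊕ Fin (k + 1)
  | .inl (some x) => .inl x
  | .inl none => .inr 0
  | .inr j => .inr j.succ

theorem shiftVar_unshiftVar {k : ℕ} (x : Option V ⊕ Fin k) : shiftVar (unshiftVar x) = x := by
  rcases x with (_ | x) | j <;> simp [shiftVar, unshiftVar]

theorem sumProd_succ {k : ℕ} (P : PointedWord α (V ⊕ Fin (k + 1)) → Prop)
    (w : PointedWord α (Option (V ⊕ Fin (k + 1))) → R) (p : PointedWord α V) :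
    sumProd (k + 1) P w p = ∑ i, sumProd k (fun q => P (q.subst shiftVar))
      (fun q => w (q.subst (Option.map shiftVar))) (p.extend i) := by
  unfold sumProd
  rw [← (Fin.consEquiv fun _ : Fin (k + 1) => Fin p.word.length).sum_comp, Fintype.sum_prod_type]
  refine Finset.sum_congr rfl fun i _ => Finset.sum_congr rfl fun τ _ => ?_
  have hval (x) : Sum.elim p.val (Fin.cons i τ : Fin (k + 1) → Fin p.word.length) x =
      Sum.elim (p.extend i).val τ (shiftVar x) := by
    obtain x | j := x
    · rfl
    · cases j using Fin.cases <;> rfl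
  refine condProd_congr _ _ (iff_of_eq (congrArg P (ext_val _ _ hval)))
    fun z => congrArg w (ext_val _ _ fun o => ?_)
  cases o with
  | none => rfl
  | some x => exact hval x

theorem sumProd_zero (P : PointedWord α (V ⊕ Fin 0) → Prop)
    (w : PointedWord α (Option (V ⊕ Fin 0)) → R) :
    sumProd 0 P w = condProd (fun q => P (q.subst (Sum.elim id Fin.elim0)))
      (fun q => w (q.subst (Option.map (Sum.elim id Fin.elim0)))) := by
  funext p
  rw [sumProd, Fintype.sum_unique]
  refine condProd_congr _ _ (iff_of_eq (congrArg P (ext_val _ _ ?_)))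
    fun z => congrArg w (ext_val _ _ ?_)
  · rintro (x | j)
    · rfl
    · exact j.elim0
  · rintro (_ | x | j)
    · rfl
    · rfl
    · exact j.elim0

theorem sumProd_mem_recSeries {k : ℕ} {P : PointedWord α (V ⊕ Fin k) → Prop} (hP : Recognizable P)
    {w : PointedWord α (Option (V ⊕ Fin k)) → R} (hw : Recognizable w) :
    sumProd k P w ∈ recSeries α R V :=
  AddSubmonoid.subset_closure ⟨k, P, w, hP, hw, rfl⟩

theorem condProd_mem_recStepSeries {P : PointedWord α V → Prop} (hP : Recognizable P)
    {w : PointedWord α (Option V) → R} (hw : Recognizable w) : condProd P w ∈ recStepSeries α R V :=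
  AddSubmonoid.subset_closure ⟨P, w, hP, hw, rfl⟩

theorem condProd_mem_recSeries {P : PointedWord α V → Prop} (hP : Recognizable P)
    {w : PointedWord α (Option V) → R} (hw : Recognizable w) : condProd P w ∈ recSeries α R V := by
  have hsum := sumProd_mem_recSeries (k := 0) (hP.subst .inl) (hw.subst (Option.map .inl))
  rw [sumProd_zero] at hsum
  convert hsum using 1
  funext p
  refine condProd_congr _ _ Iff.rfl fun z => congrArg w (ext_val _ _ fun o => ?_)
  cases o <;> rfl

theorem sum_extend_mem_recSeries {G : PointedWord α (Option V) → Multiset (List R)}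
    (hG : G ∈ recSeries α R (Option V)) :
    (fun p => ∑ i, G (p.extend i)) ∈ recSeries α R V := by
  induction hG using AddSubmonoid.closure_induction with
  | mem G hG =>
    obtain ⟨k, P, w, hP, hw, rfl⟩ := hG
    convert sumProd_mem_recSeries (hP.subst unshiftVar) (hw.subst (Option.map unshiftVar)) using 1
    funext p
    rw [sumProd_succ]
    refine Finset.sum_congr rfl fun i _ => ?_
    have hvars (q : PointedWord α (Option V ⊕ Fin k)) :
        (q.subst shiftVar).subst unshiftVar = q :=
      ext_val _ _ fun x => congrArg q.val (shiftVar_unshiftVar x)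
    have hvars_option (q : PointedWord α (Option (Option V ⊕ Fin k))) :
        (q.subst (Option.map shiftVar)).subst (Option.map unshiftVar) = q :=
      ext_val _ _ fun x => congrArg q.val (by cases x <;> simp [shiftVar_unshiftVar])
    simp only [hvars, hvars_option]
  | zero =>
    convert (recSeries α R V).zero_mem using 1
    funext p
    simp
  | add G H _ _ ihG ihH =>
    convert (recSeries α R V).add_mem ihG ihH using 1
    funext p
    simp [Finset.sum_add_distrib]

open Classical in
theorem ite_zero_mem_recSeries {P : PointedWord α V → Prop} (hP : Recognizable P)
    {G : PointedWord α V → Multiset (List R)} (hG : G ∈ recSeries α R V) :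
    (fun p => if P p then G p else 0) ∈ recSeries α R V := by
  induction hG using AddSubmonoid.closure_induction with
  | mem G hG =>
    obtain ⟨k, Q, w, hQ, hw, rfl⟩ := hG
    convert sumProd_mem_recSeries ((hP.subst .inl).and hQ) hw using 1
    funext p
    by_cases h : P p
    · rw [if_pos h]
      refine Finset.sum_congr rfl fun τ _ => condProd_congr _ _ ?_ fun _ => rfl
      exact (and_iff_right h).symm
    · rw [if_neg h]
      refine (Finset.sum_eq_zero fun τ _ => condProd_eq_zero_iff.2 fun h' => h h'.1).symm
  | zero =>
    convert (recSeries α R V).zero_mem using 1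
    funext p
    simp
  | add G H _ _ ihG ihH =>
    convert (recSeries α R V).add_mem ihG ihH using 1
    funext p
    by_cases h : P p <;> simp [h]

theorem subst_first_mem_recSeries {G : PointedWord α V → Multiset (List R)}
    (hG : G ∈ recSeries α R V) (s : V → Option V') :
    (fun p : PointedWord α V' => G ((p.extend p.first).subst s)) ∈ recSeries α R V' := by
  induction hG using AddSubmonoid.closure_induction with
  | mem G hG =>
    obtain ⟨k, P, w, hP, hw, rfl⟩ := hG
    let sP : V ⊕ Fin k → Option (V' ⊕ Fin k) :=
      Sum.elim (fun x => (s x).map .inl) fun j => some (.inr j)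
    let sw : Option (V ⊕ Fin k) → Option (Option (V' ⊕ Fin k)) :=
      fun o => o.elim (some none) fun x => (sP x).map some
    convert sumProd_mem_recSeries (hP.subst sP).extend_first (hw.subst sw).extend_first using 1
    funext p
    have hval (τ : Fin k → Fin p.word.length) (x : V ⊕ Fin k) :
        Sum.elim ((p.extend p.first).subst s).val τ x =
          (((p.append τ).extend (p.append τ).first).subst sP).val x := by
      obtain x | j := x
      · change (s x).elim p.first p.val = ((s x).map Sum.inl).elim p.first (Sum.elim p.val τ)
        cases s x <;> rfl
      · rfl
    refine Finset.sum_congr rfl fun τ _ => ?_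
    refine condProd_congr _ _ (iff_of_eq (congrArg P (ext_val _ _ (hval τ)))) fun i =>
      congrArg w (ext_val _ _ ?_)
    rintro (_ | x)
    · rfl
    · refine (hval τ x).trans ?_
      change (sP x).elim p.first (Sum.elim p.val τ) =
        ((sP x).map some).elim p.first fun o => o.elim i (Sum.elim p.val τ)
      cases sP x <;> rfl
  | zero => exact (recSeries α R V').zero_mem
  | add G H _ _ ihG ihH => exact (recSeries α R V').add_mem ihG ihH

theorem subst_mem_recSeries {G : PointedWord α V → Multiset (List R)} (hG : G ∈ recSeries α R V)
    (s : V → V') : (fun p : PointedWord α V' => G (p.subst s)) ∈ recSeries α R V' :=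
  subst_first_mem_recSeries hG fun x => some (s x)

open Classical in
theorem ite_mem_recSeries {P : PointedWord α V → Prop} (hP : Recognizable P)
    {G H : PointedWord α V → Multiset (List R)} (hG : G ∈ recSeries α R V)
    (hH : H ∈ recSeries α R V) :
    (fun p => if P p then G p else H p) ∈ recSeries α R V := by
  convert (recSeries α R V).add_mem (ite_zero_mem_recSeries hP hG)
    (ite_zero_mem_recSeries hP.not hH) using 1
  funext p
  by_cases h : P p <;> simp [h]

/-- The substitution of `none` for the variable `x`. -/
def bindVar (x y : ℕ) : Option ℕ := if y = x then none else some y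

theorem extend_subst_bindVar (p : PointedWord α ℕ) (x : ℕ) (i : Fin p.word.length) :
    (p.extend i).subst (bindVar x) = ⟨p.word, p.ne, Function.update p.val x i⟩ :=
  ext_val _ _ fun y => by
    by_cases h : y = x
    · subst h; simp [bindVar, extend]
    · simp [bindVar, extend, h]

theorem FOFormula.recognizable_sat (φ : FOFormula α) :
    Recognizable fun p : PointedWord α ℕ => φ.Sat p.word p.val := by
  induction φ with
  | top => exact Recognizable.const True
  | letter a x => exact Recognizable.letter a x
  | le x y => exact Recognizable.le x y
  | not φ ih => exact ih.not
  | and φ ψ ih₁ ih₂ => exact ih₁.and ih₂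
  | all x φ ih =>
    convert (ih.subst (bindVar x)).all using 1
    exact funext fun p => propext <| forall_congr' fun i => iff_of_eq <|
      congrArg (fun q : PointedWord α ℕ => φ.Sat q.word q.val) (extend_subst_bindVar p x i).symm

theorem StepWFO.recognizable_sem (Ψ : StepWFO α R) :
    Recognizable fun p : PointedWord α ℕ => Ψ.sem p.word p.val := by
  classical
  induction Ψ with
  | const r => exact Recognizable.const r
  | ite φ Ψ₁ Ψ₂ ih₁ ih₂ =>
    convert φ.recognizable_sat.ite ih₁ ih₂ using 2
    simp only [sem]

theorem WFO.sem_mem_recSeries (Φ : WFO α R) :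
    (fun p : PointedWord α ℕ => Φ.sem p.word p.val) ∈ recSeries α R ℕ := by
  classical
  induction Φ with
  | zero => exact (recSeries α R ℕ).zero_mem
  | prod x Ψ =>
    convert condProd_mem_recSeries (Recognizable.const True)
      (Ψ.recognizable_sem.subst (bindVar x)) using 1
    funext p
    rw [condProd, if_pos trivial]
    exact congrArg (fun l => ({l} : Multiset (List R))) <| congrArg List.ofFn <| funext fun i =>
      congrArg (fun q : PointedWord α ℕ => Ψ.sem q.word q.val) (extend_subst_bindVar p x i).symm
  | ite φ Φ₁ Φ₂ ih₁ ih₂ =>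
    convert ite_mem_recSeries φ.recognizable_sat ih₁ ih₂ using 2
    simp only [sem]
  | add Φ₁ Φ₂ ih₁ ih₂ => exact (recSeries α R ℕ).add_mem ih₁ ih₂
  | sum x Φ ih =>
    convert sum_extend_mem_recSeries (subst_mem_recSeries ih (bindVar x)) using 1
    exact funext fun p => Finset.sum_congr rfl fun i _ =>
      congrArg (fun q : PointedWord α ℕ => Φ.sem q.word q.val) (extend_subst_bindVar p x i).symm

/-- The pointed word without variables given by a nonempty word. -/
def pureWord (u : {u : List α // u ≠ []}) : PointedWord α Empty := ⟨u.1, u.2, Empty.elim⟩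

theorem WFO.exists_mem_recSeries (Φ : WFO α R) :
    ∃ G ∈ recSeries α R Empty, ∀ u, Φ.usem u = G (pureWord u) :=
  ⟨_, subst_first_mem_recSeries Φ.sem_mem_recSeries fun _ => none, fun _ => rfl⟩

end Series

/-! ### Definability of recognizable series -/

section Definable

variable {α : Type u} {R : Type v} {V : Type}

/-- `F` is given by a step formula, whatever the names `e` of its variables. -/
def StepDefinable (F : PointedWord α V → R) : Prop :=
  ∀ e : V → ℕ, ∃ Ψ : StepWFO α R, (∀ x ∈ Ψ.freeVars, x ∈ Set.range e) ∧
    ∀ (u : List α) (hu : u ≠ []) (σ : ℕ → Fin u.length),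
      Ψ.sem u σ = F ⟨u, hu, fun x => σ (e x)⟩

/-- `G` is given by a formula in the class `C`, whatever the names `e` of its variables. -/
def WFODefinable (C : WFO α R → Prop) (G : PointedWord α V → Multiset (List R)) : Prop :=
  ∀ e : V → ℕ, ∃ Φ : WFO α R, C Φ ∧ (∀ x ∈ Φ.freeVars, x ∈ Set.range e) ∧
    ∀ (u : List α) (hu : u ≠ []) (σ : ℕ → Fin u.length),
      Φ.sem u σ = G ⟨u, hu, fun x => σ (e x)⟩

/-- The class `C` contains the formula `0` and all products, and it is closed under the conditional,
as are the three classes of formulas in the theorem. -/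
structure IteClosed (C : WFO α R → Prop) : Prop where
  zero : C .zero
  prod : ∀ x Ψ, C (.prod x Ψ)
  ite : ∀ φ Φ₁ Φ₂, C Φ₁ → C Φ₂ → C (.ite φ Φ₁ Φ₂)

theorem iteClosed_true : IteClosed fun _ : WFO α R => True :=
  ⟨trivial, fun _ _ => trivial, fun _ _ _ _ _ => trivial⟩

theorem iteClosed_noBinarySum : IteClosed (WFO.NoBinarySum : WFO α R → Prop) :=
  ⟨trivial, fun _ _ => trivial, fun _ _ _ h₁ h₂ => ⟨h₁, h₂⟩⟩

theorem iteClosed_noFirstOrderSum : IteClosed (WFO.NoFirstOrderSum : WFO α R → Prop) :=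
  ⟨trivial, fun _ _ => trivial, fun _ _ _ h₁ h₂ => ⟨h₁, h₂⟩⟩

theorem IteClosed.and {C D : WFO α R → Prop} (hC : IteClosed C) (hD : IteClosed D) :
    IteClosed fun Φ => C Φ ∧ D Φ :=
  ⟨⟨hC.zero, hD.zero⟩, fun x Ψ => ⟨hC.prod x Ψ, hD.prod x Ψ⟩,
    fun φ _ _ h₁ h₂ => ⟨hC.ite φ _ _ h₁.1 h₂.1, hD.ite φ _ _ h₁.2 h₂.2⟩⟩

theorem FODefinableFun.stepDefinable [Nonempty R] {F : PointedWord α V → R}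
    (hF : FODefinableFun F) (hfin : (Set.range F).Finite) : StepDefinable F := by
  classical
  intro e
  have hfinset (s : Finset R) : ∃ Ψ : StepWFO α R, (∀ x ∈ Ψ.freeVars, x ∈ Set.range e) ∧
      ∀ (u : List α) (hu : u ≠ []) (σ : ℕ → Fin u.length), F ⟨u, hu, fun x => σ (e x)⟩ ∈ s →
        Ψ.sem u σ = F ⟨u, hu, fun x => σ (e x)⟩ := by
    induction s using Finset.induction_on with
    | empty => exact ⟨.const (Classical.arbitrary R), by simp [StepWFO.freeVars], by simp⟩
    | insert r s _ ih =>
      obtain ⟨Ψ, hΨ, hsem⟩ := ih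
      obtain ⟨φ, hφ, hsat⟩ := hF r e
      refine ⟨.ite φ (.const r) Ψ, ?_, fun u hu σ hs => ?_⟩
      · simp only [StepWFO.freeVars, Finset.mem_union, Finset.notMem_empty, or_false]
        exact fun x hx => hx.elim (hφ x) (hΨ x)
      · rw [StepWFO.sem]
        split_ifs with h
        · exact ((hsat u hu σ).1 h).symm
        · exact hsem u hu σ <|
            (Finset.mem_insert.1 hs).resolve_left fun hr => h ((hsat u hu σ).2 hr)
  obtain ⟨Ψ, hΨ, hsem⟩ := hfinset hfin.toFinset
  exact ⟨Ψ, hΨ, fun u hu σ => hsem u hu σ (hfin.mem_toFinset.2 ⟨_, rfl⟩)⟩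

theorem Recognizable.finite_range {F : PointedWord α V → R} (hF : Recognizable F) :
    (Set.range F).Finite := by
  obtain ⟨n, f, -, h⟩ := hF
  refine (Set.finite_range fun t : {t : Fin n // ∃ p : PointedWord α V, f p.mark = t} =>
    F t.2.choose).subset ?_
  rintro _ ⟨p, rfl⟩
  have ht : ∃ q : PointedWord α V, f q.mark = f p.mark := ⟨p, rfl⟩
  exact ⟨⟨_, ht⟩, h _ _ ht.choose_spec⟩

namespace WFODefinable

variable {C : WFO α R → Prop}

theorem zero (hC : C .zero) : WFODefinable C (0 : PointedWord α V → Multiset (List R)) :=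
  fun _ => ⟨.zero, hC, by simp [WFO.freeVars], fun _ _ _ => rfl⟩

theorem add (hC : ∀ Φ₁ Φ₂, C Φ₁ → C Φ₂ → C (.add Φ₁ Φ₂))
    {G H : PointedWord α V → Multiset (List R)} (hG : WFODefinable C G) (hH : WFODefinable C H) :
    WFODefinable C (G + H) := by
  intro e
  obtain ⟨Φ₁, hC₁, hfv₁, hsem₁⟩ := hG e
  obtain ⟨Φ₂, hC₂, hfv₂, hsem₂⟩ := hH e
  refine ⟨.add Φ₁ Φ₂, hC _ _ hC₁ hC₂, ?_, fun u hu σ => ?_⟩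
  · simp only [WFO.freeVars, Finset.mem_union]
    exact fun x hx => hx.elim (hfv₁ x) (hfv₂ x)
  · rw [WFO.sem, hsem₁ u hu, hsem₂ u hu]
    rfl

open Classical in
theorem ite (hC : IteClosed C) {P : PointedWord α V → Prop} (hP : FODefinable P)
    {G H : PointedWord α V → Multiset (List R)} (hG : WFODefinable C G)
    (hH : WFODefinable C H) : WFODefinable C fun p => if P p then G p else H p := by
  intro e
  obtain ⟨φ, hfv, hsat⟩ := hP e
  obtain ⟨Φ₁, hC₁, hfv₁, hsem₁⟩ := hG e
  obtain ⟨Φ₂, hC₂, hfv₂, hsem₂⟩ := hH e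
  refine ⟨.ite φ Φ₁ Φ₂, hC.ite _ _ _ hC₁ hC₂, ?_, fun u hu σ => ?_⟩
  · simp only [WFO.freeVars, Finset.mem_union]
    exact fun x hx => hx.elim (fun hx => hx.elim (hfv x) (hfv₁ x)) (hfv₂ x)
  · rw [WFO.sem, hsem₁ u hu, hsem₂ u hu]
    exact if_congr (hsat u hu σ) rfl rfl

theorem sum [Finite V] (hC : ∀ x Φ, C Φ → C (.sum x Φ))
    {G : PointedWord α (Option V) → Multiset (List R)} (hG : WFODefinable C G) :
    WFODefinable C fun p : PointedWord α V => ∑ i, G (p.extend i) := by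
  intro e
  obtain ⟨z, hz⟩ := (Set.finite_range e).exists_notMem
  obtain ⟨Φ, hΦ, hfv, hsem⟩ := hG fun o => o.elim z e
  exact ⟨.sum z Φ, hC _ _ hΦ, mem_range_of_mem_erase hfv, fun u hu σ =>
    Finset.sum_congr rfl fun i _ => (hsem u hu _).trans (congrArg G (update_elim hz hu σ i))⟩

theorem prod [Finite V] (hC : ∀ x Ψ, C (.prod x Ψ)) {w : PointedWord α (Option V) → R}
    (hw : StepDefinable w) :
    WFODefinable C fun p : PointedWord α V => {List.ofFn fun i => w (p.extend i)} := by
  intro e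
  obtain ⟨z, hz⟩ := (Set.finite_range e).exists_notMem
  obtain ⟨Ψ, hfv, hsem⟩ := hw fun o => o.elim z e
  exact ⟨.prod z Ψ, hC _ _, mem_range_of_mem_erase hfv, fun u hu σ =>
    congrArg (fun l => ({l} : Multiset (List R))) <| congrArg List.ofFn <| funext fun i =>
      (hsem u hu _).trans (congrArg w (update_elim hz hu σ i))⟩

theorem condProd [Finite α] [Finite V] (hC : IteClosed C) {P : PointedWord α V → Prop}
    (hP : Recognizable P) {w : PointedWord α (Option V) → R} (hw : Recognizable w) :
    WFODefinable C (condProd P w) := by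
  classical
  have hdef : FODefinable P := (hP.foDefinableFun True).congr (by simp)
  obtain hR | hR := isEmpty_or_nonempty R
  · have hzero : _root_.condProd P w = 0 := funext fun p => isEmptyElim (w (p.extend p.first))
    exact hzero ▸ zero hC.zero
  · convert ite hC hdef (prod hC.prod (hw.foDefinableFun.stepDefinable hw.finite_range))
      (zero hC.zero) using 1
    funext p
    simp [_root_.condProd]

theorem sumProd [Finite α] [Finite V] (hC : IteClosed C) (hsum : ∀ x Φ, C Φ → C (.sum x Φ))
    {k : ℕ} {P : PointedWord α (V ⊕ Fin k) → Prop} (hP : Recognizable P)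
    {w : PointedWord α (Option (V ⊕ Fin k)) → R} (hw : Recognizable w) :
    WFODefinable C (sumProd k P w) := by
  induction k generalizing V with
  | zero =>
    rw [sumProd_zero]
    exact condProd hC (hP.subst _) (hw.subst _)
  | succ k ih =>
    rw [show _root_.sumProd (k + 1) P w = _ from funext (sumProd_succ P w)]
    exact sum hsum (ih (hP.subst _) (hw.subst _))

theorem exists_sentence {G : PointedWord α Empty → Multiset (List R)} (hG : WFODefinable C G) :
    ∃ Φ : WFO α R, Φ.IsSentence ∧ C Φ ∧ Φ.usem = fun u => G (pureWord u) := by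
  obtain ⟨Φ, hC, hfv, hsem⟩ := hG Empty.elim
  refine ⟨Φ, Finset.eq_empty_of_forall_notMem fun x hx => ?_, hC, funext fun u => ?_⟩
  · obtain ⟨y, -⟩ := hfv x hx
    exact y.elim
  · exact (hsem u.1 u.2 _).trans (congrArg G (ext_val _ _ fun x => x.elim))

end WFODefinable

theorem wfoDefinable_of_mem_recSeries [Finite α] [Finite V]
    {G : PointedWord α V → Multiset (List R)} (hG : G ∈ recSeries α R V) :
    WFODefinable (fun _ => True) G := by
  induction hG using AddSubmonoid.closure_induction with
  | mem G hG =>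
    obtain ⟨k, P, w, hP, hw, rfl⟩ := hG
    exact .sumProd iteClosed_true (fun _ _ _ => trivial) hP hw
  | zero => exact .zero trivial
  | add G H _ _ ihG ihH => exact ihG.add (fun _ _ _ _ => trivial) ihH

theorem wfoDefinable_of_mem_recStepSeries [Finite α] [Finite V]
    {G : PointedWord α V → Multiset (List R)} (hG : G ∈ recStepSeries α R V) :
    WFODefinable WFO.NoFirstOrderSum G := by
  induction hG using AddSubmonoid.closure_induction with
  | mem G hG =>
    obtain ⟨P, w, hP, hw, rfl⟩ := hG
    exact .condProd iteClosed_noFirstOrderSum hP hw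
  | zero => exact .zero trivial
  | add G H _ _ ihG ihH => exact ihG.add (fun _ _ h₁ h₂ => ⟨h₁, h₂⟩) ihH

theorem recognizable_eq_zero_of_mem_recStepSeries {G : PointedWord α V → Multiset (List R)}
    (hG : G ∈ recStepSeries α R V) : Recognizable fun p => G p = 0 := by
  induction hG using AddSubmonoid.closure_induction with
  | mem G hG =>
    obtain ⟨P, w, hP, _, rfl⟩ := hG
    simpa only [condProd_eq_zero_iff] using hP.not
  | zero => simpa using Recognizable.const True
  | add G H _ _ ihG ihH => simpa using ihG.and ihH

theorem wfoDefinable_of_mem_recStepSeries_of_card_le_one [Finite α] [Finite V]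
    {G : PointedWord α V → Multiset (List R)} (hG : G ∈ recStepSeries α R V)
    (hcard : ∀ p, (G p).card ≤ 1) :
    WFODefinable (fun Φ => Φ.NoBinarySum ∧ Φ.NoFirstOrderSum) G := by
  classical
  have hC := (iteClosed_noBinarySum (α := α) (R := R)).and iteClosed_noFirstOrderSum
  induction hG using AddSubmonoid.closure_induction with
  | mem G hG =>
    obtain ⟨P, w, hP, hw, rfl⟩ := hG
    exact .condProd hC hP hw
  | zero => exact .zero hC.zero
  | add G H hG _ ihG ihH =>
    have hadd (p) : (G p).card + (H p).card ≤ 1 := by simpa using hcard p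
    have hzero : FODefinable fun p => G p = 0 :=
      ((recognizable_eq_zero_of_mem_recStepSeries hG).foDefinableFun True).congr (by simp)
    -- at most one of the summands is nonzero, so a conditional can replace the sum
    have hite := WFODefinable.ite hC hzero
      (ihH fun p => (Nat.le_add_left ..).trans (hadd p))
      (ihG fun p => (Nat.le_add_right ..).trans (hadd p))
    convert hite using 1
    funext p
    by_cases h : G p = 0
    · simp [h]
    · have hpos := Multiset.card_pos.2 h
      have hH : H p = 0 := Multiset.card_eq_zero.1 (by have := hadd p; lia)
      simp [h, hH]

end Definable

/-! ### Bounded recognizable series -/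

section Bounded

variable {α : Type u} {R : Type v} {V : Type}

theorem PointedWord.extend_subst_map_some (q : PointedWord α (Option V))
    (i : Fin q.word.length) :
    (q.extend i).subst (Option.map some) = (q.subst some).extend i :=
  ext_val _ _ fun o => by cases o <;> rfl

theorem Recognizable.exists_eq_of_unique {X : Type*} {Q : PointedWord α (Option V) → Prop}
    (hQ : Recognizable Q) {F : PointedWord α (Option V) → X} (hF : Recognizable F)
    (huniq : ∀ (p : PointedWord α V) i j, Q (p.extend i) → Q (p.extend j) → i = j) :
    ∃ G : PointedWord α V → X, Recognizable G ∧ ∀ p i, Q (p.extend i) → G p = F (p.extend i) := by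
  classical
  refine ⟨_, ((hQ.prodMk hF).range_extend.prodMk hF.extend_first).comp fun S =>
    if h : ∃ x, (True, x) ∈ S.1 then h.choose else S.2, fun p i hi => ?_⟩
  have h : ∃ x, (True, x) ∈ Set.range fun i => (Q (p.extend i), F (p.extend i)) :=
    ⟨F (p.extend i), i, by simp [hi]⟩
  rw [dif_pos h]
  obtain ⟨j, hj⟩ := h.choose_spec
  simp only [Prod.mk.injEq, eq_iff_iff, iff_true] at hj
  rw [← hj.2, huniq p i j hi hj.1]

theorem exists_sum_condProd_eq {P : PointedWord α (Option V) → Prop} (hP : Recognizable P)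
    {w : PointedWord α (Option (Option V)) → R} (hw : Recognizable w)
    (huniq : ∀ (p : PointedWord α V) i j, P (p.extend i) → P (p.extend j) → i = j) :
    ∃ w' : PointedWord α (Option V) → R, Recognizable w' ∧
      ∀ p : PointedWord α V, ∑ i, condProd P w (p.extend i) =
        condProd (fun p => ∃ i, P (p.extend i)) w' p := by
  classical
  -- the variables `none` for the position of the weight and `some none` for `i` change places
  have hswap (p : PointedWord α V) (z i : Fin p.word.length) :
      ((p.extend z).extend i).subst (fun o => o.elim (some none) (Option.map some)) =
        (p.extend i).extend z :=
    ext_val _ _ fun o => by rcases o with _ | _ | x <;> rfl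
  obtain ⟨w', hw', hsel⟩ := (hP.subst (Option.map some)).exists_eq_of_unique
    (hw.subst fun o => o.elim (some none) (Option.map some)) fun q i j hi hj => by
      rw [extend_subst_map_some] at hi hj
      exact huniq (q.subst some) i j hi hj
  refine ⟨w', hw', fun p => ?_⟩
  by_cases hex : ∃ i, P (p.extend i)
  · obtain ⟨i, hi⟩ := hex
    have hweight (z : Fin p.word.length) : w ((p.extend i).extend z) = w' (p.extend z) :=
      ((hsel (p.extend z) i (extend_subst_map_some (p.extend z) i ▸ hi)).trans
        (congrArg w (hswap p z i))).symm
    rw [Finset.sum_eq_single i, condProd, condProd, if_pos hi, if_pos ⟨i, hi⟩]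
    · exact congrArg (fun l => ({l} : Multiset (List R))) (congrArg List.ofFn (funext hweight))
    · exact fun j _ hj => if_neg fun hj' => hj (huniq p j i hj' hi)
    · simp
  · rw [condProd, if_neg hex]
    exact Finset.sum_eq_zero fun i _ => condProd_eq_zero_iff.2 fun hi => hex ⟨i, hi⟩

/-- `P` holds at some position before the value of `none`. -/
def HoldsBefore (P : PointedWord α (Option V) → Prop) (q : PointedWord α (Option V)) : Prop :=
  ∃ j < q.val none, P ((q.subst some).extend j)

theorem Recognizable.holdsBefore {P : PointedWord α (Option V) → Prop} (hP : Recognizable P) :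
    Recognizable (HoldsBefore P) := by
  have := ((lt none (some none)).and (hP.subst (Option.map some))).ex
  simp only [extend_subst_map_some] at this
  exact this

theorem exists_sum_condProd_eq_add {P : PointedWord α (Option V) → Prop} (hP : Recognizable P)
    {w : PointedWord α (Option (Option V)) → R} (hw : Recognizable w) :
    ∃ w' : PointedWord α (Option V) → R, Recognizable w' ∧
      ∀ p : PointedWord α V, ∑ i, condProd P w (p.extend i) =
        condProd (fun p => ∃ i, P (p.extend i)) w' p +
          ∑ i, condProd (fun q => P q ∧ HoldsBefore P q) w (p.extend i) := by
  classical
  have huniq (p : PointedWord α V) (i j) (hi : P (p.extend i) ∧ ¬ HoldsBefore P (p.extend i))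
      (hj : P (p.extend j) ∧ ¬ HoldsBefore P (p.extend j)) : i = j := by
    rcases lt_trichotomy i j with hlt | heq | hlt
    · exact absurd ⟨i, hlt, hi.1⟩ hj.2
    · exact heq
    · exact absurd ⟨j, hlt, hj.1⟩ hi.2
  have hfirst (p : PointedWord α V) :
      (∃ i, P (p.extend i) ∧ ¬ HoldsBefore P (p.extend i)) ↔ ∃ i, P (p.extend i) := by
    refine ⟨fun ⟨i, hi, _⟩ => ⟨i, hi⟩, fun hex => ?_⟩
    obtain ⟨i, hi, hmin⟩ := wellFounded_lt.has_min {i | P (p.extend i)} hex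
    exact ⟨i, hi, fun ⟨j, hj, hPj⟩ => hmin j hPj hj⟩
  obtain ⟨w', hw', hsum⟩ := exists_sum_condProd_eq (hP.and hP.holdsBefore.not) hw huniq
  simp only [hfirst] at hsum
  refine ⟨w', hw', fun p => ?_⟩
  rw [← hsum, ← Finset.sum_add_distrib]
  refine Finset.sum_congr rfl fun i _ => ?_
  by_cases h : P (p.extend i) <;> by_cases hbefore : HoldsBefore P (p.extend i) <;>
    simp [condProd, h, hbefore]

theorem sum_condProd_mem_recStepSeries_of_card_le {P : PointedWord α (Option V) → Prop}
    (hP : Recognizable P) {w : PointedWord α (Option (Option V)) → R} (hw : Recognizable w)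
    {K : ℕ} (hK : ∀ p : PointedWord α V, (∑ i, condProd P w (p.extend i)).card ≤ K) :
    (fun p : PointedWord α V => ∑ i, condProd P w (p.extend i)) ∈ recStepSeries α R V := by
  classical
  induction K generalizing P with
  | zero =>
    convert (recStepSeries α R V).zero_mem using 1
    exact funext fun p => Multiset.card_eq_zero.1 (Nat.le_zero.1 (hK p))
  | succ K ih =>
    obtain ⟨w', hw', hsplit⟩ := exists_sum_condProd_eq_add hP hw
    rw [funext hsplit]
    refine (recStepSeries α R V).add_mem (condProd_mem_recStepSeries hP.ex hw')
      (ih (hP.and hP.holdsBefore) fun p => ?_)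
    by_cases hex : ∃ i, P (p.extend i)
    · have hcard := hK p
      rw [hsplit, Multiset.card_add, condProd, if_pos hex, Multiset.card_singleton] at hcard
      lia
    · rw [Finset.sum_eq_zero fun i _ => condProd_eq_zero_iff.2 fun hi => hex ⟨i, hi.1⟩]
      exact Nat.zero_le K

theorem sum_extend_mem_recStepSeries_of_card_le
    {G : PointedWord α (Option V) → Multiset (List R)} (hG : G ∈ recStepSeries α R (Option V))
    {K : ℕ} (hK : ∀ p : PointedWord α V, (∑ i, G (p.extend i)).card ≤ K) :
    (fun p => ∑ i, G (p.extend i)) ∈ recStepSeries α R V := by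
  induction hG using AddSubmonoid.closure_induction with
  | mem G hG =>
    obtain ⟨P, w, hP, hw, rfl⟩ := hG
    exact sum_condProd_mem_recStepSeries_of_card_le hP hw hK
  | zero =>
    convert (recStepSeries α R V).zero_mem using 1
    funext p
    simp
  | add G H _ _ ihG ihH =>
    simp only [Pi.add_apply, Finset.sum_add_distrib, Multiset.card_add] at hK ⊢
    exact (recStepSeries α R V).add_mem (ihG fun p => (Nat.le_add_right ..).trans (hK p))
      (ihH fun p => (Nat.le_add_left ..).trans (hK p))

theorem sumProd_mem_recStepSeries_of_card_le {K k : ℕ} {P : PointedWord α (V ⊕ Fin k) → Prop}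
    (hP : Recognizable P) {w : PointedWord α (Option (V ⊕ Fin k)) → R} (hw : Recognizable w)
    (hK : ∀ p, (sumProd k P w p).card ≤ K) : sumProd k P w ∈ recStepSeries α R V := by
  induction k generalizing V with
  | zero =>
    rw [sumProd_zero]
    exact condProd_mem_recStepSeries (hP.subst _) (hw.subst _)
  | succ k ih =>
    simp only [sumProd_succ] at hK
    rw [show sumProd (k + 1) P w = _ from funext (sumProd_succ P w)]
    refine sum_extend_mem_recStepSeries_of_card_le (ih (hP.subst _) (hw.subst _) fun q => ?_) hK
    refine (Multiset.card_le_card ?_).trans (hK (q.subst some))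
    rw [← extend_subst_some q]
    exact Finset.single_le_sum_of_canonicallyOrdered (f := fun i => sumProd k _ _
      ((q.subst some).extend i)) (Finset.mem_univ (q.val none))

theorem mem_recStepSeries_of_card_le {G : PointedWord α V → Multiset (List R)}
    (hG : G ∈ recSeries α R V) {K : ℕ} (hK : ∀ p, (G p).card ≤ K) : G ∈ recStepSeries α R V := by
  induction hG using AddSubmonoid.closure_induction with
  | mem G hG =>
    obtain ⟨k, P, w, hP, hw, rfl⟩ := hG
    exact sumProd_mem_recStepSeries_of_card_le hP hw hK
  | zero => exact (recStepSeries α R V).zero_mem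
  | add G H _ _ ihG ihH =>
    simp only [Pi.add_apply, Multiset.card_add] at hK
    exact (recStepSeries α R V).add_mem (ihG fun p => (Nat.le_add_right ..).trans (hK p))
      (ihH fun p => (Nat.le_add_left ..).trans (hK p))

end Bounded

/-! ### Runs of weighted automata -/

namespace WAutomaton

variable {α : Type u} {R : Type v} {A B : WAutomaton α R}

theorem isRun_append {ρ ρ' : List A.Δ} : ∀ {p q : A.State},
    A.IsRun p (ρ ++ ρ') q ↔ ∃ r, A.IsRun p ρ r ∧ A.IsRun r ρ' q := by
  induction ρ with
  | nil => simp [IsRun]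
  | cons δ ρ ih =>
    intro p q
    simp [IsRun, ih, and_assoc]

theorem IsRun.unique {ρ : List A.Δ} (hρ : ρ ≠ []) : ∀ {p q p' q' : A.State},
    A.IsRun p ρ q → A.IsRun p' ρ q' → p = p' ∧ q = q' := by
  induction ρ with
  | nil => exact absurd rfl hρ
  | cons δ ρ ih =>
    rintro p q p' q' ⟨rfl, h⟩ ⟨rfl, h'⟩
    refine ⟨rfl, ?_⟩
    by_cases hρ' : ρ = []
    · subst hρ'
      exact (show _ = _ from h).symm.trans h'
    · exact (ih hρ' h h').2

theorem label_append (ρ ρ' : List A.Δ) : A.label (ρ ++ ρ') = A.label ρ ++ A.label ρ' := by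
  simp [label]

theorem append_mem_lang {p q : A.State} {x y : List α} :
    x ++ y ∈ A.lang p q ↔ ∃ r, x ∈ A.lang p r ∧ y ∈ A.lang r q := by
  constructor
  · rintro ⟨ρ, hρ, hl⟩
    obtain ⟨ρ₁, ρ₂, rfl, h₁, h₂⟩ := List.map_eq_append_iff.1 hl
    obtain ⟨r, hr, hr'⟩ := isRun_append.1 hρ
    exact ⟨r, ⟨ρ₁, hr, h₁⟩, ⟨ρ₂, hr', h₂⟩⟩
  · rintro ⟨r, ⟨ρ₁, hr, h₁⟩, ⟨ρ₂, hr', h₂⟩⟩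
    exact ⟨ρ₁ ++ ρ₂, isRun_append.2 ⟨r, hr, hr'⟩, by rw [label_append, h₁, h₂]⟩

variable (A) in
theorem aperiodic_iff : A.Aperiodic ↔
    HasAperiodicKer fun x : List α => {s : A.State × A.State | x ∈ A.lang s.1 s.2} := by
  constructor
  · rintro ⟨m, _, h⟩
    refine ⟨fun {x x' y y'} hx hy => Set.ext fun s => ?_, m, fun x => Set.ext fun s => ?_⟩
    · have hx' := fun r => Set.ext_iff.1 hx (s.1, r)
      have hy' := fun r => Set.ext_iff.1 hy (r, s.2)
      simp only [Set.mem_ofPred_eq] at hx' hy' ⊢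
      simp only [append_mem_lang, hx', hy']
    · by_cases hx : x = []
      · simp only [hx, wordPow_nil]
      · exact h s.1 s.2 x hx
  · intro h
    obtain ⟨N, hN⟩ := h.exists_wordPow
    refine ⟨N + 1, N.succ_pos, fun p q x _ => ?_⟩
    exact Set.ext_iff.1 (h.wordPow_eq_of_le hN N.le_succ x) (p, q)

section Semantics

variable [Finite α] (A)

theorem finite_successfulRuns (x : List α) : (A.successfulRuns x).Finite := by
  refine (List.finite_length_eq A.Δ x.length).subset ?_
  rintro ρ ⟨p, -, q, -, -, h⟩
  simp [← h, label]

theorem usemFrom_eq_sum (p q : A.State) (x : List α) :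
    A.usemFrom p q x = ∑ ρ ∈ (A.finite_runs p q x).toFinset, {A.weight ρ} := by
  rw [usemFrom, ← Multiset.sum_map_singleton (Multiset.map _ _), Multiset.map_map]
  rfl

theorem usem_eq_sum (x : {x : List α // x ≠ []}) :
    A.usem x = ∑ ρ ∈ (A.finite_successfulRuns x.1).toFinset, {A.weight ρ} := by
  classical
  have h : (A.finite_successfulRuns x.1).toFinset =
      (A.init.toFinite.toFinset ×ˢ A.final.toFinite.toFinset).biUnion
        fun s => (A.finite_runs s.1 s.2 x.1).toFinset := by
    ext ρ
    simp [successfulRuns]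
  rw [h, Finset.sum_biUnion, Finset.sum_product]
  · exact Finset.sum_congr rfl fun p _ => Finset.sum_congr rfl fun q _ =>
      A.usemFrom_eq_sum p q x.1
  · intro s _ s' _ hs
    rw [Function.onFun, Finset.disjoint_left]
    intro ρ hρ hρ'
    rw [Set.Finite.mem_toFinset] at hρ hρ'
    have hne : ρ ≠ [] := by
      rintro rfl
      exact x.2 hρ.2.symm
    have := hρ.1.unique hne hρ'.1
    exact hs (Prod.ext this.1 this.2)

theorem card_usem (x : {x : List α // x ≠ []}) :
    ((A.usem x).card : ℕ∞) = (A.successfulRuns x.1).encard := by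
  rw [usem_eq_sum, Multiset.card_sum, (A.finite_successfulRuns x.1).encard_eq_coe_toFinset_card]
  simp

open Classical in
theorem usem_eq_sum_ite [Fintype A.State] (x : {x : List α // x ≠ []}) :
    A.usem x = ∑ p, if p ∈ A.init then
      ∑ q, if q ∈ A.final then A.usemFrom p q x.1 else 0 else 0 := by
  simp only [usem, ← Finset.sum_filter]
  congr! with p <;> ext <;> simp

end Semantics

/-! ### Sums of automata -/

variable (A B) in
/-- An isomorphism of `A` with the part of `B` that is reachable from the image of `A`. -/
structure Embedding where
  toFun : A.State → B.State
  injective : Function.Injective toFun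
  mapTransition : A.Δ → B.Δ
  coe_mapTransition : ∀ δ, (mapTransition δ).1 = (toFun δ.1.1, δ.1.2.1, toFun δ.1.2.2)
  wgt_mapTransition : ∀ δ, B.wgt (mapTransition δ) = A.wgt δ
  exists_mapTransition_eq : ∀ (p : A.State) (δ : B.Δ), δ.1.1 = toFun p →
    ∃ δ', mapTransition δ' = δ

namespace Embedding

variable (e : Embedding A B)

theorem mapTransition_injective : Function.Injective e.mapTransition := by
  intro δ δ' h
  have h' := congrArg Subtype.val h
  simp only [e.coe_mapTransition, Prod.mk.injEq, e.injective.eq_iff] at h'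
  exact Subtype.ext (Prod.ext h'.1 (Prod.ext h'.2.1 h'.2.2))

theorem label_map (ρ : List A.Δ) : B.label (ρ.map e.mapTransition) = A.label ρ := by
  simp [label, Function.comp_def, e.coe_mapTransition]

theorem weight_map (ρ : List A.Δ) : B.weight (ρ.map e.mapTransition) = A.weight ρ := by
  simp [weight, Function.comp_def, e.wgt_mapTransition]

theorem isRun_iff {ρ : List B.Δ} : ∀ {p : A.State} {q : B.State},
    B.IsRun (e.toFun p) ρ q ↔
      ∃ q' ρ', e.toFun q' = q ∧ A.IsRun p ρ' q' ∧ ρ'.map e.mapTransition = ρ := by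
  induction ρ with
  | nil => simp [IsRun]
  | cons δ ρ ih =>
    intro p q
    constructor
    · rintro ⟨hp, h⟩
      obtain ⟨δ, rfl⟩ := e.exists_mapTransition_eq p δ hp
      rw [e.coe_mapTransition] at hp h
      obtain ⟨q', ρ', rfl, hρ, rfl⟩ := ih.1 h
      exact ⟨q', δ :: ρ', rfl, ⟨e.injective hp, hρ⟩, rfl⟩
    · rintro ⟨q', _ | ⟨δ', ρ'⟩, rfl, hρ, h⟩
      · simp at h
      · obtain ⟨rfl, rfl⟩ := List.cons.inj h
        have h' : B.IsRun (e.toFun δ'.1.2.2) (ρ'.map e.mapTransition) (e.toFun q') :=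
          ih.2 ⟨q', ρ', rfl, hρ.2, rfl⟩
        simp only [IsRun, e.coe_mapTransition]
        exact ⟨congrArg e.toFun hρ.1, h'⟩

theorem runs_eq_image (p q : A.State) (x : List α) :
    B.runs (e.toFun p) (e.toFun q) x = List.map e.mapTransition '' A.runs p q x := by
  ext ρ
  constructor
  · rintro ⟨hρ, hx⟩
    obtain ⟨q', ρ', hq, hρ', rfl⟩ := e.isRun_iff.1 hρ
    obtain rfl := e.injective hq
    exact ⟨ρ', ⟨hρ', by rwa [e.label_map] at hx⟩, rfl⟩
  · rintro ⟨ρ', ⟨hρ', rfl⟩, rfl⟩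
    exact ⟨e.isRun_iff.2 ⟨q, ρ', rfl, hρ', rfl⟩, e.label_map ρ'⟩

theorem runs_eq_empty (p : A.State) {q : B.State} (hq : ∀ q', e.toFun q' ≠ q) (x : List α) :
    B.runs (e.toFun p) q x = ∅ := by
  refine Set.eq_empty_of_forall_notMem fun ρ hρ => ?_
  obtain ⟨q', -, hq', -⟩ := e.isRun_iff.1 hρ.1
  exact hq q' hq'

theorem mem_lang_iff {p q : A.State} {x : List α} :
    x ∈ B.lang (e.toFun p) (e.toFun q) ↔ x ∈ A.lang p q := by
  rw [lang, lang, Set.mem_ofPred_eq, Set.mem_ofPred_eq, e.runs_eq_image, Set.image_nonempty]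

theorem notMem_lang (p : A.State) {q : B.State} (hq : ∀ q', e.toFun q' ≠ q) (x : List α) :
    x ∉ B.lang (e.toFun p) q := by
  rw [lang, Set.mem_ofPred_eq, e.runs_eq_empty p hq]
  exact Set.not_nonempty_empty

theorem usemFrom_eq [Finite α] (p q : A.State) (x : List α) :
    B.usemFrom (e.toFun p) (e.toFun q) x = A.usemFrom p q x := by
  classical
  have h : (B.finite_runs (e.toFun p) (e.toFun q) x).toFinset =
      (A.finite_runs p q x).toFinset.image (List.map e.mapTransition) := by
    ext ρ
    simp [e.runs_eq_image]
  rw [usemFrom_eq_sum, usemFrom_eq_sum, h,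
    Finset.sum_image (List.map_injective_iff.2 e.mapTransition_injective).injOn]
  simp only [e.weight_map]

theorem usemFrom_eq_zero [Finite α] (p : A.State) {q : B.State} (hq : ∀ q', e.toFun q' ≠ q)
    (x : List α) : B.usemFrom (e.toFun p) q x = 0 := by
  simp [usemFrom_eq_sum, e.runs_eq_empty p hq]

open Classical in
theorem sum_usemFrom [Finite α] [Fintype A.State] [Fintype B.State]
    (he : ∀ q, e.toFun q ∈ B.final ↔ q ∈ A.final) (p : A.State) (x : List α) :
    (∑ q, if q ∈ B.final then B.usemFrom (e.toFun p) q x else 0) =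
      ∑ q, if q ∈ A.final then A.usemFrom p q x else 0 := by
  refine (Fintype.sum_of_injective e.toFun e.injective _ _ (fun q hq => ?_) fun q => ?_).symm
  · rw [e.usemFrom_eq_zero p (fun q' h => hq ⟨q', h⟩), ite_self]
  · rw [e.usemFrom_eq, if_congr (he q) rfl rfl]

end Embedding

/-- The automaton without states, whose semantics is the constant empty multiset. -/
def empty (α : Type u) (R : Type v) : WAutomaton α R where
  State := Empty
  finite_state := inferInstance
  Δ := ∅
  wgt δ := δ.2.elim
  init := ∅
  final := ∅

theorem empty_usem [Finite α] (x) : (empty α R).usem x = 0 := by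
  simp [usem, empty]

theorem empty_aperiodic : (empty α R).Aperiodic := ⟨1, le_rfl, fun p => p.elim⟩

variable (A B)

/-- A transition of one of two automata as a transition of their disjoint union. -/
def sumTransition : A.Δ ⊕ B.Δ → (A.State ⊕ B.State) × α × (A.State ⊕ B.State)
  | .inl δ => (.inl δ.1.1, δ.1.2.1, .inl δ.1.2.2)
  | .inr δ => (.inr δ.1.1, δ.1.2.1, .inr δ.1.2.2)

theorem sumTransition_injective : Function.Injective (sumTransition A B) := by
  rintro (⟨⟨p, a, q⟩, h⟩ | ⟨⟨p, a, q⟩, h⟩) (⟨⟨p', a', q'⟩, h'⟩ | ⟨⟨p', a', q'⟩, h'⟩) <;>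
    simp [sumTransition]

/-- The disjoint union of two automata, whose semantics is the sum of their semantics. -/
noncomputable def sum : WAutomaton α R where
  State := A.State ⊕ B.State
  finite_state := inferInstance
  Δ := Set.range (sumTransition A B)
  wgt δ := Sum.elim A.wgt B.wgt ((Equiv.ofInjective _ (sumTransition_injective A B)).symm δ)
  init := Sum.elim A.init B.init
  final := Sum.elim A.final B.final

/-- The first automaton as a part of the disjoint union. -/
noncomputable def embInl : Embedding A (sum A B) where
  toFun := .inl
  injective := Sum.inl_injective
  mapTransition δ := ⟨_, .inl δ, rfl⟩
  coe_mapTransition _ := rfl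
  wgt_mapTransition δ := congrArg (Sum.elim A.wgt B.wgt)
    (Equiv.ofInjective_symm_apply (sumTransition_injective A B) (.inl δ))
  exists_mapTransition_eq := by
    rintro p ⟨_, δ | δ, rfl⟩ h
    · exact ⟨δ, rfl⟩
    · simp [sumTransition] at h

/-- The second automaton as a part of the disjoint union. -/
noncomputable def embInr : Embedding B (sum A B) where
  toFun := .inr
  injective := Sum.inr_injective
  mapTransition δ := ⟨_, .inr δ, rfl⟩
  coe_mapTransition _ := rfl
  wgt_mapTransition δ := congrArg (Sum.elim A.wgt B.wgt)
    (Equiv.ofInjective_symm_apply (sumTransition_injective A B) (.inr δ))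
  exists_mapTransition_eq := by
    rintro p ⟨_, δ | δ, rfl⟩ h
    · simp [sumTransition] at h
    · exact ⟨δ, rfl⟩

variable {A B} in
theorem Aperiodic.sum (hA : A.Aperiodic) (hB : B.Aperiodic) : (sum A B).Aperiodic := by
  rw [aperiodic_iff] at hA hB
  obtain ⟨N, hN⟩ := (hA.prodMk hB).exists_wordPow
  have h := fun x => (hA.prodMk hB).wordPow_eq_of_le hN N.le_succ x
  simp only [Prod.mk.injEq] at h
  refine ⟨N + 1, N.succ_pos, ?_⟩
  rintro (p | p) (q | q) x -
  · exact (embInl A B).mem_lang_iff.trans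
      ((Set.ext_iff.1 (h x).1 (p, q)).trans (embInl A B).mem_lang_iff.symm)
  · exact iff_of_false ((embInl A B).notMem_lang p (fun _ => Sum.inl_ne_inr) _)
      ((embInl A B).notMem_lang p (fun _ => Sum.inl_ne_inr) _)
  · exact iff_of_false ((embInr A B).notMem_lang p (fun _ => Sum.inr_ne_inl) _)
      ((embInr A B).notMem_lang p (fun _ => Sum.inr_ne_inl) _)
  · exact (embInr A B).mem_lang_iff.trans
      ((Set.ext_iff.1 (h x).2 (p, q)).trans (embInr A B).mem_lang_iff.symm)

theorem sum_usem [Finite α] (x : {x : List α // x ≠ []}) :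
    (sum A B).usem x = A.usem x + B.usem x := by
  classical
  have := Fintype.ofFinite A.State
  have := Fintype.ofFinite B.State
  let : Fintype (sum A B).State := inferInstanceAs (Fintype (A.State ⊕ B.State))
  rw [usem_eq_sum_ite, usem_eq_sum_ite, usem_eq_sum_ite]
  refine (Fintype.sum_sum_type (α₁ := A.State) (α₂ := B.State) (M := Multiset (List R)) _).trans
    (congrArg₂ _ ?_ ?_)
  · exact Finset.sum_congr rfl fun p _ => if_congr Iff.rfl
      ((embInl A B).sum_usemFrom (fun _ => Iff.rfl) p x.1) rfl
  · exact Finset.sum_congr rfl fun p _ => if_congr Iff.rfl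
      ((embInr A B).sum_usemFrom (fun _ => Iff.rfl) p x.1) rfl

end WAutomaton

/-! ### Guessing a decoration of the input -/

section Guess

variable {B : Type u} {B' : Type w} {R : Type v} {M : Type} [Monoid M]

theorem hasAperiodicKer_prod_map (φ : B' → M) {N : ℕ} (hN : ∀ x : M, x ^ N = x ^ (N + 1)) :
    HasAperiodicKer fun y : List B' => (y.map φ).prod where
  append h h' := by simp only [List.map_append, List.prod_append, h, h']
  exists_wordPow := ⟨N, fun y => by simp [wordPow, List.map_flatten, List.prod_flatten, hN]⟩

/-- `δ` is a transition of the automaton below that guesses the letter `b`. The last condition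
excludes the guesses which cannot occur in a successful run. -/
structure IsGuess (π : B' → B) (φ : B' → M) (S : Set M) (δ : (M × M) × B × (M × M)) (b : B') :
    Prop where
  map_eq : π b = δ.2.1
  fst_mul : δ.1.1 * φ b = δ.2.2.1
  mul_snd : φ b * δ.2.2.2 = δ.1.2
  mem : δ.1.1 * δ.1.2 ∈ S

/-- The automaton that reads `x` and guesses a word `y` with `y.map π = x` and
`(y.map φ).prod ∈ S`. A state consists of the product of the letters guessed so far and of the
product of the letters still to be guessed. -/
noncomputable def guessAutomaton [Finite M] (π : B' → B) (φ : B' → M) (S : Set M)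
    (wt : M → B' → M → R) : WAutomaton B R where
  State := M × M
  finite_state := inferInstance
  Δ := {δ | ∃ b, IsGuess π φ S δ b}
  wgt δ := wt δ.1.1.1 δ.2.choose δ.1.2.2.2
  init := {s | s.1 = 1 ∧ s.2 ∈ S}
  final := {s | s.2 = 1}

/-- The weight sequence of a run of the automaton that guesses `y`, when the run starts with the
product `l` of the letters guessed before and ends with the product `r` of those guessed after. -/
def guessWeight (φ : B' → M) (wt : M → B' → M → R) (l : M) (y : List B') (r : M) : List R :=
  List.ofFn fun i : Fin y.length =>
    wt (l * ((y.take i).map φ).prod) y[i] (((y.drop (i + 1)).map φ).prod * r)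

theorem guessWeight_cons (φ : B' → M) (wt : M → B' → M → R) (l : M) (b : B') (y : List B')
    (r : M) : guessWeight φ wt l (b :: y) r =
      wt l b ((y.map φ).prod * r) :: guessWeight φ wt (l * φ b) y r := by
  simp only [guessWeight, List.length_cons, List.ofFn_succ]
  simp [mul_assoc]

namespace guessAutomaton

variable [Finite M] {π : B' → B} {φ : B' → M} {S : Set M} {wt : M → B' → M → R}

/-- The letter guessed by a transition. -/
noncomputable def guess (δ : (guessAutomaton π φ S wt).Δ) : B' := δ.2.choose

theorem isGuess_guess (δ : (guessAutomaton π φ S wt).Δ) : IsGuess π φ S δ.1 (guess δ) :=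
  δ.2.choose_spec

theorem map_guess (ρ : List (guessAutomaton π φ S wt).Δ) :
    (ρ.map guess).map π = (guessAutomaton π φ S wt).label ρ := by
  simp [WAutomaton.label, Function.comp_def, (isGuess_guess _).map_eq]

theorem prod_guess {ρ : List (guessAutomaton π φ S wt).Δ} :
    ∀ {p q : (guessAutomaton π φ S wt).State}, (guessAutomaton π φ S wt).IsRun p ρ q →
      p.1 * ((ρ.map guess).map φ).prod = q.1 ∧ ((ρ.map guess).map φ).prod * q.2 = p.2 := by
  induction ρ with
  | nil =>
    rintro p q h
    obtain rfl : p = q := h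
    simp
  | cons δ ρ ih =>
    rintro p q ⟨rfl, h⟩
    have hδ := isGuess_guess δ
    rw [List.map_cons, List.map_cons, List.prod_cons, ← mul_assoc, hδ.fst_mul, mul_assoc,
      (ih h).2, hδ.mul_snd]
    exact ⟨(ih h).1, rfl⟩

theorem weight_eq_guessWeight {ρ : List (guessAutomaton π φ S wt).Δ} :
    ∀ {p q : (guessAutomaton π φ S wt).State}, (guessAutomaton π φ S wt).IsRun p ρ q →
      (guessAutomaton π φ S wt).weight ρ = guessWeight φ wt p.1 (ρ.map guess) q.2 := by
  induction ρ with
  | nil => exact fun _ => rfl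
  | cons δ ρ ih =>
    rintro p q ⟨rfl, h⟩
    rw [List.map_cons, guessWeight_cons, (prod_guess h).2, (isGuess_guess δ).fst_mul, ← ih h]
    rfl

theorem eq_of_map_guess_eq {ρ : List (guessAutomaton π φ S wt).Δ} :
    ∀ {ρ' : List (guessAutomaton π φ S wt).Δ} {p q p' q' : (guessAutomaton π φ S wt).State},
      (guessAutomaton π φ S wt).IsRun p ρ q → (guessAutomaton π φ S wt).IsRun p' ρ' q' →
      p.1 = p'.1 → q.2 = q'.2 → ρ.map guess = ρ'.map guess → ρ = ρ' := by
  induction ρ with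
  | nil => exact fun _ _ _ _ hρ => (List.map_eq_nil_iff.1 hρ.symm).symm
  | cons δ ρ ih =>
    rintro (_ | ⟨δ', ρ'⟩) p q p' q' ⟨rfl, h⟩ ⟨rfl, h'⟩ hp hq hρ
    · simp at hρ
    obtain ⟨hhead, htail⟩ : guess δ = guess δ' ∧ ρ.map guess = ρ'.map guess := List.cons.inj hρ
    have hδ := isGuess_guess δ
    have hδ' := isGuess_guess δ'
    rw [← hhead] at hδ'
    have hfst : δ.1.2.2.1 = δ'.1.2.2.1 := by rw [← hδ.fst_mul, ← hδ'.fst_mul, hp]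
    have hsnd : δ.1.2.2.2 = δ'.1.2.2.2 := by
      rw [← (prod_guess h).2, ← (prod_guess h').2, hq, htail]
    have hsource : δ.1.1 = δ'.1.1 :=
      Prod.ext hp (by rw [← hδ.mul_snd, ← hδ'.mul_snd, hsnd])
    have hletter : δ.1.2.1 = δ'.1.2.1 := hδ.map_eq.symm.trans hδ'.map_eq
    obtain rfl : δ = δ' :=
      Subtype.ext (Prod.ext hsource (Prod.ext hletter (Prod.ext hfst hsnd)))
    rw [ih h h' hfst hq htail]

section UniqueGuess

variable (hS : ∀ l r b b', π b = π b' → l * φ b * r ∈ S → l * φ b' * r ∈ S → b = b')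
include hS

theorem guess_eq {δ : (guessAutomaton π φ S wt).Δ} {b : B'} (hb : IsGuess π φ S δ.1 b) :
    guess δ = b := by
  have hδ := isGuess_guess δ
  refine hS δ.1.1.1 δ.1.2.2.2 _ _ (hδ.map_eq.trans hb.map_eq.symm) ?_ ?_
  · rw [mul_assoc, hδ.mul_snd]
    exact hδ.mem
  · rw [mul_assoc, hb.mul_snd]
    exact hb.mem

theorem exists_isRun {y : List B'} : ∀ {l r : M}, l * ((y.map φ).prod * r) ∈ S →
    ∃ ρ, (guessAutomaton π φ S wt).IsRun (l, (y.map φ).prod * r) ρ (l * (y.map φ).prod, r) ∧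
      ρ.map guess = y := by
  induction y with
  | nil => exact fun _ => ⟨[], Prod.ext (mul_one _).symm (one_mul _), rfl⟩
  | cons b y ih =>
    intro l r h
    rw [List.map_cons, List.prod_cons] at h ⊢
    obtain ⟨ρ, hρ, hy⟩ := ih (l := l * φ b) (r := r) (by simpa only [mul_assoc] using h)
    have hb : IsGuess π φ S
        ((l, φ b * (y.map φ).prod * r), π b, (l * φ b, (y.map φ).prod * r)) b :=
      ⟨rfl, rfl, (mul_assoc _ _ _).symm, h⟩
    refine ⟨⟨_, b, hb⟩ :: ρ, ⟨rfl, ?_⟩, ?_⟩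
    · rwa [← mul_assoc]
    · rw [List.map_cons, guess_eq hS hb, hy]

theorem mem_lang_iff {x : List B} (hx : x ≠ []) {p q : (guessAutomaton π φ S wt).State} :
    x ∈ (guessAutomaton π φ S wt).lang p q ↔ p.1 * p.2 ∈ S ∧
      ∃ y : List B', y.map π = x ∧ p.1 * (y.map φ).prod = q.1 ∧ (y.map φ).prod * q.2 = p.2 := by
  constructor
  · rintro ⟨ρ, hρ, rfl⟩
    refine ⟨?_, ρ.map guess, map_guess ρ, prod_guess hρ⟩
    cases ρ with
    | nil => exact absurd rfl hx
    | cons δ ρ => exact hρ.1 ▸ (isGuess_guess δ).mem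
  · rintro ⟨hp, y, rfl, hq, hp'⟩
    obtain ⟨ρ, hρ, rfl⟩ := exists_isRun (wt := wt) hS (y := y) (l := p.1) (r := q.2) (hp'.symm ▸ hp)
    rw [hp', hq] at hρ
    exact ⟨ρ, hρ, (map_guess ρ).symm⟩

theorem mem_lang_of_projectionValues_eq {emb : B → B'} {k : ℕ}
    (hk : ∀ l r y, l * (y.map φ).prod * r ∈ S → markCount π emb y ≤ k) {x x' : List B}
    (hx : x ≠ []) (hx' : x' ≠ [])
    (h : projectionValues (fun y => (y.map φ).prod) π emb k x =
      projectionValues (fun y => (y.map φ).prod) π emb k x')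
    {p q : (guessAutomaton π φ S wt).State} (hpq : x ∈ (guessAutomaton π φ S wt).lang p q) :
    x' ∈ (guessAutomaton π φ S wt).lang p q := by
  obtain ⟨hp, y, hy, hq, hp'⟩ := (mem_lang_iff hS hx).1 hpq
  have hcount : markCount π emb y ≤ k := hk p.1 q.2 y (by rwa [mul_assoc, hp'])
  obtain ⟨y', hy', -, hval⟩ :=
    (congrFun h ⟨_, Nat.lt_succ_of_le hcount⟩).subset ⟨y, hy, rfl, rfl⟩
  dsimp only at hval
  exact (mem_lang_iff hS hx').2 ⟨hp, y', hy', by rw [hval, hq], by rw [hval, hp']⟩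

theorem aperiodic {emb : B → B'} (hemb : Function.LeftInverse π emb) {k N : ℕ}
    (hk : ∀ l r y, l * (y.map φ).prod * r ∈ S → markCount π emb y ≤ k)
    (hN : ∀ x : M, x ^ N = x ^ (N + 1)) : (guessAutomaton π φ S wt).Aperiodic := by
  have hproj := (hasAperiodicKer_prod_map φ hN).projectionValues hemb k
  obtain ⟨m, hm⟩ := hproj.exists_wordPow
  refine ⟨m + 1, m.succ_pos, fun p q x hx => ?_⟩
  have hne (n : ℕ) : (List.replicate (n + 1) x).flatten ≠ [] := by
    simp [List.replicate_succ, hx]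
  have hpow := hproj.wordPow_eq_of_le hm m.le_succ x
  exact ⟨mem_lang_of_projectionValues_eq hS hk (hne _) (hne _) hpow,
    mem_lang_of_projectionValues_eq hS hk (hne _) (hne _) hpow.symm⟩

theorem bijOn_successfulRuns (x : List B) :
    Set.BijOn (List.map guess) ((guessAutomaton π φ S wt).successfulRuns x)
      {y | y.map π = x ∧ (y.map φ).prod ∈ S} := by
  refine ⟨?_, ?_, ?_⟩
  · rintro ρ ⟨p, hp, q, hq, hρ, rfl⟩
    have h := (prod_guess hρ).2
    rw [show q.2 = 1 from hq, mul_one] at h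
    exact ⟨map_guess ρ, h ▸ hp.2⟩
  · rintro ρ ⟨p, hp, q, hq, hρ, -⟩ ρ' ⟨p', hp', q', hq', hρ', -⟩ h
    exact eq_of_map_guess_eq hρ hρ' (hp.1.trans hp'.1.symm) (Eq.trans hq (Eq.symm hq')) h
  · rintro y ⟨rfl, hy⟩
    obtain ⟨ρ, hρ, rfl⟩ := exists_isRun (wt := wt) hS (y := y) (l := 1) (r := 1) (by simpa using hy)
    exact ⟨ρ, ⟨_, ⟨rfl, by simpa using hy⟩, _, rfl, hρ, (map_guess ρ).symm⟩, rfl⟩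

theorem usem_eq_finsum [Finite B] (x : {x : List B // x ≠ []}) :
    (guessAutomaton π φ S wt).usem x =
      ∑ᶠ y ∈ {y | y.map π = x.1 ∧ (y.map φ).prod ∈ S}, {guessWeight φ wt 1 y 1} := by
  rw [WAutomaton.usem_eq_sum, ← finsum_mem_eq_finite_toFinset_sum]
  refine finsum_mem_eq_of_bijOn _ (bijOn_successfulRuns hS x.1) ?_
  rintro ρ ⟨p, hp, q, hq, hρ, -⟩
  rw [weight_eq_guessWeight hρ, hp.1, show q.2 = 1 from hq]

end UniqueGuess

end guessAutomaton

end Guess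

/-! ### Recognizable series are given by aperiodic automata -/

section

variable {α : Type u} {R : Type v} {V : Type}

theorem snd_eq_compl_allMarks {y z : List (α × Set V)} {b : α × Set V}
    (hd : MarksDisjoint (y ++ b :: z)) (hu : allMarks (y ++ b :: z) = Set.univ) :
    b.2 = (allMarks y ∪ allMarks z)ᶜ := by
  rw [marksDisjoint_append, marksDisjoint_cons, allMarks_cons, Set.disjoint_union_right] at hd
  rw [allMarks_append, allMarks_cons, Set.union_left_comm] at hu
  exact eq_compl_iff_isCompl.2 ⟨Set.disjoint_union_right.2 ⟨hd.2.2.1.symm, hd.2.1.2⟩,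
    codisjoint_iff.2 hu⟩

section AcceptedValues

variable {M : Type} [Monoid M] (φ : α × Set V → M) (P : PointedWord α V → Prop)

/-- The products of the encodings of the pointed words which satisfy `P`. -/
def acceptedValues : Set M := {m | ∃ p, P p ∧ (p.mark.map φ).prod = m}

variable {φ P} (hφ : ∀ y z : List (α × Set V), (y.map φ).prod = (z.map φ).prod →
  allMarks y = allMarks z ∧ (MarksDisjoint y ↔ MarksDisjoint z))
include hφ

theorem marks_of_prod_mem_acceptedValues {y : List (α × Set V)}
    (hy : (y.map φ).prod ∈ acceptedValues φ P) : MarksDisjoint y ∧ allMarks y = Set.univ := by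
  obtain ⟨p, -, hp⟩ := hy
  obtain ⟨hu, hd⟩ := hφ _ _ hp
  exact ⟨hd.1 p.marksDisjoint_mark, hu.symm.trans p.allMarks_mark⟩

theorem eq_of_mem_acceptedValues
    (hsurj : Function.Surjective fun y : List (α × Set V) => (y.map φ).prod) (l r : M)
    (b b' : α × Set V) (hfst : b.1 = b'.1) (hb : l * φ b * r ∈ acceptedValues φ P)
    (hb' : l * φ b' * r ∈ acceptedValues φ P) : b = b' := by
  obtain ⟨y, rfl⟩ := hsurj l
  obtain ⟨z, rfl⟩ := hsurj r
  have hsnd {c : α × Set V} (hc : (y.map φ).prod * φ c * (z.map φ).prod ∈ acceptedValues φ P) :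
      c.2 = (allMarks y ∪ allMarks z)ᶜ := by
    have hmarks := marks_of_prod_mem_acceptedValues hφ (P := P) (y := y ++ c :: z)
      (by simpa [mul_assoc] using hc)
    exact snd_eq_compl_allMarks hmarks.1 hmarks.2
  exact Prod.ext hfst ((hsnd hb).trans (hsnd hb').symm)

theorem markCount_le_of_mem_acceptedValues [Finite V]
    (hsurj : Function.Surjective fun y : List (α × Set V) => (y.map φ).prod)
    (l r : M) (x : List (α × Set V))
    (hx : l * (x.map φ).prod * r ∈ acceptedValues φ P) :
    markCount Prod.fst (fun a => (a, (∅ : Set V))) x ≤ Nat.card V := by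
  obtain ⟨y, rfl⟩ := hsurj l
  obtain ⟨z, rfl⟩ := hsurj r
  have hd : MarksDisjoint (y ++ x ++ z) :=
    (marks_of_prod_mem_acceptedValues hφ (by simpa only [List.map_append, List.prod_append])).1
  exact (markCount_le_of_marksDisjoint
    (marksDisjoint_append.1 (marksDisjoint_append.1 hd).1).2.1).trans (Set.ncard_le_card _)

theorem bijOn_mark (hP : ∀ p q : PointedWord α V,
      (p.mark.map φ).prod = (q.mark.map φ).prod → (P p ↔ P q)) {u : List α} (hu : u ≠ []) :
    Set.BijOn (fun τ => (⟨u, hu, τ⟩ : PointedWord α V).mark) {τ | P ⟨u, hu, τ⟩}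
      {y | y.map Prod.fst = u ∧ (y.map φ).prod ∈ acceptedValues φ P} := by
  refine ⟨fun τ hτ => ⟨mark_map_fst _, _, hτ, rfl⟩, fun τ _ τ' _ h => ?_, ?_⟩
  · have h' := mark_injective h
    simpa using h'
  · rintro y ⟨hfst, hy⟩
    have hmarks := marks_of_prod_mem_acceptedValues hφ hy
    obtain ⟨⟨v, hv, τ⟩, rfl⟩ := exists_mark_eq (by rintro rfl; exact hu hfst.symm) hmarks.1 hmarks.2
    obtain rfl : v = u := (mark_map_fst ⟨v, hv, τ⟩).symm.trans hfst
    obtain ⟨q, hq, hqp⟩ := hy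
    exact ⟨τ, (hP _ _ hqp).1 hq, rfl⟩

end AcceptedValues

/-- Adds the mark `none` to a letter. -/
def addNone (b : α × Set V) : α × Set (Option V) := (b.1, insert none (some '' b.2))

theorem mark_extend (p : PointedWord α V) (i : Fin p.word.length) :
    (p.extend i).mark = (p.mark.take i).map Recognizable.embSome ++
      addNone (p.mark[(i : ℕ)]'(p.length_mark.symm ▸ i.2)) ::
        (p.mark.drop (i + 1)).map Recognizable.embSome := by
  have hset : (p.extend i).mark = (p.mark.map Recognizable.embSome).set i
      (addNone (p.mark[(i : ℕ)]'(p.length_mark.symm ▸ i.2))) := by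
    refine List.ext_getElem (by simp [length_mark, extend]) fun j hj hj' => ?_
    rw [List.getElem_set]
    split_ifs with h
    · subst h
      simp only [getElem_mark, addNone]
      refine Prod.ext rfl (Set.ext fun o => ?_)
      cases o <;> simp [extend]
    · simp only [getElem_mark, List.getElem_map, Recognizable.embSome]
      refine Prod.ext rfl (Set.ext fun o => ?_)
      cases o <;> simp [extend, Fin.ext_iff, h]
  rw [hset, List.set_eq_take_append_cons_drop, if_pos (by simp [length_mark]), List.map_take,
    List.map_drop]

theorem exists_weight [Nonempty R] {M : Type} [Monoid M] {T : Type*} {φ : α × Set V → M}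
    {f : List (α × Set (Option V)) → T} (hf : HasAperiodicKer f)
    (hφ : ∀ y z : List (α × Set V), (y.map φ).prod = (z.map φ).prod →
      f (y.map Recognizable.embSome) = f (z.map Recognizable.embSome))
    {w : PointedWord α (Option V) → R} (hw : ∀ p q, f p.mark = f q.mark → w p = w q) :
    ∃ wt : M → α × Set V → M → R, ∀ p : PointedWord α V,
      guessWeight φ wt 1 p.mark 1 = List.ofFn fun i => w (p.extend i) := by
  let key (s : Σ p : PointedWord α V, Fin p.word.length) : M × (α × Set V) × M :=
    (((s.1.mark.take s.2).map φ).prod, s.1.mark[(s.2 : ℕ)]'(s.1.length_mark.symm ▸ s.2.2),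
      ((s.1.mark.drop (s.2 + 1)).map φ).prod)
  have hkey : Function.FactorsThrough (fun s => w (s.1.extend s.2)) key := by
    rintro ⟨p, i⟩ ⟨q, j⟩ h
    obtain ⟨htake, hget, hdrop⟩ := Prod.mk.injEq .. ▸ Prod.mk.injEq .. ▸ h
    refine hw _ _ ?_
    rw [mark_extend, mark_extend, hget]
    exact hf.append (hφ _ _ htake) (hf.append (x := [_]) (x' := [_]) rfl (hφ _ _ hdrop))
  refine ⟨fun l b r => Function.extend key (fun s => w (s.1.extend s.2))
    (fun _ => Classical.arbitrary R) (l, b, r), fun p => ?_⟩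
  refine List.ext_getElem (by simp [guessWeight, length_mark]) fun i hi hi' => ?_
  simp only [guessWeight, List.getElem_ofFn, one_mul, mul_one]
  exact hkey.extend_apply _ ⟨p, ⟨i, by simpa using hi'⟩⟩

theorem exists_aperiodic_usem_eq_sum_condProd [Finite α] [Fintype V] [DecidableEq V]
    {P : PointedWord α V → Prop} (hP : Recognizable P) {w : PointedWord α (Option V) → R}
    (hw : Recognizable w) : ∃ A : WAutomaton α R, A.Aperiodic ∧
      ∀ x : {x : List α // x ≠ []},
        A.usem x = ∑ τ : V → Fin x.1.length, condProd P w ⟨x.1, x.2, τ⟩ := by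
  classical
  cases isEmpty_or_nonempty R with
  | inl _ =>
    exact ⟨.empty α R, WAutomaton.empty_aperiodic, fun x => isEmptyElim (w ⟨x.1, x.2, fun _ =>
      ⟨0, List.length_pos_iff.2 x.2⟩⟩)⟩
  | inr _ =>
    obtain ⟨n, f, hf, hfP⟩ := hP
    obtain ⟨m, f', hf', hfw⟩ := hw
    obtain ⟨M, _, _, φ, hsurj, ⟨N, hN⟩, hker⟩ := HasAperiodicKer.exists_prod_map
      (hf.prodMk ((hf'.comp_map Recognizable.embSome).prodMk hasAperiodicKer_marks))
    simp only [Prod.mk.injEq] at hker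
    have hmarks (y z : List (α × Set V)) (h : (y.map φ).prod = (z.map φ).prod) :
        allMarks y = allMarks z ∧ (MarksDisjoint y ↔ MarksDisjoint z) :=
      ((hker y z).1 h).2.2.imp_right iff_of_eq
    obtain ⟨wt, hwt⟩ := exists_weight hf' (fun y z h => ((hker y z).1 h).2.1) hfw
    have hS := eq_of_mem_acceptedValues hmarks (P := P) hsurj
    refine ⟨guessAutomaton Prod.fst φ (acceptedValues φ P) wt,
      guessAutomaton.aperiodic hS (fun _ => rfl)
        (markCount_le_of_mem_acceptedValues hmarks hsurj) hN, fun x => ?_⟩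
    have hbij := bijOn_mark hmarks
      (fun p q h => iff_of_eq (hfP p q ((hker _ _).1 h).1)) x.2
    rw [guessAutomaton.usem_eq_finsum hS, ← finsum_mem_eq_of_bijOn _ hbij fun τ _ => rfl]
    simp only [hwt]
    rw [finsum_mem_def, finsum_eq_sum_of_fintype]
    refine Finset.sum_congr rfl fun τ _ => ?_
    simp [Set.indicator, condProd]

theorem exists_aperiodic_of_mem_recSeries [Finite α] {G : PointedWord α Empty → Multiset (List R)}
    (hG : G ∈ recSeries α R Empty) :
    ∃ A : WAutomaton α R, A.Aperiodic ∧ ∀ x, A.usem x = G (pureWord x) := by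
  induction hG using AddSubmonoid.closure_induction with
  | mem G hG =>
    obtain ⟨k, P, w, hP, hw, rfl⟩ := hG
    obtain ⟨A, hA, h⟩ := exists_aperiodic_usem_eq_sum_condProd
      (hP.subst (Sum.elim Empty.elim id)) (hw.subst (Option.map (Sum.elim Empty.elim id)))
    refine ⟨A, hA, fun x => (h x).trans (Finset.sum_congr rfl fun τ _ => ?_)⟩
    refine condProd_congr _ _ (iff_of_eq (congrArg P (ext_val _ _ ?_)))
      fun z => congrArg w (ext_val _ _ ?_)
    · rintro (x | j)
      · exact x.elim
      · rfl
    · rintro (_ | x | j)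
      · rfl
      · exact x.elim
      · rfl
  | zero => exact ⟨.empty α R, WAutomaton.empty_aperiodic, fun x => WAutomaton.empty_usem x⟩
  | add G H _ _ ihG ihH =>
    obtain ⟨A, hA, h⟩ := ihG
    obtain ⟨B, hB, h'⟩ := ihH
    exact ⟨.sum A B, hA.sum hB, fun x => by rw [WAutomaton.sum_usem, h, h']; rfl⟩

end

/-! ### Ambiguity and crossing transitions -/

theorem exists_polynomial_eval_lt_two_pow (P : Polynomial ℕ) (c d : ℕ) :
    ∃ n : ℕ, 1 ≤ n ∧ P.eval (c + n * d) < 2 ^ n := by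
  let Q : Polynomial ℝ := (P.map (Nat.castRingHom ℝ)).comp (.C (c : ℝ) + .C (d / Real.log 2) * .X)
  have hlog : Real.log 2 ≠ 0 := (Real.log_pos one_lt_two).ne'
  have hQ (n : ℕ) : Q.eval (n * Real.log 2) = P.eval (c + n * d) := by
    have hcast := Polynomial.eval_natCast_map (Nat.castRingHom ℝ) P (c + n * d)
    rw [eq_natCast, Nat.cast_id] at hcast
    rw [← hcast]
    simp only [Q, Polynomial.eval_comp, Polynomial.eval_add, Polynomial.eval_mul,
      Polynomial.eval_C, Polynomial.eval_X]
    congr 1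
    push_cast
    field_simp
  have hexp (n : ℕ) : Real.exp (n * Real.log 2) = 2 ^ n := by
    rw [Real.exp_nat_mul, Real.exp_log two_pos]
  have hlim := Q.tendsto_div_exp_atTop.comp
    (tendsto_natCast_atTop_atTop.atTop_mul_const (Real.log_pos one_lt_two))
  obtain ⟨n, hn, hn1⟩ :=
    ((hlim.eventually (gt_mem_nhds one_pos)).and (Filter.eventually_ge_atTop 1)).exists
  rw [Function.comp_apply, hQ, hexp, div_lt_one (by positivity)] at hn
  exact ⟨n, hn1, by exact_mod_cast hn⟩

namespace WAutomaton

variable {α : Type u} {R : Type v} {A : WAutomaton α R}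

/-- Reachability of states. -/
def Reach (A : WAutomaton α R) (p q : A.State) : Prop := ∃ ρ, A.IsRun p ρ q

theorem IsRun.reach {p q : A.State} {ρ : List A.Δ} (h : A.IsRun p ρ q) : A.Reach p q := ⟨ρ, h⟩

theorem Reach.refl (p : A.State) : A.Reach p p := ⟨[], rfl⟩

theorem Reach.trans {p q r : A.State} : A.Reach p q → A.Reach q r → A.Reach p r := by
  rintro ⟨ρ, h⟩ ⟨ρ', h'⟩
  exact ⟨ρ ++ ρ', isRun_append.2 ⟨q, h, h'⟩⟩

theorem reach_transition (δ : A.Δ) : A.Reach δ.1.1 δ.1.2.2 := ⟨[δ], rfl, rfl⟩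

/-- A transition is crossing if it leads to another strongly connected component of the automaton;
the runs of a polynomially ambiguous automaton are determined by their crossing transitions. -/
def Crossing (A : WAutomaton α R) (δ : A.Δ) : Prop := ¬ A.Reach δ.1.2.2 δ.1.1

theorem IsRun.reach_of_mem {p q : A.State} {ρ : List A.Δ} (h : A.IsRun p ρ q) {δ : A.Δ}
    (hδ : δ ∈ ρ) : A.Reach p δ.1.1 ∧ A.Reach δ.1.2.2 q := by
  obtain ⟨ρ₁, ρ₂, rfl⟩ := List.append_of_mem hδ
  obtain ⟨r, h₁, rfl, h₂⟩ := isRun_append.1 h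
  exact ⟨h₁.reach, h₂.reach⟩

theorem IsRun.reach_of_not_crossing {ρ : List A.Δ} : ∀ {p q : A.State}, A.IsRun p ρ q →
    (∀ δ ∈ ρ, ¬ A.Crossing δ) → A.Reach q p := by
  induction ρ with
  | nil => exact fun h _ => ⟨[], Eq.symm h⟩
  | cons δ ρ ih =>
    rintro p q ⟨rfl, h⟩ hρ
    rw [List.forall_mem_cons] at hρ
    exact (ih h hρ.2).trans (not_not.1 hρ.1)

theorem IsRun.not_crossing_of_reach {ρ : List A.Δ} {p q : A.State} (h : A.IsRun p ρ q)
    (hqp : A.Reach q p) {δ : A.Δ} (hδ : δ ∈ ρ) : ¬ A.Crossing δ :=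
  not_not.2 (((h.reach_of_mem hδ).2.trans hqp).trans (h.reach_of_mem hδ).1)

theorem IsRun.pairwise_crossing {ρ : List A.Δ} : ∀ {p q : A.State}, A.IsRun p ρ q →
    ρ.Pairwise fun δ δ' => δ = δ' → ¬ A.Crossing δ := by
  induction ρ with
  | nil => simp
  | cons δ ρ ih =>
    rintro p q ⟨rfl, h⟩
    refine List.pairwise_cons.2 ⟨?_, ih h⟩
    rintro δ' hδ' rfl
    exact not_not.2 (h.reach_of_mem hδ').1

theorem IsRun.eq_of_getElem?_eq_crossing {p q : A.State} {ρ : List A.Δ} (h : A.IsRun p ρ q)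
    {δ : A.Δ} (hδ : A.Crossing δ) {i j : ℕ} (hi : ρ[i]? = some δ) (hj : ρ[j]? = some δ) :
    i = j := by
  obtain ⟨hi_lt, rfl⟩ := List.getElem?_eq_some_iff.1 hi
  obtain ⟨hj_lt, hij⟩ := List.getElem?_eq_some_iff.1 hj
  have hpair := List.pairwise_iff_getElem.1 h.pairwise_crossing
  rcases lt_trichotomy i j with hlt | heq | hlt
  · exact absurd hδ (hpair i j hi_lt hj_lt hlt hij.symm)
  · exact heq
  · exact absurd (hij ▸ hδ) (hpair j i hj_lt hi_lt hlt hij)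

theorem isRun_flatten {p : A.State} {l : List (List A.Δ)} (hl : ∀ ρ ∈ l, A.IsRun p ρ p) :
    A.IsRun p l.flatten p := by
  induction l with
  | nil => rfl
  | cons ρ l ih =>
    rw [List.forall_mem_cons] at hl
    exact isRun_append.2 ⟨p, hl.1, ih hl.2⟩

theorem two_pow_le_encard_successfulRuns {p₀ p q₀ : A.State} (hp₀ : p₀ ∈ A.init)
    (hq₀ : q₀ ∈ A.final) {η θ : List A.Δ} (hη : A.IsRun p₀ η p) (hθ : A.IsRun p θ q₀)
    {ρ ρ' : List A.Δ} (hρ : A.IsRun p ρ p) (hρ' : A.IsRun p ρ' p)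
    (hlabel : A.label ρ = A.label ρ') (hne : ρ ≠ ρ') (n : ℕ) :
    (2 ^ n : ℕ) ≤ (A.successfulRuns
      (A.label η ++ wordPow (A.label ρ) n ++ A.label θ)).encard := by
  let loops (b : Fin n → Bool) : List (List A.Δ) := List.ofFn fun i => cond (b i) ρ ρ'
  have hloops (b : Fin n → Bool) : ∀ σ ∈ loops b, A.IsRun p σ p ∧ A.label σ = A.label ρ := by
    intro σ hσ
    obtain ⟨i, rfl⟩ := List.mem_ofFn.1 hσ
    cases b i
    exacts [⟨hρ', hlabel.symm⟩, ⟨hρ, rfl⟩]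
  have hlabels (b : Fin n → Bool) : A.label (loops b).flatten = wordPow (A.label ρ) n := by
    have : (loops b).map A.label = List.replicate n (A.label ρ) := List.eq_replicate_iff.2
      ⟨by simp [loops], by simpa using fun σ hσ => (hloops b σ hσ).2⟩
    rw [wordPow, ← this, label, List.map_flatten]
    rfl
  have hlengths (b : Fin n → Bool) : (loops b).map List.length = List.replicate n ρ.length :=
    List.eq_replicate_iff.2 ⟨by simp [loops], by
      simpa using fun σ hσ => by simpa [label] using congrArg List.length (hloops b σ hσ).2⟩
  have hinj : Function.Injective fun b => η ++ (loops b).flatten ++ θ := by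
    intro b b' h
    have hflatten := List.append_cancel_left (List.append_cancel_right h)
    have hloops_eq : loops b = loops b' :=
      List.eq_iff_flatten_eq.2 ⟨hflatten, (hlengths b).trans (hlengths b').symm⟩
    funext i
    have hi := congrFun (List.ofFn_injective hloops_eq) i
    cases hb : b i <;> cases hb' : b' i <;> simp_all
  have hrange : Set.range (fun b => η ++ (loops b).flatten ++ θ) ⊆
      A.successfulRuns (A.label η ++ wordPow (A.label ρ) n ++ A.label θ) := by
    rintro _ ⟨b, rfl⟩
    refine ⟨p₀, hp₀, q₀, hq₀, isRun_append.2 ⟨p, isRun_append.2 ⟨p, hη, ?_⟩, hθ⟩, ?_⟩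
    · exact isRun_flatten fun σ hσ => (hloops b σ hσ).1
    · rw [label_append, label_append, hlabels]
  refine le_of_eq_of_le ?_ (Set.encard_le_encard hrange)
  rw [← Set.image_univ, hinj.encard_image, Set.encard_univ]
  simp

theorem PolynomiallyAmbiguous.eq_of_loops (hA : A.PolynomiallyAmbiguous) {p₀ p q₀ : A.State}
    (hp₀ : p₀ ∈ A.init) (hq₀ : q₀ ∈ A.final) (h₁ : A.Reach p₀ p) (h₂ : A.Reach p q₀)
    {ρ ρ' : List A.Δ} (hρ : A.IsRun p ρ p) (hρ' : A.IsRun p ρ' p)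
    (hlabel : A.label ρ = A.label ρ') : ρ = ρ' := by
  by_contra hne
  obtain ⟨η, hη⟩ := h₁
  obtain ⟨θ, hθ⟩ := h₂
  obtain ⟨P, hP⟩ := hA
  obtain ⟨n, hn, hlt⟩ := exists_polynomial_eval_lt_two_pow P (η.length + θ.length) ρ.length
  set x := A.label η ++ wordPow (A.label ρ) n ++ A.label θ
  have hlength : x.length = η.length + θ.length + n * ρ.length := by
    simp only [x, List.length_append, length_wordPow, label, List.length_map]
    ring
  have hρ_pos : 0 < ρ.length := by
    rw [List.length_pos_iff]
    rintro rfl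
    exact hne (List.map_eq_nil_iff.1 hlabel.symm).symm
  have hx : x ≠ [] := by
    rw [← List.length_pos_iff, hlength]
    positivity
  have hle := (two_pow_le_encard_successfulRuns hp₀ hq₀ hη hθ hρ hρ' hlabel hne n).trans (hP x hx)
  rw [hlength] at hle
  exact hlt.not_ge (by exact_mod_cast hle)

theorem PolynomiallyAmbiguous.eq_of_reach (hA : A.PolynomiallyAmbiguous)
    {p₀ p q q₀ : A.State} (hp₀ : p₀ ∈ A.init) (hq₀ : q₀ ∈ A.final) (h₁ : A.Reach p₀ p)
    (h₂ : A.Reach q q₀) (hqp : A.Reach q p) {ρ ρ' : List A.Δ} (hρ : A.IsRun p ρ q)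
    (hρ' : A.IsRun p ρ' q) (hlabel : A.label ρ = A.label ρ') : ρ = ρ' := by
  obtain ⟨γ, hγ⟩ := hqp
  exact List.append_cancel_right <| hA.eq_of_loops hp₀ hq₀ h₁ (hρ.reach.trans h₂)
    (isRun_append.2 ⟨q, hρ, hγ⟩) (isRun_append.2 ⟨q, hρ', hγ⟩)
    (by rw [label_append, label_append, hlabel])

/-- Two transitions read the same letter and are equal if one of them is crossing. -/
def CrossingAgree (δ δ' : A.Δ) : Prop :=
  δ.1.2.1 = δ'.1.2.1 ∧ (A.Crossing δ ∨ A.Crossing δ' → δ = δ')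

theorem PolynomiallyAmbiguous.append_eq_append (hA : A.PolynomiallyAmbiguous) {p₀ q₀ : A.State}
    (hp₀ : p₀ ∈ A.init) (hq₀ : q₀ ∈ A.final) {ρ ρ' : List A.Δ}
    (h : List.Forall₂ CrossingAgree ρ ρ') : ∀ {p r r' : A.State} {η η' : List A.Δ},
      A.Reach p₀ p → A.IsRun p η r → A.IsRun p η' r' → A.label η = A.label η' →
      (∀ δ ∈ η, ¬ A.Crossing δ) → (∀ δ ∈ η', ¬ A.Crossing δ) →
      A.IsRun r ρ q₀ → A.IsRun r' ρ' q₀ → η ++ ρ = η' ++ ρ' := by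
  induction h with
  | nil =>
    intro p r r' η η' hp hη hη' hlabel hcη _ hr hr'
    obtain rfl : r = q₀ := hr
    obtain rfl : r' = r := hr'
    rw [hA.eq_of_reach hp₀ hq₀ hp (.refl _) (hη.reach_of_not_crossing hcη) hη hη' hlabel]
  | @cons δ δ' ρ ρ' hδ _ ih =>
    rintro p _ _ η η' hp hη hη' hlabel hcη hcη' ⟨rfl, hr⟩ ⟨rfl, hr'⟩
    by_cases hcross : A.Crossing δ ∨ A.Crossing δ'
    · obtain rfl := hδ.2 hcross
      have hη_eq : η = η' := hA.eq_of_reach hp₀ hq₀ hp ((reach_transition δ).trans hr.reach)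
        (hη.reach_of_not_crossing hcη) hη hη' hlabel
      have hρ_eq : ρ = ρ' := ih (η := []) (η' := [])
        ((hp.trans hη.reach).trans (reach_transition δ)) rfl rfl rfl (by simp) (by simp) hr hr'
      rw [hη_eq, hρ_eq]
    · rw [not_or] at hcross
      have happend := ih (η := η ++ [δ]) (η' := η' ++ [δ']) hp
        (isRun_append.2 ⟨_, hη, rfl, rfl⟩) (isRun_append.2 ⟨_, hη', rfl, rfl⟩)
        (by rw [label_append, label_append, hlabel]; simp [label, hδ.1])
        (List.forall_mem_append.2 ⟨hcη, by simpa using hcross.1⟩)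
        (List.forall_mem_append.2 ⟨hcη', by simpa using hcross.2⟩) hr hr'
      simpa only [List.append_assoc, List.singleton_append] using happend

theorem PolynomiallyAmbiguous.eq_of_crossingAgree (hA : A.PolynomiallyAmbiguous)
    {p₀ q₀ : A.State} (hp₀ : p₀ ∈ A.init) (hq₀ : q₀ ∈ A.final) {ρ ρ' : List A.Δ}
    (h : List.Forall₂ CrossingAgree ρ ρ') (hρ : A.IsRun p₀ ρ q₀) (hρ' : A.IsRun p₀ ρ' q₀) :
    ρ = ρ' :=
  hA.append_eq_append hp₀ hq₀ h (η := []) (η' := []) (.refl p₀) rfl rfl rfl (by simp) (by simp)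
    hρ hρ'

end WAutomaton

/-! ### Runs through prescribed transitions -/

namespace WAutomaton

variable {α : Type u} {R : Type v} {A : WAutomaton α R}

section Compatible

variable {V : Type} {d : V → A.Δ} {D : Set V}

/-- The transition reads the letter, it is the one prescribed by each of the marks, and if it is
crossing, then it is prescribed by a mark in `D`. -/
def Compatible (d : V → A.Δ) (D : Set V) (b : α × Set V) (δ : A.Δ) : Prop :=
  δ.1.2.1 = b.1 ∧ (∀ x ∈ b.2, d x = δ) ∧ (A.Crossing δ → ∃ x ∈ D, x ∈ b.2)

/-- The pairs of states between which there is a run compatible with the marked word. -/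
def compatibleRel (d : V → A.Δ) (D : Set V) (y : List (α × Set V)) : Set (A.State × A.State) :=
  {s | ∃ ρ, A.IsRun s.1 ρ s.2 ∧ List.Forall₂ (Compatible d D) y ρ}

theorem mem_compatibleRel_append {p q : A.State} {y z : List (α × Set V)} :
    (p, q) ∈ compatibleRel d D (y ++ z) ↔
      ∃ r, (p, r) ∈ compatibleRel d D y ∧ (r, q) ∈ compatibleRel d D z := by
  constructor
  · rintro ⟨ρ, hρ, h⟩
    have hy := (List.forall₂_take_append _ _ _ h.flip).flip
    have hz := (List.forall₂_drop_append _ _ _ h.flip).flip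
    rw [← List.take_append_drop y.length ρ] at hρ
    obtain ⟨r, hr, hr'⟩ := isRun_append.1 hρ
    exact ⟨r, ⟨_, hr, hy⟩, ⟨_, hr', hz⟩⟩
  · rintro ⟨r, ⟨ρ, hρ, h⟩, ⟨ρ', hρ', h'⟩⟩
    exact ⟨ρ ++ ρ', isRun_append.2 ⟨r, hρ, hρ'⟩, List.rel_append h h'⟩

theorem compatibleRel_append_congr {x x' y y' : List (α × Set V)}
    (h : compatibleRel d D x = compatibleRel d D x')
    (h' : compatibleRel d D y = compatibleRel d D y') :
    compatibleRel d D (x ++ y) = compatibleRel d D (x' ++ y') := by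
  ext ⟨p, q⟩
  rw [mem_compatibleRel_append, mem_compatibleRel_append, h, h']

theorem forall₂_compatible_iff_of_forall_eq_empty {y : List (α × Set V)} (hy : ∀ b ∈ y, b.2 = ∅)
    {ρ : List A.Δ} : List.Forall₂ (Compatible d D) y ρ ↔
      A.label ρ = y.map Prod.fst ∧ ∀ δ ∈ ρ, ¬ A.Crossing δ := by
  induction y generalizing ρ with
  | nil => cases ρ <;> simp [label]
  | cons b y ih =>
    rw [List.forall_mem_cons] at hy
    cases ρ with
    | nil => simp [label]
    | cons δ ρ =>
      rw [List.forall₂_cons, ih hy.2, List.forall_mem_cons]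
      simp only [Compatible, hy.1, label, List.map_cons, List.cons.injEq, Set.mem_empty_iff_false,
        and_false, exists_false, false_implies, implies_true, true_and]
      exact and_and_and_comm

theorem mem_compatibleRel_iff_of_forall_eq_empty {y : List (α × Set V)} (hy : ∀ b ∈ y, b.2 = ∅)
    {p q : A.State} :
    (p, q) ∈ compatibleRel d D y ↔ A.Reach q p ∧ y.map Prod.fst ∈ A.lang p q := by
  constructor
  · rintro ⟨ρ, hρ, h⟩
    obtain ⟨hlabel, hcross⟩ := (forall₂_compatible_iff_of_forall_eq_empty hy).1 h
    exact ⟨hρ.reach_of_not_crossing hcross, ρ, hρ, hlabel⟩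
  · rintro ⟨hqp, ρ, hρ, hlabel⟩
    exact ⟨ρ, hρ, (forall₂_compatible_iff_of_forall_eq_empty hy).2
      ⟨hlabel, fun _ => hρ.not_crossing_of_reach hqp⟩⟩

theorem compatibleRel_rectangular {y : List (α × Set V)} {b : α × Set V} (hb : b ∈ y) {x : V}
    (hx : x ∈ b.2) {p q p' q' : A.State} (h : (p, q) ∈ compatibleRel d D y)
    (h' : (p', q') ∈ compatibleRel d D y) : (p, q') ∈ compatibleRel d D y := by
  obtain ⟨y₁, y₂, rfl⟩ := List.append_of_mem hb
  have hmark {r s : A.State} (hrs : (r, s) ∈ compatibleRel d D (b :: y₂)) :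
      r = (d x).1.1 ∧ Compatible d D b (d x) ∧ ((d x).1.2.2, s) ∈ compatibleRel d D y₂ := by
    obtain ⟨_, hρ, _ | ⟨hδ, hy₂⟩⟩ := hrs
    obtain rfl := hδ.2.1 x hx
    exact ⟨hρ.1.symm, hδ, _, hρ.2, hy₂⟩
  obtain ⟨r, hpr, hrq⟩ := mem_compatibleRel_append.1 h
  obtain ⟨r', -, hrq'⟩ := mem_compatibleRel_append.1 h'
  obtain ⟨rfl, hδ, -⟩ := hmark hrq
  obtain ⟨-, -, ρ, hρ, hy₂⟩ := hmark hrq'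
  exact mem_compatibleRel_append.2 ⟨_, hpr, d x :: ρ, ⟨rfl, hρ⟩, .cons hδ hy₂⟩

-- A word without marks only allows runs inside a strongly connected component, which are governed
-- by the aperiodicity of `A`; a marked word gives a rectangular relation, which is idempotent.
theorem Aperiodic.hasAperiodicKer_compatibleRel (hA : A.Aperiodic) :
    HasAperiodicKer (compatibleRel d D) where
  append := compatibleRel_append_congr
  exists_wordPow := by
    rw [aperiodic_iff] at hA
    obtain ⟨N, hN⟩ := hA.exists_wordPow
    refine ⟨max N 2, fun y => ?_⟩
    by_cases hy : ∀ b ∈ y, b.2 = ∅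
    · have hpow (n : ℕ) : ∀ b ∈ wordPow y n, b.2 = ∅ := by
        intro b hb
        obtain ⟨z, hz, hbz⟩ := List.mem_flatten.1 hb
        exact hy b (List.eq_of_mem_replicate hz ▸ hbz)
      ext ⟨p, q⟩
      rw [mem_compatibleRel_iff_of_forall_eq_empty (hpow _),
        mem_compatibleRel_iff_of_forall_eq_empty (hpow _), map_wordPow, map_wordPow]
      exact and_congr_right fun _ =>
        Set.ext_iff.1 (hA.wordPow_eq_of_le hN (le_max_left N 2) (y.map Prod.fst)) (p, q)
    · push Not at hy
      obtain ⟨b, hb, x, hx⟩ := hy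
      refine apply_wordPow_eq_of_le (fun h => compatibleRel_append_congr h rfl) ?_
        (le_max_right N 2)
      ext ⟨p, q⟩
      simp only [wordPow_succ, wordPow_zero, List.append_nil, mem_compatibleRel_append]
      constructor
      · rintro ⟨r, hpr, hrq⟩
        exact ⟨r, hpr, r, compatibleRel_rectangular hb hx hrq hpr, hrq⟩
      · rintro ⟨r, hpr, s, hrs, hsq⟩
        exact ⟨r, hpr, compatibleRel_rectangular hb hx hrs hsq⟩

theorem Aperiodic.recognizable_compatibleRel (hA : A.Aperiodic) (d : V → A.Δ)
    (D : Set V) (p q : A.State) :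
    Recognizable fun w : PointedWord α V => (p, q) ∈ compatibleRel d D w.mark :=
  Recognizable.of_hasAperiodicKer hA.hasAperiodicKer_compatibleRel fun _ _ h => by rw [h]

theorem forall₂_compatible_mark_iff {w : PointedWord α V} {ρ : List A.Δ} :
    List.Forall₂ (Compatible d D) w.mark ρ ↔
      A.label ρ = w.word ∧ (∀ x, ρ[(w.val x : ℕ)]? = some (d x)) ∧
        ∀ (i : ℕ) (δ : A.Δ), ρ[i]? = some δ → A.Crossing δ → ∃ x ∈ D, (w.val x : ℕ) = i := by
  rw [List.forall₂_iff_get]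
  constructor
  · rintro ⟨hlen, h⟩
    rw [length_mark] at hlen
    have hget (i : ℕ) (hi : i < w.word.length) := h i (w.length_mark.symm ▸ hi) (hlen ▸ hi)
    simp only [List.get_eq_getElem, getElem_mark, Compatible, Set.mem_ofPred_eq] at hget
    refine ⟨List.ext_getElem (by simp [label, hlen]) fun i _ hi => ?_, fun x => ?_, ?_⟩
    · simpa [label] using (hget i hi).1
    · exact List.getElem?_eq_some_iff.2 ⟨_, ((hget (w.val x) (w.val x).2).2.1 x rfl).symm⟩
    · intro i δ hδ hcross
      obtain ⟨hi, rfl⟩ := List.getElem?_eq_some_iff.1 hδ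
      obtain ⟨x, hx, hxi⟩ := (hget i (hlen ▸ hi)).2.2 hcross
      exact ⟨x, hx, congrArg Fin.val hxi⟩
  · rintro ⟨hlabel, hd, hcross⟩
    have hlen : w.word.length = ρ.length := by simp [← hlabel, label]
    refine ⟨w.length_mark.trans hlen, fun i hi hi' => ?_⟩
    simp only [List.get_eq_getElem, getElem_mark, Compatible, Set.mem_ofPred_eq]
    refine ⟨by simp [← hlabel, label], ?_, fun hδ => ?_⟩
    · intro x hx
      have hdx := hd x
      rw [hx] at hdx
      exact (List.getElem?_eq_some_iff.1 hdx).2.symm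
    · obtain ⟨x, hx, hxi⟩ := hcross i _ (List.getElem?_eq_getElem hi') hδ
      exact ⟨x, hx, Fin.ext hxi⟩

theorem forall₂_compatible_mark_extend_iff {δ : A.Δ} {w : PointedWord α V}
    {i : Fin w.word.length} {ρ : List A.Δ} :
    List.Forall₂ (Compatible (fun o : Option V => o.elim δ d) (Set.range some))
        (w.extend i).mark ρ ↔
      List.Forall₂ (Compatible d Set.univ) w.mark ρ ∧ ρ[(i : ℕ)]? = some δ := by
  simp only [forall₂_compatible_mark_iff, Option.forall, Set.exists_range_iff, Set.mem_univ,
    true_and]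
  exact ⟨fun ⟨hlabel, ⟨hi, hd⟩, hcross⟩ => ⟨⟨hlabel, hd, hcross⟩, hi⟩,
    fun ⟨⟨hlabel, hd, hcross⟩, hi⟩ => ⟨hlabel, ⟨hi, hd⟩, hcross⟩⟩

theorem Compatible.crossingAgree {b : α × Set V} {δ δ' : A.Δ} (h : Compatible d D b δ)
    (h' : Compatible d D b δ') : CrossingAgree δ δ' := by
  refine ⟨h.1.trans h'.1.symm, fun hcross => ?_⟩
  obtain ⟨x, -, hx⟩ := hcross.elim h.2.2 h'.2.2
  exact (h.2.1 x hx).symm.trans (h'.2.1 x hx)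

theorem PolynomiallyAmbiguous.eq_of_compatible (hA : A.PolynomiallyAmbiguous) {p₀ q₀ : A.State}
    (hp₀ : p₀ ∈ A.init) (hq₀ : q₀ ∈ A.final) {y : List (α × Set V)} {ρ ρ' : List A.Δ}
    (hρ : A.IsRun p₀ ρ q₀) (hρ' : A.IsRun p₀ ρ' q₀) (h : List.Forall₂ (Compatible d D) y ρ)
    (h' : List.Forall₂ (Compatible d D) y ρ') : ρ = ρ' := by
  refine hA.eq_of_crossingAgree hp₀ hq₀ ?_ hρ hρ'
  clear hρ hρ'
  induction h generalizing ρ' with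
  | nil => cases h'; exact .nil
  | cons hδ _ ih =>
    obtain _ | ⟨hδ', h'⟩ := h'
    exact .cons (hδ.crossingAgree hδ') (ih h')

end Compatible

open Classical in
/-- The weight of the transition at the position `none` of the run compatible with the other
marks, and a junk value if there is no such run. -/
noncomputable def compatibleWeight [Nonempty R] (p q : A.State) {V : Type} (d : V → A.Δ)
    (w : PointedWord α (Option V)) : R :=
  if h : ∃ δ : A.Δ, (p, q) ∈ compatibleRel (fun o => o.elim δ d) (Set.range some) w.mark then
    A.wgt h.choose else Classical.arbitrary R

theorem Aperiodic.recognizable_compatibleWeight [Finite α] [Nonempty R] (hA : A.Aperiodic)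
    (p q : A.State) {V : Type} (d : V → A.Δ) : Recognizable (compatibleWeight p q d) := by
  classical
  exact (Recognizable.pi fun δ : A.Δ =>
    hA.recognizable_compatibleRel (fun o => o.elim δ d) (Set.range some) p q).comp
      fun S : A.Δ → Prop => if h : ∃ δ, S δ then A.wgt h.choose else Classical.arbitrary R

namespace PolynomiallyAmbiguous

variable {p₀ q₀ : A.State}

theorem compatibleWeight_extend [Nonempty R] (hA : A.PolynomiallyAmbiguous)
    (hp₀ : p₀ ∈ A.init) (hq₀ : q₀ ∈ A.final) {V : Type} {d : V → A.Δ} {w : PointedWord α V}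
    {ρ : List A.Δ} (hρ : A.IsRun p₀ ρ q₀) (h : List.Forall₂ (Compatible d Set.univ) w.mark ρ)
    {i : Fin w.word.length} {δ : A.Δ} (hi : ρ[(i : ℕ)]? = some δ) :
    compatibleWeight p₀ q₀ d (w.extend i) = A.wgt δ := by
  have hex : ∃ δ : A.Δ, (p₀, q₀) ∈ compatibleRel (fun o : Option V => o.elim δ d)
      (Set.range some) (w.extend i).mark :=
    ⟨δ, ρ, hρ, forall₂_compatible_mark_extend_iff.2 ⟨h, hi⟩⟩
  obtain ⟨ρ', hρ', h'⟩ := hex.choose_spec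
  obtain ⟨h', hi'⟩ := forall₂_compatible_mark_extend_iff.1 h'
  obtain rfl := hA.eq_of_compatible hp₀ hq₀ hρ hρ' h h'
  rw [compatibleWeight, dif_pos hex, Option.some_injective _ (hi'.symm.trans hi)]

theorem ofFn_compatibleWeight [Nonempty R] (hA : A.PolynomiallyAmbiguous)
    (hp₀ : p₀ ∈ A.init) (hq₀ : q₀ ∈ A.final) {V : Type} {d : V → A.Δ} {w : PointedWord α V}
    {ρ : List A.Δ} (hρ : A.IsRun p₀ ρ q₀) (h : List.Forall₂ (Compatible d Set.univ) w.mark ρ) :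
    (List.ofFn fun i => compatibleWeight p₀ q₀ d (w.extend i)) = A.weight ρ := by
  have hlen : w.word.length = ρ.length := w.length_mark.symm.trans h.length_eq
  refine List.ext_getElem (by simp [weight, hlen]) fun i _ hi => ?_
  have hi : i < ρ.length := by simpa [weight] using hi
  rw [List.getElem_ofFn, hA.compatibleWeight_extend hp₀ hq₀ hρ h (List.getElem?_eq_getElem hi)]
  simp [weight]

open Classical in
theorem condProd_compatibleWeight [Finite α] [Nonempty R] (hA : A.PolynomiallyAmbiguous)
    (hp₀ : p₀ ∈ A.init) (hq₀ : q₀ ∈ A.final) {V : Type} (d : V → A.Δ) {x : List α}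
    (hx : x ≠ []) (τ : V → Fin x.length) :
    condProd (fun w => (p₀, q₀) ∈ compatibleRel d Set.univ w.mark) (compatibleWeight p₀ q₀ d)
        ⟨x, hx, τ⟩ =
      ∑ ρ ∈ (A.finite_runs p₀ q₀ x).toFinset,
        if List.Forall₂ (Compatible d Set.univ) (⟨x, hx, τ⟩ : PointedWord α V).mark ρ
        then {A.weight ρ} else 0 := by
  by_cases hw : (p₀, q₀) ∈ compatibleRel d Set.univ (⟨x, hx, τ⟩ : PointedWord α V).mark
  · obtain ⟨ρ, hρ, h⟩ := hw
    rw [condProd, if_pos ⟨ρ, hρ, h⟩, hA.ofFn_compatibleWeight hp₀ hq₀ hρ h,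
      Finset.sum_eq_single_of_mem ρ, if_pos h]
    · exact (Set.Finite.mem_toFinset _).2 ⟨hρ, (forall₂_compatible_mark_iff.1 h).1⟩
    · intro ρ' hρ' hne
      have hrun := ((Set.Finite.mem_toFinset _).1 hρ').1
      exact if_neg fun h' => hne (hA.eq_of_compatible hp₀ hq₀ hrun hρ h' h)
  · rw [condProd, if_neg hw]
    refine (Finset.sum_eq_zero fun ρ hρ => if_neg fun h => hw ⟨ρ, ?_, h⟩).symm
    exact ((Set.Finite.mem_toFinset _).1 hρ).1

end PolynomiallyAmbiguous

theorem forall_crossing_mem_iff_of_compatible {V : Type} {d : V → A.Δ} {w : PointedWord α V}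
    {ρ : List A.Δ} (h : List.Forall₂ (Compatible d Set.univ) w.mark ρ) (δ : A.Δ)
    (hδ : A.Crossing δ) : δ ∈ ρ ↔ δ ∈ Set.range d := by
  obtain ⟨-, hd, hcross⟩ := forall₂_compatible_mark_iff.1 h
  constructor
  · intro hmem
    obtain ⟨i, hi⟩ := List.mem_iff_getElem?.1 hmem
    obtain ⟨x, -, rfl⟩ := hcross i δ hi hδ
    exact ⟨x, Option.some_injective _ ((hd x).symm.trans hi)⟩
  · rintro ⟨x, rfl⟩
    exact List.mem_of_getElem? (hd x)

theorem IsRun.existsUnique_compatible {p q : A.State} {ρ : List A.Δ} (hρ : A.IsRun p ρ q)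
    {x : List α} (hlabel : A.label ρ = x) (hx : x ≠ []) {V : Type} {d : V → A.Δ}
    (hd : ∀ v, A.Crossing (d v)) (hmem : ∀ δ, A.Crossing δ → (δ ∈ ρ ↔ δ ∈ Set.range d)) :
    ∃! τ : V → Fin x.length,
      List.Forall₂ (Compatible d Set.univ) (⟨x, hx, τ⟩ : PointedWord α V).mark ρ := by
  have hpos (v : V) : ∃ i : Fin x.length, ρ[(i : ℕ)]? = some (d v) := by
    obtain ⟨i, hi, hiv⟩ := List.getElem_of_mem ((hmem (d v) (hd v)).2 ⟨v, rfl⟩)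
    have hlen : x.length = ρ.length := by simp [← hlabel, label]
    exact ⟨⟨i, hlen ▸ hi⟩, List.getElem?_eq_some_iff.2 ⟨hi, hiv⟩⟩
  choose τ hτ using hpos
  refine ⟨τ, forall₂_compatible_mark_iff.2 ⟨hlabel, hτ, fun i δ hi hδ => ?_⟩, fun τ' hτ' => ?_⟩
  · obtain ⟨v, rfl⟩ := (hmem δ hδ).1 (List.mem_of_getElem? hi)
    exact ⟨v, trivial, hρ.eq_of_getElem?_eq_crossing hδ (hτ v) hi⟩
  · exact funext fun v => Fin.ext <| hρ.eq_of_getElem?_eq_crossing (hd v)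
      ((forall₂_compatible_mark_iff.1 hτ').2.1 v) (hτ v)

open Classical in
theorem IsRun.sum_ite_compatible {p q : A.State} {ρ : List A.Δ} (hρ : A.IsRun p ρ q)
    {x : List α} (hlabel : A.label ρ = x) (hx : x ≠ []) {V : Type} [Fintype V] [DecidableEq V]
    {d : V → A.Δ} (hd : ∀ v, A.Crossing (d v)) {M : Type*} [AddCommMonoid M] (m : M) :
    (∑ τ : V → Fin x.length,
        if List.Forall₂ (Compatible d Set.univ) (⟨x, hx, τ⟩ : PointedWord α V).mark ρ
        then m else 0) =
      if ∀ δ, A.Crossing δ → (δ ∈ ρ ↔ δ ∈ Set.range d) then m else 0 := by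
  split_ifs with hmem
  · obtain ⟨τ, hτ, huniq⟩ := hρ.existsUnique_compatible hlabel hx hd hmem
    rw [Finset.sum_eq_single τ (fun τ' _ hne => if_neg fun h => hne (huniq τ' h)) (by simp),
      if_pos hτ]
  · exact Finset.sum_eq_zero fun τ _ =>
      if_neg fun h => hmem (forall_crossing_mem_iff_of_compatible h)

/-- An enumeration of a set of crossing transitions. -/
noncomputable def enumCrossing (D : Finset {δ : A.Δ // A.Crossing δ}) : Fin D.card → A.Δ :=
  fun j => (D.equivFin.symm j).1.1

theorem mem_range_enumCrossing {D : Finset {δ : A.Δ // A.Crossing δ}} {δ : A.Δ}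
    (hδ : A.Crossing δ) : δ ∈ Set.range (enumCrossing D) ↔ ⟨δ, hδ⟩ ∈ D := by
  constructor
  · rintro ⟨j, rfl⟩
    exact (D.equivFin.symm j).2
  · exact fun hmem => ⟨D.equivFin ⟨_, hmem⟩, by simp [enumCrossing]⟩

open Classical in
theorem PolynomiallyAmbiguous.usemFrom_eq_sum_condProd [Finite α] [Nonempty R]
    [Fintype {δ : A.Δ // A.Crossing δ}] (hA : A.PolynomiallyAmbiguous) {p₀ q₀ : A.State}
    (hp₀ : p₀ ∈ A.init) (hq₀ : q₀ ∈ A.final) {x : List α} (hx : x ≠ []) :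
    A.usemFrom p₀ q₀ x = ∑ D : Finset {δ : A.Δ // A.Crossing δ}, ∑ τ : Fin D.card → Fin x.length,
      condProd (fun w => (p₀, q₀) ∈ compatibleRel (enumCrossing D) Set.univ w.mark)
        (compatibleWeight p₀ q₀ (enumCrossing D)) ⟨x, hx, τ⟩ := by
  have hsum (D : Finset {δ : A.Δ // A.Crossing δ}) :
      ∑ τ : Fin D.card → Fin x.length,
        condProd (fun w => (p₀, q₀) ∈ compatibleRel (enumCrossing D) Set.univ w.mark)
          (compatibleWeight p₀ q₀ (enumCrossing D)) ⟨x, hx, τ⟩ =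
        ∑ ρ ∈ (A.finite_runs p₀ q₀ x).toFinset,
          if Finset.univ.filter (fun δ => δ.1 ∈ ρ) = D then {A.weight ρ} else 0 := by
    rw [Finset.sum_congr rfl fun τ _ => hA.condProd_compatibleWeight hp₀ hq₀ _ hx τ,
      Finset.sum_comm]
    refine Finset.sum_congr rfl fun ρ hρ => ?_
    obtain ⟨hρ, hlabel⟩ := (Set.Finite.mem_toFinset _).1 hρ
    rw [hρ.sum_ite_compatible (d := enumCrossing D) hlabel hx fun j => (D.equivFin.symm j).1.2]
    refine if_congr (.trans ?_ Finset.ext_iff.symm) rfl rfl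
    refine .trans (forall₂_congr fun δ hδ => ?_) Subtype.forall.symm
    rw [mem_range_enumCrossing hδ, Finset.mem_filter_univ]
  rw [usemFrom_eq_sum, Finset.sum_congr rfl fun D _ => hsum D, Finset.sum_comm]
  simp only [Finset.sum_ite_eq, Finset.mem_univ, if_true]

theorem usem_eq_zero_of_isEmpty [Finite α] [IsEmpty R] (A : WAutomaton α R)
    (x : {x : List α // x ≠ []}) : A.usem x = 0 := by
  rw [usem_eq_sum]
  refine Finset.sum_eq_zero fun ρ hρ => ?_
  obtain ⟨_, _, _, _, _, hlabel⟩ := (Set.Finite.mem_toFinset _).1 hρ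
  cases ρ with
  | nil => exact absurd hlabel.symm x.2
  | cons δ ρ => exact isEmptyElim (A.wgt δ)

theorem PolynomiallyAmbiguous.exists_mem_recSeries [Finite α] (hA : A.PolynomiallyAmbiguous)
    (hap : A.Aperiodic) : ∃ G ∈ recSeries α R Empty, ∀ x, A.usem x = G (pureWord x) := by
  classical
  rcases isEmpty_or_nonempty R with _ | _
  · exact ⟨0, zero_mem _, A.usem_eq_zero_of_isEmpty⟩
  have : Fintype {δ : A.Δ // A.Crossing δ} := Fintype.ofFinite _
  refine ⟨∑ p ∈ A.init.toFinite.toFinset, ∑ q ∈ A.final.toFinite.toFinset,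
    ∑ D : Finset {δ : A.Δ // A.Crossing δ}, sumProd D.card
      (fun w => (p, q) ∈ compatibleRel (enumCrossing D) Set.univ (w.subst Sum.inr).mark)
      (fun w => compatibleWeight p q (enumCrossing D) (w.subst (Option.map Sum.inr))), ?_, ?_⟩
  · exact sum_mem fun p _ => sum_mem fun q _ => sum_mem fun D _ =>
      sumProd_mem_recSeries ((hap.recognizable_compatibleRel _ _ p q).subst Sum.inr)
        ((hap.recognizable_compatibleWeight p q _).subst _)
  · intro x
    simp only [Finset.sum_apply]
    refine Finset.sum_congr rfl fun p hp => Finset.sum_congr rfl fun q hq => ?_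
    rw [Set.Finite.mem_toFinset] at hp hq
    rw [hA.usemFrom_eq_sum_condProd hp hq x.2]
    refine Finset.sum_congr rfl fun D _ => Finset.sum_congr rfl fun τ _ => ?_
    refine condProd_congr _ _ Iff.rfl fun i => congrArg _ (ext_val _ _ fun o => ?_)
    cases o <;> rfl

end WAutomaton

/-! ### Ambiguity and number of values -/

namespace WFO

variable {α : Type u} {R : Type v}

/-- A polynomial in the length of the word that bounds the number of values of a formula, each
first-order sum contributing a factor `X`. -/
noncomputable def cardBound : WFO α R → Polynomial ℕ
  | zero => 0
  | prod _ _ => 1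
  | ite _ Φ₁ Φ₂ | add Φ₁ Φ₂ => Φ₁.cardBound + Φ₂.cardBound
  | sum _ Φ => Polynomial.X * Φ.cardBound

theorem card_sem_le_eval_cardBound (Φ : WFO α R) (x : List α) (σ : ℕ → Fin x.length) :
    (Φ.sem x σ).card ≤ Φ.cardBound.eval x.length := by
  induction Φ generalizing σ with
  | zero => simp [sem]
  | prod => simp [sem, cardBound]
  | ite φ Φ₁ Φ₂ ih₁ ih₂ =>
    rw [sem, cardBound, Polynomial.eval_add]
    split_ifs
    · exact Nat.le_add_right_of_le (ih₁ σ)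
    · exact Nat.le_add_left_of_le (ih₂ σ)
  | add Φ₁ Φ₂ ih₁ ih₂ =>
    rw [sem, cardBound, Multiset.card_add, Polynomial.eval_add]
    exact Nat.add_le_add (ih₁ σ) (ih₂ σ)
  | sum y Φ ih =>
    rw [sem, cardBound, Multiset.card_sum, Polynomial.eval_mul, Polynomial.eval_X]
    exact (Finset.sum_le_card_nsmul _ _ _ fun i _ => ih _).trans (by simp)

theorem NoFirstOrderSum.natDegree_cardBound {Φ : WFO α R} (hΦ : Φ.NoFirstOrderSum) :
    Φ.cardBound.natDegree = 0 := by
  induction Φ with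
  | zero => exact Polynomial.natDegree_zero
  | prod => exact Polynomial.natDegree_one
  | ite _ Φ₁ Φ₂ ih₁ ih₂ | add Φ₁ Φ₂ ih₁ ih₂ =>
    exact Nat.le_zero.1 <| (Polynomial.natDegree_add_le _ _).trans <|
      max_le (ih₁ hΦ.1).le (ih₂ hΦ.2).le
  | sum => exact hΦ.elim

theorem card_sem_le_one {Φ : WFO α R} (hΦ : Φ.NoBinarySum) (hΦ' : Φ.NoFirstOrderSum) (x : List α)
    (σ : ℕ → Fin x.length) : (Φ.sem x σ).card ≤ 1 := by
  induction Φ with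
  | zero => simp [sem]
  | prod => simp [sem]
  | ite φ Φ₁ Φ₂ ih₁ ih₂ =>
    rw [sem]
    split_ifs
    · exact ih₁ hΦ.1 hΦ'.1
    · exact ih₂ hΦ.2 hΦ'.2
  | add => exact hΦ.elim
  | sum => exact hΦ'.elim

theorem exists_aperiodic [Finite α] (Φ : WFO α R) :
    ∃ A : WAutomaton α R, A.Aperiodic ∧ A.usem = Φ.usem := by
  obtain ⟨G, hG, h⟩ := Φ.exists_mem_recSeries
  obtain ⟨A, hA, h'⟩ := exists_aperiodic_of_mem_recSeries hG
  exact ⟨A, hA, funext fun x => (h' x).trans (h x).symm⟩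

end WFO

namespace WAutomaton

variable {α : Type u} {R : Type v} [Finite α] {A : WAutomaton α R}

theorem encard_successfulRuns_le_iff {x : List α} (hx : x ≠ []) {n : ℕ} :
    (A.successfulRuns x).encard ≤ n ↔ (A.usem ⟨x, hx⟩).card ≤ n := by
  rw [← A.card_usem ⟨x, hx⟩, Nat.cast_le]

theorem polynomiallyAmbiguous_of_usem_eq {Φ : WFO α R} (h : A.usem = Φ.usem) :
    A.PolynomiallyAmbiguous :=
  ⟨Φ.cardBound, fun _ hx => (encard_successfulRuns_le_iff hx).2 <| by
    rw [h]; exact Φ.card_sem_le_eval_cardBound _ _⟩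

theorem finitelyAmbiguous_of_usem_eq {Φ : WFO α R} (hΦ : Φ.NoFirstOrderSum)
    (h : A.usem = Φ.usem) : A.FinitelyAmbiguous := by
  obtain ⟨k, hk⟩ := Polynomial.natDegree_eq_zero.1 hΦ.natDegree_cardBound
  refine ⟨k, fun x hx => (encard_successfulRuns_le_iff hx).2 ?_⟩
  rw [h]
  exact (Φ.card_sem_le_eval_cardBound _ _).trans_eq (by rw [← hk, Polynomial.eval_C])

theorem unambiguous_of_usem_eq {Φ : WFO α R} (hΦ : Φ.NoBinarySum) (hΦ' : Φ.NoFirstOrderSum)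
    (h : A.usem = Φ.usem) : A.Unambiguous := fun _ hx =>
  mod_cast (encard_successfulRuns_le_iff hx).2 <| by
    rw [h]; exact WFO.card_sem_le_one hΦ hΦ' _ _

theorem PolynomiallyAmbiguous.exists_sentence (hA : A.PolynomiallyAmbiguous) (hap : A.Aperiodic) :
    ∃ Φ : WFO α R, Φ.IsSentence ∧ Φ.usem = A.usem := by
  obtain ⟨G, hG, h⟩ := hA.exists_mem_recSeries hap
  obtain ⟨Φ, hΦ, -, hsem⟩ := (wfoDefinable_of_mem_recSeries hG).exists_sentence
  exact ⟨Φ, hΦ, hsem.trans (funext h).symm⟩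

theorem exists_mem_recStepSeries {k : ℕ} (hap : A.Aperiodic)
    (hk : ∀ x, x ≠ [] → (A.successfulRuns x).encard ≤ k) :
    ∃ G ∈ recStepSeries α R Empty, (∀ p, (G p).card ≤ k) ∧ A.usem = fun x => G (pureWord x) := by
  have hA : A.PolynomiallyAmbiguous := ⟨Polynomial.C k, fun x hx => by simpa using hk x hx⟩
  obtain ⟨G, hG, h⟩ := hA.exists_mem_recSeries hap
  have hcard (p : PointedWord α Empty) : (G p).card ≤ k := by
    have hp : p = pureWord ⟨p.word, p.ne⟩ := PointedWord.ext_val _ _ fun v => v.elim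
    rw [hp, ← h]
    exact (encard_successfulRuns_le_iff p.ne).1 (hk _ p.ne)
  exact ⟨G, mem_recStepSeries_of_card_le hG hcard, hcard, funext h⟩

theorem FinitelyAmbiguous.exists_sentence (hA : A.FinitelyAmbiguous) (hap : A.Aperiodic) :
    ∃ Φ : WFO α R, Φ.IsSentence ∧ Φ.NoFirstOrderSum ∧ Φ.usem = A.usem := by
  obtain ⟨k, hk⟩ := hA
  obtain ⟨G, hG, -, h⟩ := exists_mem_recStepSeries hap hk
  obtain ⟨Φ, hΦ, hsum, hsem⟩ := (wfoDefinable_of_mem_recStepSeries hG).exists_sentence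
  exact ⟨Φ, hΦ, hsum, hsem.trans h.symm⟩

theorem Unambiguous.exists_sentence (hA : A.Unambiguous) (hap : A.Aperiodic) :
    ∃ Φ : WFO α R, Φ.IsSentence ∧ Φ.NoBinarySum ∧ Φ.NoFirstOrderSum ∧ Φ.usem = A.usem := by
  obtain ⟨G, hG, hcard, h⟩ := exists_mem_recStepSeries (k := 1) hap (mod_cast hA)
  obtain ⟨Φ, hΦ, ⟨hadd, hsum⟩, hsem⟩ :=
    (wfoDefinable_of_mem_recStepSeries_of_card_le_one hG hcard).exists_sentence
  exact ⟨Φ, hΦ, hadd, hsum, hsem.trans h.symm⟩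

end WAutomaton

theorem theorem1 {α : Type*} [Finite α] {R : Type*} :
    ({f : {u : List α // u ≠ []} → Multiset (List R) |
        ∃ A : WAutomaton α R, A.Aperiodic ∧ A.PolynomiallyAmbiguous ∧ A.usem = f} =
      {f | ∃ Φ : WFO α R, Φ.IsSentence ∧ Φ.usem = f}) ∧
    ({f : {u : List α // u ≠ []} → Multiset (List R) |
        ∃ A : WAutomaton α R, A.Aperiodic ∧ A.FinitelyAmbiguous ∧ A.usem = f} =
      {f | ∃ Φ : WFO α R, Φ.IsSentence ∧ Φ.NoFirstOrderSum ∧ Φ.usem = f}) ∧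
    ({f : {u : List α // u ≠ []} → Multiset (List R) |
        ∃ A : WAutomaton α R, A.Aperiodic ∧ A.Unambiguous ∧ A.usem = f} =
      {f | ∃ Φ : WFO α R,
        Φ.IsSentence ∧ Φ.NoBinarySum ∧ Φ.NoFirstOrderSum ∧ Φ.usem = f}) := by
  refine ⟨Set.ext fun f => ⟨?_, ?_⟩, Set.ext fun f => ⟨?_, ?_⟩, Set.ext fun f => ⟨?_, ?_⟩⟩
  · rintro ⟨A, hap, hA, rfl⟩
    exact hA.exists_sentence hap
  · rintro ⟨Φ, -, rfl⟩
    obtain ⟨A, hap, h⟩ := Φ.exists_aperiodic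
    exact ⟨A, hap, WAutomaton.polynomiallyAmbiguous_of_usem_eq h, h⟩
  · rintro ⟨A, hap, hA, rfl⟩
    exact hA.exists_sentence hap
  · rintro ⟨Φ, -, hsum, rfl⟩
    obtain ⟨A, hap, h⟩ := Φ.exists_aperiodic
    exact ⟨A, hap, WAutomaton.finitelyAmbiguous_of_usem_eq hsum h, h⟩
  · rintro ⟨A, hap, hA, rfl⟩
    exact hA.exists_sentence hap
  · rintro ⟨Φ, -, hadd, hsum, rfl⟩
    obtain ⟨A, hap, h⟩ := Φ.exists_aperiodic
    exact ⟨A, hap, WAutomaton.unambiguous_of_usem_eq hadd hsum h, h⟩
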